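/- Theorem 1.1. Let $T>0$ and $m,n\ge 1$, and let $B_1\in\mathbb R^{n\times m}$, $B_2\in\mathbb R^{n\times n}$ satisfy the Kalman rank condition $\operatorname{rank}[B_1,B_2B_1,\dots,B_2^{n-1}B_1]=n$. Let $A=(a_{ij})_{1\le i,j\le m}$ be a real symmetric matrix function of $(t,v)\in(0,T)\times\mathbb R^m$ whose entries are Lipschitz on $(0,T)\times\mathbb R^m$ and which is uniformly elliptic: for some $\lambda>1$, $$\lambda^{-1}|\xi|^2\le\sum_{i,j=1}^m a_{ij}(t,v)\xi_i\xi_j\le\lambda|\xi|^2\qquad\text{for all }(t,v)\in(0,T)\times\mathbb R^m,\ \xi\in\mathbb R^m.$$ Let $c$ ($\mathbb R$-valued) and $d$ ($\mathbb R^m$-valued) be bounded measurable functions of $(t,v)\in(0,T)\times\mathbb R^m$, and put $$P=\partial_t+(B_1v+B_2w)\cdot\nabla_w+\operatorname{div}_v\big(A(t,v)\nabla_v\big),\qquad (t,v,w)\in(0,T)\times\mathbb R^m\times\mathbb R^n.$$ Let $u$ be a real- or complex-valued function on $(0,T)\times\mathbb R^m\times\mathbb R^n$ such that $u$ and its distributional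 derivatives $\nabla_vu$ and $(\partial_t+(B_1v+B_2w)\cdot\nabla_w)u$ belong to $L^2((0,T)\times\mathbb R^m\times\mathbb R^n)$. Suppose that $Pu=cu+d\cdot\nabla_vu$ in the sense of distributions on $(0,T)\times\mathbb R^m\times\mathbb R^n$, and that $u$ has zero $L^2$-trace at $t=0$, that is, $\|u(t,\cdot,\cdot)\|_{L^2(\mathbb R^m\times\mathbb R^n)}\to0$ as $t\to0^+$ outside some null set of times $t$. Then $u=0$ almost everywhere on $(0,T)\times\mathbb R^m\times\mathbb R^n$. -/

import Mathlib

open MeasureTheory Filter Topology Set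
open scoped ContDiff Matrix

noncomputable section

namespace Ultraparabolic

/-- The space `ℝ × ℝ^m × ℝ^n` of the variables `(t, v, w)`. -/
abbrev Space (m n : ℕ) : Type :=
  ℝ × EuclideanSpace ℝ (Fin m) × EuclideanSpace ℝ (Fin n)

/-- The open strip `(0, T) × ℝ^m × ℝ^n`. -/
def strip (m n : ℕ) (T : ℝ) : Set (Space m n) := Ioo 0 T ×ˢ univ

/-- The open strip `(0, T) × ℝ^m` of the variables `(t, v)`. -/
def stripV (m : ℕ) (T : ℝ) : Set (ℝ × EuclideanSpace ℝ (Fin m)) := Ioo 0 T ×ˢ univ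

/-- The Kalman matrix `[B₁, B₂ B₁, …, B₂^(n-1) B₁]`: the column `(k, j)` is the `j`-th column of
`B₂ ^ k * B₁`. -/
def kalmanMatrix {m n : ℕ} (B₁ : Matrix (Fin n) (Fin m) ℝ) (B₂ : Matrix (Fin n) (Fin n) ℝ) :
    Matrix (Fin n) (Fin n × Fin m) ℝ :=
  Matrix.of fun i p => (B₂ ^ (p.1 : ℕ) * B₁) i p.2

/-- The drift vector `B₁ v + B₂ w`. -/
def drift {m n : ℕ} (B₁ : Matrix (Fin n) (Fin m) ℝ) (B₂ : Matrix (Fin n) (Fin n) ℝ)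
    (v : EuclideanSpace ℝ (Fin m)) (w : EuclideanSpace ℝ (Fin n)) : EuclideanSpace ℝ (Fin n) :=
  WithLp.toLp 2 (B₁ *ᵥ v.ofLp + B₂ *ᵥ w.ofLp)

/-- Test functions: real `C^∞` functions with compact support in `(0, T) × ℝ^m × ℝ^n`. -/
structure IsTestFunction {m n : ℕ} (T : ℝ) (φ : Space m n → ℝ) : Prop where
  contDiff : ContDiff ℝ ∞ φ
  hasCompactSupport : HasCompactSupport φ
  tsupport_subset : tsupport φ ⊆ strip m n T

/-- The classical partial derivative `∂φ/∂v_j`. -/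
def partialV {m n : ℕ} (j : Fin m) (φ : Space m n → ℝ) (p : Space m n) : ℝ :=
  fderiv ℝ φ p (0, EuclideanSpace.single j 1, 0)

/-- `∂_t φ + div_w ((B₁ v + B₂ w) φ) = ∂_t φ + (B₁ v + B₂ w) · ∇_w φ + (tr B₂) φ`, which is minus
the formal adjoint of `∂_t + (B₁ v + B₂ w) · ∇_w` applied to `φ`. -/
def transportDiv {m n : ℕ} (B₁ : Matrix (Fin n) (Fin m) ℝ) (B₂ : Matrix (Fin n) (Fin n) ℝ)
    (φ : Space m n → ℝ) (p : Space m n) : ℝ :=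
  fderiv ℝ φ p (1, 0, drift B₁ B₂ p.2.1 p.2.2) + B₂.trace * φ p

variable {𝕜 : Type*} [RCLike 𝕜]

/-- `g` is the weak (distributional) partial derivative `∂u/∂v_j` on `(0, T) × ℝ^m × ℝ^n`. -/
def IsWeakPartialV {m n : ℕ} (T : ℝ) (j : Fin m) (u g : Space m n → 𝕜) : Prop :=
  ∀ φ : Space m n → ℝ, IsTestFunction T φ →
    ∫ p in strip m n T, partialV j φ p • u p = - ∫ p in strip m n T, φ p • g p

/-- `f` is the weak (distributional) transport derivative `(∂_t + (B₁ v + B₂ w) · ∇_w) u` on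
`(0, T) × ℝ^m × ℝ^n`. -/
def IsWeakTransport {m n : ℕ} (T : ℝ) (B₁ : Matrix (Fin n) (Fin m) ℝ)
    (B₂ : Matrix (Fin n) (Fin n) ℝ) (u f : Space m n → 𝕜) : Prop :=
  ∀ φ : Space m n → ℝ, IsTestFunction T φ →
    ∫ p in strip m n T, transportDiv B₁ B₂ φ p • u p = - ∫ p in strip m n T, φ p • f p

/-- `P u = c u + d · ∇_v u` in the sense of distributions on `(0, T) × ℝ^m × ℝ^n`, where
`P = ∂_t + (B₁ v + B₂ w) · ∇_w + div_v (A(t, v) ∇_v)` and `G = (G_1, …, G_m)` is the weak gradient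
`∇_v u`. -/
def IsDistributionalSolution {m n : ℕ} (T : ℝ) (B₁ : Matrix (Fin n) (Fin m) ℝ)
    (B₂ : Matrix (Fin n) (Fin n) ℝ)
    (A : ℝ → EuclideanSpace ℝ (Fin m) → Matrix (Fin m) (Fin m) ℝ)
    (c : ℝ → EuclideanSpace ℝ (Fin m) → ℝ)
    (d : ℝ → EuclideanSpace ℝ (Fin m) → EuclideanSpace ℝ (Fin m))
    (u : Space m n → 𝕜) (G : Fin m → Space m n → 𝕜) : Prop :=
  ∀ φ : Space m n → ℝ, IsTestFunction T φ →
    - (∫ p in strip m n T, transportDiv B₁ B₂ φ p • u p)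
      - (∫ p in strip m n T, ∑ i, ∑ j, (A p.1 p.2.1 i j * partialV i φ p) • G j p)
    = ∫ p in strip m n T, φ p • (c p.1 p.2.1 • u p + ∑ j, d p.1 p.2.1 j • G j p)

/-- `g` is the `L²(ℝ^m × ℝ^n)`-trace of `u` at `t = 0`: `u(t, ·) → g` in `L²` as `t → 0⁺`, the
limit being taken after discarding a null set of times (`u` is only defined almost everywhere). -/
def HasL2TraceAtZero {m n : ℕ} (u : Space m n → 𝕜)
    (g : EuclideanSpace ℝ (Fin m) × EuclideanSpace ℝ (Fin n) → 𝕜) : Prop :=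
  MemLp g 2 volume ∧
    Tendsto (fun t : ℝ => eLpNorm (fun z => u (t, z) - g z) 2 volume)
      (𝓝[>] 0 ⊓ ae volume) (𝓝 0)

end Ultraparabolic

end

/-!
For `∂_t u = - div_v (A ∇_v u)` the Cauchy problem at `t = 0` is ill-posed, so uniqueness does not
follow from an energy estimate. It follows from a Carleman estimate in time alone, which applies
because the coefficients do not depend on `w`.

*Straightening.* With `Q' = exp (- t B₂) B₁` and `Q(0) = 0`, the change of variables
`w ↦ exp (- t B₂) w - Q(t) v` (`straighten`) turns the transport field into `∂_t` and `∂_{v_i}` into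
`D_i = ∂_{v_i} - ∑ k, Q_{k i}(t) ∂_{w_k}`. Since the trace at `t = 0` vanishes, the weak equations
persist for test functions that do not vanish near `t = 0`
(`tendsto_integral_deriv_initCutoff`); after a cutoff `χ(t)` that is `1` for `t < T₁`, the solution
is extended by zero to all times (`StripSystem.weakSystem`). It satisfies `∂_t u = F + R` with
`F = - D · (A D u)`, where `R` consists of terms of lower order and of a source that vanishes for
`t < T₁`.

*Frequency localization.* Averages in `w` with a kernel whose Fourier transform has compact support
commute with the equation (`WeakSystem.avgW`) and turn the derivatives in `w` into bounded operators
(`exists_hasBoundedW`). The commutator of `∂_t` with `D_i` is then bounded, and the time derivative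
of the energy `⟨ϑ(t) F, u⟩` equals `2 ⟨ϑ F, ∂_t u⟩` up to terms controlled by `u` and its gradient
along `v` (`WeakSystem.exists_dirichlet_inequality`). This is proved with difference quotients in
time: derivatives in `L²` are derivatives of the group of translations, and the Lipschitz bound of
`A` in time is all that is needed of the coefficients.

*Carleman estimate.* Let the weight be `ω = exp (κ exp (- α t))` and `p = κ α exp (- α t)`, so that
`ω' = - p ω` and `p' = - α p`. The energy identity with the weight `p ω²` and the inequality for the
Dirichlet energy with the weight `ω²` add up to a square `‖ω (F - p u)‖²` and the positive term
`α ⟨p ω u, ω u⟩`, which for large `α` absorbs the terms of lower order (`carleman_algebra`). There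
remains `‖ω u‖² ≤ 3 ‖ω E₀‖²` with the source `E₀` supported in `t ≥ T₁` (`WeakSystem.carleman`). As
`κ → ∞` this forces `u = 0` for `t < T₁`, first for the localized functions and then in the limit of
kernels that concentrate (`WeakSystem.vanish`).
-/

noncomputable section

namespace Ultraparabolic

set_option linter.unusedSectionVars false

/-! ### Translations and multiplication operators on `L²` -/

section Multipliers

variable {E : Type*} [MeasurableSpace E] {μ : Measure E}

/-- A multiplier: a measurable function that is bounded everywhere. -/
def IsMultiplier (b : E → ℝ) : Prop := Measurable b ∧ ∃ C, ∀ e, |b e| ≤ C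

lemma IsMultiplier.memLp {b : E → ℝ} (hb : IsMultiplier b) {x : E → ℝ} (hx : MemLp x 2 μ) :
    MemLp (fun e => b e * x e) 2 μ := by
  obtain ⟨hm, C, hC⟩ := hb
  refine MemLp.of_le_mul (c := C) hx (hm.aestronglyMeasurable.mul hx.1) (Eventually.of_forall ?_)
  intro e
  rw [norm_mul]
  exact mul_le_mul_of_nonneg_right (hC e) (norm_nonneg _)

open Classical in
/-- Multiplication by the function `b` on `L²(E)`; it is `0` by convention when `b` is not a
multiplier. -/
def mulL (μ : Measure E) (b : E → ℝ) : Lp ℝ 2 μ →L[ℝ] Lp ℝ 2 μ :=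
  if hb : IsMultiplier b then
    LinearMap.mkContinuous
      { toFun := fun x => (hb.memLp (Lp.memLp x)).toLp _
        map_add' := fun x y => by
          rw [← MemLp.toLp_add]
          apply MemLp.toLp_congr
          filter_upwards [Lp.coeFn_add x y] with e he
          rw [he]; simp [mul_add]
        map_smul' := fun r x => by
          rw [RingHom.id_apply, ← MemLp.toLp_const_smul]
          apply MemLp.toLp_congr
          filter_upwards [Lp.coeFn_smul r x] with e he
          rw [he]; simp; ring }
      hb.2.choose (fun x => by
        refine Lp.norm_le_mul_norm_of_ae_le_mul ?_
        filter_upwards [(hb.memLp (Lp.memLp x)).coeFn_toLp] with e he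
        simp only [LinearMap.coe_mk, AddHom.coe_mk]
        rw [he, norm_mul]
        exact mul_le_mul_of_nonneg_right (hb.2.choose_spec e) (norm_nonneg _))
  else 0

lemma coeFn_mulL {b : E → ℝ} (hb : IsMultiplier b) (x : Lp ℝ 2 μ) :
    mulL μ b x =ᵐ[μ] fun e => b e * x e := by
  unfold mulL
  rw [dif_pos hb]
  exact (hb.memLp (Lp.memLp x)).coeFn_toLp

lemma IsMultiplier.const (r : ℝ) : IsMultiplier (fun _ : E => r) :=
  ⟨measurable_const, |r|, fun _ => le_rfl⟩

lemma IsMultiplier.mul {b c : E → ℝ} (hb : IsMultiplier b) (hc : IsMultiplier c) :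
    IsMultiplier (fun e => b e * c e) := by
  obtain ⟨hbm, B, hB⟩ := hb
  obtain ⟨hcm, C, hC⟩ := hc
  refine ⟨hbm.mul hcm, B * C, fun e => ?_⟩
  rw [abs_mul]
  exact mul_le_mul (hB e) (hC e) (abs_nonneg _) ((abs_nonneg _).trans (hB e))

lemma IsMultiplier.add {b c : E → ℝ} (hb : IsMultiplier b) (hc : IsMultiplier c) :
    IsMultiplier (fun e => b e + c e) := by
  obtain ⟨hbm, B, hB⟩ := hb
  obtain ⟨hcm, C, hC⟩ := hc
  exact ⟨hbm.add hcm, B + C, fun e => (abs_add_le _ _).trans (add_le_add (hB e) (hC e))⟩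

lemma IsMultiplier.neg {b : E → ℝ} (hb : IsMultiplier b) : IsMultiplier (fun e => - b e) :=
  ⟨hb.1.neg, hb.2.imp fun _ hC e => by rw [abs_neg]; exact hC e⟩

lemma IsMultiplier.sub {b c : E → ℝ} (hb : IsMultiplier b) (hc : IsMultiplier c) :
    IsMultiplier (fun e => b e - c e) := by
  simpa only [sub_eq_add_neg] using hb.add hc.neg

lemma IsMultiplier.comp_add_right {E : Type*} [NormedAddCommGroup E] [MeasurableSpace E]
    [BorelSpace E] {b : E → ℝ} (hb : IsMultiplier b) (a : E) :
    IsMultiplier (fun e => b (e + a)) :=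
  ⟨hb.1.comp (measurable_id.add_const a), hb.2.imp fun _ hC _ => hC _⟩

lemma mulL_mulL {b c : E → ℝ} (hb : IsMultiplier b) (hc : IsMultiplier c) (x : Lp ℝ 2 μ) :
    mulL μ b (mulL μ c x) = mulL μ (fun e => b e * c e) x := by
  apply Lp.ext
  filter_upwards [coeFn_mulL hb (mulL μ c x), coeFn_mulL hc x, coeFn_mulL (hb.mul hc) x]
    with e h1 h2 h3
  rw [h1, h2, h3, mul_assoc]

lemma mulL_comm {b c : E → ℝ} (hb : IsMultiplier b) (hc : IsMultiplier c) (x : Lp ℝ 2 μ) :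
    mulL μ b (mulL μ c x) = mulL μ c (mulL μ b x) := by
  rw [mulL_mulL hb hc, mulL_mulL hc hb]
  simp only [mul_comm]

lemma mulL_add_fun {b c : E → ℝ} (hb : IsMultiplier b) (hc : IsMultiplier c) (x : Lp ℝ 2 μ) :
    mulL μ (fun e => b e + c e) x = mulL μ b x + mulL μ c x := by
  apply Lp.ext
  filter_upwards [coeFn_mulL hb x, coeFn_mulL hc x, coeFn_mulL (hb.add hc) x,
    Lp.coeFn_add (mulL μ b x) (mulL μ c x)] with e h1 h2 h3 h4
  rw [h4, Pi.add_apply, h1, h2, h3, add_mul]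

lemma mulL_sub_fun {b c : E → ℝ} (hb : IsMultiplier b) (hc : IsMultiplier c) (x : Lp ℝ 2 μ) :
    mulL μ (fun e => b e - c e) x = mulL μ b x - mulL μ c x := by
  apply Lp.ext
  filter_upwards [coeFn_mulL hb x, coeFn_mulL hc x, coeFn_mulL (hb.sub hc) x,
    Lp.coeFn_sub (mulL μ b x) (mulL μ c x)] with e h1 h2 h3 h4
  rw [h4, Pi.sub_apply, h1, h2, h3, sub_mul]

lemma mulL_const (r : ℝ) (x : Lp ℝ 2 μ) : mulL μ (fun _ => r) x = r • x := by
  apply Lp.ext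
  filter_upwards [coeFn_mulL (IsMultiplier.const r) x, Lp.coeFn_smul r x] with e h1 h2
  rw [h1, h2]; rfl

/-- Multipliers that agree where `x` does not vanish act in the same way on `x`. -/
lemma mulL_congr {b c : E → ℝ} (hb : IsMultiplier b) (hc : IsMultiplier c) {x : Lp ℝ 2 μ}
    (h : ∀ᵐ e ∂μ, x e ≠ 0 → b e = c e) : mulL μ b x = mulL μ c x := by
  apply Lp.ext
  filter_upwards [coeFn_mulL hb x, coeFn_mulL hc x, h] with e h1 h2 h3
  rw [h1, h2]
  by_cases hx : x e = 0
  · simp [hx]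
  · rw [h3 hx]

lemma real_inner_eq_integral (x y : Lp ℝ 2 μ) : inner ℝ x y = ∫ e, x e * y e ∂μ := by
  rw [L2.inner_def]
  simp [mul_comm]

lemma integrable_mul_Lp (x y : Lp ℝ 2 μ) : Integrable (fun e => x e * y e) μ := by
  simpa [mul_comm] using L2.integrable_inner (𝕜 := ℝ) x y

lemma inner_mulL_left {b : E → ℝ} (hb : IsMultiplier b) (x y : Lp ℝ 2 μ) :
    inner ℝ (mulL μ b x) y = inner ℝ x (mulL μ b y) := by
  rw [real_inner_eq_integral, real_inner_eq_integral]
  apply integral_congr_ae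
  filter_upwards [coeFn_mulL hb x, coeFn_mulL hb y] with e h1 h2
  rw [h1, h2]; ring

lemma norm_mulL_le {b : E → ℝ} (hb : Measurable b) {C : ℝ} (hC : ∀ e, |b e| ≤ C)
    (x : Lp ℝ 2 μ) : ‖mulL μ b x‖ ≤ C * ‖x‖ := by
  refine Lp.norm_le_mul_norm_of_ae_le_mul ?_
  filter_upwards [coeFn_mulL ⟨hb, C, hC⟩ x] with e he
  rw [he, norm_mul]
  exact mul_le_mul_of_nonneg_right (hC e) (norm_nonneg _)

/-- Comparison of the quadratic forms of two multipliers. -/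
lemma inner_mulL_mono {b c : E → ℝ} (hb : IsMultiplier b) (hc : IsMultiplier c) {x : Lp ℝ 2 μ}
    (h : ∀ᵐ e ∂μ, x e ≠ 0 → b e ≤ c e) :
    inner ℝ (mulL μ b x) x ≤ inner ℝ (mulL μ c x) x := by
  rw [real_inner_eq_integral, real_inner_eq_integral]
  apply integral_mono_ae (integrable_mul_Lp _ _) (integrable_mul_Lp _ _)
  filter_upwards [coeFn_mulL hb x, coeFn_mulL hc x, h] with e h1 h2 h3
  simp only [h1, h2]
  by_cases hx : x e = 0
  · simp [hx]
  · nlinarith [h3 hx, mul_self_nonneg (x e)]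

end Multipliers

section Translations

variable {E : Type*} [NormedAddCommGroup E] [NormedSpace ℝ E] [FiniteDimensional ℝ E]
  [MeasurableSpace E] [BorelSpace E] {μ : Measure E} [μ.IsAddHaarMeasure]

/-- The translation `x ↦ x (· + a)` as an isometry of `L²(E)`. -/
def translate (μ : Measure E) [μ.IsAddHaarMeasure] (a : E) : Lp ℝ 2 μ →ₗᵢ[ℝ] Lp ℝ 2 μ :=
  Lp.compMeasurePreservingₗᵢ ℝ (· + a) (measurePreserving_add_right μ a)

lemma coeFn_translate (a : E) (x : Lp ℝ 2 μ) : translate μ a x =ᵐ[μ] fun e => x (e + a) :=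
  Lp.coeFn_compMeasurePreserving x (measurePreserving_add_right μ a)

lemma ae_add_right {p : E → Prop} (a : E) (h : ∀ᵐ e ∂μ, p e) : ∀ᵐ e ∂μ, p (e + a) :=
  (measurePreserving_add_right μ a).quasiMeasurePreserving.ae h

lemma translate_toLp {φ : E → ℝ} (hφ : MemLp φ 2 μ) (a : E) :
    translate μ a (hφ.toLp φ) =
      (hφ.comp_measurePreserving (measurePreserving_add_right μ a)).toLp _ := rfl

@[simp] lemma translate_zero (x : Lp ℝ 2 μ) : translate μ 0 x = x := by
  apply Lp.ext
  filter_upwards [coeFn_translate (0 : E) x] with e he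
  simp [he]

lemma translate_add (a b : E) (x : Lp ℝ 2 μ) :
    translate μ (a + b) x = translate μ a (translate μ b x) := by
  apply Lp.ext
  filter_upwards [coeFn_translate (a + b) x, coeFn_translate a (translate μ b x),
    ae_add_right a (coeFn_translate b x)] with e h1 h2 h3
  rw [h1, h2, h3, add_assoc]

lemma translate_translate_neg (a : E) (x : Lp ℝ 2 μ) :
    translate μ a (translate μ (-a) x) = x := by
  rw [← translate_add]; simp

lemma translate_comm (a b : E) (x : Lp ℝ 2 μ) :
    translate μ a (translate μ b x) = translate μ b (translate μ a x) := by
  rw [← translate_add, add_comm, translate_add]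

lemma inner_translate_left (a : E) (x y : Lp ℝ 2 μ) :
    inner ℝ (translate μ a x) y = inner ℝ x (translate μ (-a) y) := by
  rw [← (translate μ a).inner_map_map x, translate_translate_neg]

lemma continuous_translate {X : Type*} [TopologicalSpace X] {a : X → E} {x : X → Lp ℝ 2 μ}
    (ha : Continuous a) (hx : Continuous x) : Continuous fun r => translate μ (a r) (x r) := by
  have h : Continuous fun r : X => (⟨fun e => e + a r, by fun_prop⟩ : C(E, E)) := by
    have : Continuous fun q : X × E => q.2 + a q.1 := by fun_prop
    exact (ContinuousMap.mk _ this).curry.continuous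
  exact hx.compMeasurePreservingLp h (fun r => measurePreserving_add_right μ (a r)) (by simp)

lemma translate_mulL {b : E → ℝ} (hb : IsMultiplier b) (a : E) (x : Lp ℝ 2 μ) :
    translate μ a (mulL μ b x) = mulL μ (fun e => b (e + a)) (translate μ a x) := by
  apply Lp.ext
  filter_upwards [coeFn_translate a (mulL μ b x), coeFn_translate a x,
    ae_add_right a (coeFn_mulL hb x), coeFn_mulL (hb.comp_add_right a) (translate μ a x)]
    with e h1 h2 h3 h4
  rw [h1, h3, h4, h2]

/-- Multiplication by a function that does not change along `a` commutes with the translation. -/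
lemma translate_mulL_of_invariant {b : E → ℝ} (hb : IsMultiplier b) {a : E}
    (h : ∀ e, b (e + a) = b e) (x : Lp ℝ 2 μ) :
    translate μ a (mulL μ b x) = mulL μ b (translate μ a x) := by
  rw [translate_mulL hb]; simp only [h]

end Translations

/-! ### Strong and weak directional derivatives in `L²` -/

section Derivatives

variable {E : Type*} [NormedAddCommGroup E] [NormedSpace ℝ E] [FiniteDimensional ℝ E]
  [MeasurableSpace E] [BorelSpace E] {μ : Measure E} [μ.IsAddHaarMeasure]

/-- `g` is the strong `L²` derivative of `u` in the direction `a`: the difference quotients of the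
translates of `u` along `a` converge to `g` in `L²`. -/
def IsDeriv (a : E) (u g : Lp ℝ 2 μ) : Prop :=
  HasDerivAt (fun h : ℝ => translate μ (h • a) u) g 0

lemma IsDeriv.hasLineDerivAt {a : E} {u g : Lp ℝ 2 μ} (h : IsDeriv a u g) (y : E) :
    HasLineDerivAt ℝ (fun y => translate μ y u) (translate μ y g) y a := by
  have := ((translate μ y).toContinuousLinearMap.hasFDerivAt.comp_hasDerivAt (0 : ℝ) h)
  refine this.congr_of_eventuallyEq (Eventually.of_forall fun s => ?_)
  simp [translate_add]

lemma IsDeriv.map {a : E} {u g : Lp ℝ 2 μ} (h : IsDeriv a u g) (L : Lp ℝ 2 μ →L[ℝ] Lp ℝ 2 μ)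
    (hL : ∀ (s : ℝ) x, translate μ (s • a) (L x) = L (translate μ (s • a) x)) :
    IsDeriv a (L u) (L g) := by
  refine (L.hasFDerivAt.comp_hasDerivAt (0 : ℝ) h).congr_of_eventuallyEq
    (Eventually.of_forall fun s => ?_)
  simp [hL]

lemma IsDeriv.translated {a : E} {u g : Lp ℝ 2 μ} (h : IsDeriv a u g) (b : E) :
    IsDeriv a (translate μ b u) (translate μ b g) :=
  h.map (translate μ b).toContinuousLinearMap fun s x => translate_comm (s • a) b x

lemma IsDeriv.smul_dir {a : E} {u g : Lp ℝ 2 μ} (h : IsDeriv a u g) (r : ℝ) :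
    IsDeriv (r • a) u (r • g) := by
  have h1 : HasDerivAt (fun s : ℝ => s * r) r 0 := by simpa using (hasDerivAt_id (0:ℝ)).mul_const r
  have h0 : HasDerivAt (fun s : ℝ => translate μ (s • a) u) g ((0:ℝ) * r) := by
    rw [zero_mul]; exact h
  refine (h0.scomp (0:ℝ) h1).congr_of_eventuallyEq (Eventually.of_forall fun s => ?_)
  simp [mul_smul]

/-- Smooth compactly supported functions on `E`. -/
structure IsTest (φ : E → ℝ) : Prop where
  contDiff : ContDiff ℝ ∞ φ
  hasCompactSupport : HasCompactSupport φ

lemma IsTest.memLp {φ : E → ℝ} (h : IsTest φ) : MemLp φ 2 μ :=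
  h.contDiff.continuous.memLp_of_hasCompactSupport h.hasCompactSupport

lemma IsTest.fderiv_apply {φ : E → ℝ} (h : IsTest φ) (a : E) : IsTest (fun e => fderiv ℝ φ e a) :=
  ⟨(h.contDiff.fderiv_right (m := ∞) (by simp)).clm_apply contDiff_const,
    h.hasCompactSupport.fderiv_apply (𝕜 := ℝ) a⟩

lemma IsTest.comp_add_right {φ : E → ℝ} (h : IsTest φ) (a : E) : IsTest (fun e => φ (e + a)) :=
  ⟨h.contDiff.comp (contDiff_id.add contDiff_const),
    h.hasCompactSupport.comp_homeomorph (Homeomorph.addRight a)⟩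

/-- First order Taylor estimate for a function with Lipschitz derivative. -/
lemma taylor_one_le {f f' : ℝ → ℝ} (hf : ∀ r, HasDerivAt f (f' r) r) {K : ℝ}
    (hK : ∀ r, |f' r - f' 0| ≤ K * |r|) (h : ℝ) : |f h - f 0 - h * f' 0| ≤ K * h ^ 2 := by
  have hK0 : 0 ≤ K * |h| := (abs_nonneg _).trans (hK h)
  have := (convex_uIcc 0 h).norm_image_sub_le_of_norm_hasDerivWithin_le
    (f := fun r => f r - r * f' 0) (f' := fun r => f' r - f' 0) (C := K * |h|)
    (fun r _ => ((hf r).sub (by simpa using (hasDerivAt_id r).mul_const (f' 0))).hasDerivWithinAt)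
    (fun r hr => by
      rcases eq_or_ne h 0 with rfl | hh
      · simp only [uIcc_self, mem_singleton_iff] at hr; subst hr; simp
      · have hKn : 0 ≤ K := nonneg_of_mul_nonneg_left hK0 (abs_pos.2 hh)
        refine (hK r).trans (mul_le_mul_of_nonneg_left ?_ hKn)
        simpa using abs_sub_left_of_mem_uIcc hr)
    left_mem_uIcc right_mem_uIcc
  simp only [Real.norm_eq_abs, zero_mul, sub_zero] at this
  calc |f h - f 0 - h * f' 0| = |f h - h * f' 0 - f 0| := by congr 1; ring
    _ ≤ K * |h| * |h| := this
    _ = K * h ^ 2 := by rw [mul_assoc, abs_mul_abs_self, sq]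

/-- A quadratic remainder gives a derivative. -/
lemma hasDerivAt_zero_of_norm_le {F : Type*} [NormedAddCommGroup F] [NormedSpace ℝ F]
    {f : ℝ → F} {f' : F} {K : ℝ} (h : ∀ s, |s| ≤ 1 → ‖f s - f 0 - s • f'‖ ≤ K * s ^ 2) :
    HasDerivAt f f' 0 := by
  rw [hasDerivAt_iff_isLittleO]
  simp only [sub_zero]
  have h1 : (fun s : ℝ => f s - f 0 - s • f') =O[𝓝 0] fun s : ℝ => s ^ 2 := by
    refine Asymptotics.IsBigO.of_bound K ?_
    filter_upwards [Metric.closedBall_mem_nhds (0:ℝ) one_pos] with s hs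
    have := h s (by simpa using hs)
    simpa using this
  exact h1.trans_isLittleO (Asymptotics.isLittleO_pow_id one_lt_two)

lemma IsTest.lipschitz_fderiv {φ : E → ℝ} (h : IsTest φ) (a : E) :
    ∃ K : ℝ, 0 ≤ K ∧ ∀ x y, |fderiv ℝ φ x a - fderiv ℝ φ y a| ≤ K * ‖x - y‖ := by
  obtain ⟨C, hC⟩ := ContDiff.lipschitzWith_of_hasCompactSupport (h.fderiv_apply a).hasCompactSupport
    (h.fderiv_apply a).contDiff (by simp)
  exact ⟨C, C.2, fun x y => by simpa [dist_eq_norm] using hC.dist_le_mul x y⟩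

/-- The classical derivative of a test function is its strong `L²` derivative. -/
lemma IsTest.isDeriv {φ : E → ℝ} (h : IsTest φ) (a : E) :
    IsDeriv a (h.memLp (μ := μ).toLp φ) ((h.fderiv_apply a).memLp.toLp _) := by
  obtain ⟨K, hK0, hK⟩ := h.lipschitz_fderiv a
  obtain ⟨R, hR⟩ := h.hasCompactSupport.isCompact.isBounded.subset_closedBall (0 : E)
  set S : Set E := Metric.closedBall (0 : E) (R + ‖a‖) with hS
  have hSm : MeasurableSet S := measurableSet_closedBall
  have hSμ : μ S ≠ ⊤ := (isCompact_closedBall _ _).measure_lt_top.ne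
  refine hasDerivAt_zero_of_norm_le
    (K := K * ‖a‖ * ‖indicatorConstLp 2 hSm hSμ (1:ℝ)‖) fun s hs => ?_
  rw [show K * ‖a‖ * ‖indicatorConstLp 2 hSm hSμ (1:ℝ)‖ * s ^ 2
    = K * ‖a‖ * s ^ 2 * ‖indicatorConstLp 2 hSm hSμ (1:ℝ)‖ by ring]
  refine Lp.norm_le_mul_norm_of_ae_le_mul ?_
  simp only [zero_smul, translate_zero]
  filter_upwards [coeFn_translate (s • a) (h.memLp (μ := μ).toLp φ),
    ae_add_right (s • a) (h.memLp (μ := μ).coeFn_toLp), h.memLp (μ := μ).coeFn_toLp,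
    (h.fderiv_apply a).memLp (μ := μ).coeFn_toLp,
    Lp.coeFn_sub (translate μ (s • a) (h.memLp.toLp φ) - h.memLp.toLp φ)
      (s • (h.fderiv_apply a).memLp.toLp _),
    Lp.coeFn_sub (translate μ (s • a) (h.memLp.toLp φ)) (h.memLp.toLp φ),
    Lp.coeFn_smul s ((h.fderiv_apply a).memLp (μ := μ).toLp _),
    indicatorConstLp_coeFn (p := 2) (hs := hSm) (hμs := hSμ) (c := (1:ℝ))]
    with e h1 h2 h3 h4 h5 h6 h7 h8
  rw [h5, Pi.sub_apply, h6, Pi.sub_apply, h7, Pi.smul_apply, h1, h2, h3, h4, h8]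
  by_cases he : e ∈ S
  · rw [indicator_of_mem he, norm_one, mul_one, Real.norm_eq_abs]
    have hd : ∀ r : ℝ, HasDerivAt (fun r : ℝ => φ (e + r • a)) (fderiv ℝ φ (e + r • a) a) r := by
      intro r
      have h1 : HasDerivAt (fun r : ℝ => e + r • a) a r := by
        simpa using ((hasDerivAt_id r).smul_const a).const_add e
      exact ((h.contDiff.differentiable (by simp)) _).hasFDerivAt.comp_hasDerivAt r h1
    have := taylor_one_le hd (K := K * ‖a‖) (fun r => by
      refine (hK _ _).trans (le_of_eq ?_)
      simp [norm_smul]; ring) s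
    simpa using this
  · have hout : ∀ x : E, R < ‖x‖ → x ∉ tsupport φ := fun x hx hx' =>
      absurd (mem_closedBall_zero_iff.1 (hR hx')) (not_le.2 hx)
    have heR : R + ‖a‖ < ‖e‖ := by simpa [hS] using he
    have h1 : φ (e + s • a) = 0 := by
      refine image_eq_zero_of_notMem_tsupport (hout _ ?_)
      have : ‖s • a‖ ≤ ‖a‖ := by
        rw [norm_smul]; exact mul_le_of_le_one_left (norm_nonneg _) hs
      have := norm_sub_le (e + s • a) (s • a)
      rw [add_sub_cancel_right] at this
      linarith
    have h2 : e ∉ tsupport φ := hout _ (by linarith [norm_nonneg a])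
    have h3 : fderiv ℝ φ e = 0 := by
      by_contra hne
      exact h2 (support_fderiv_subset ℝ hne)
    rw [h1, image_eq_zero_of_notMem_tsupport h2, h3]
    simp [indicator_of_notMem he]

/-- Test functions are dense in `L²`. -/
lemma dense_test : Dense {x : Lp ℝ 2 μ | ∃ φ : E → ℝ, ∃ h : IsTest φ, x = h.memLp.toLp φ} := by
  refine (Lp.dense_hasCompactSupport_contDiff (F := ℝ) (μ := μ) (p := 2) (by simp)).mono ?_
  rintro x ⟨φ, h1, h2, h3⟩
  refine ⟨φ, ⟨h3, h2⟩, Lp.ext ?_⟩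
  filter_upwards [h1, (IsTest.memLp (μ := μ) ⟨h3, h2⟩).coeFn_toLp] with e h4 h5
  rw [h4, h5]

lemma eq_of_inner_test {x y : Lp ℝ 2 μ}
    (h : ∀ (φ : E → ℝ) (hφ : IsTest φ), inner ℝ x (hφ.memLp.toLp φ) = inner ℝ y (hφ.memLp.toLp φ)) :
    x = y := by
  refine dense_test.eq_of_inner_left (𝕜 := ℝ) ?_
  rintro _ ⟨φ, hφ, rfl⟩
  exact h φ hφ

lemma translate_test {φ : E → ℝ} (h : IsTest φ) (a : E) :
    translate μ a (h.memLp.toLp φ) = (h.comp_add_right a).memLp.toLp _ := rfl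

lemma translate_test_fderiv {φ : E → ℝ} (h : IsTest φ) (a b : E) :
    translate μ a ((h.fderiv_apply b).memLp.toLp _) =
      ((h.comp_add_right a).fderiv_apply b).memLp.toLp _ := by
  rw [translate_toLp]
  apply MemLp.toLp_congr
  refine Eventually.of_forall fun e => ?_
  simp only [Function.comp]
  rw [fderiv_comp_add_right]

/-- A weak `L²` derivative is a strong one. -/
lemma isDeriv_of_weak {a : E} {u g : Lp ℝ 2 μ}
    (h : ∀ (φ : E → ℝ) (hφ : IsTest φ), inner ℝ u ((hφ.fderiv_apply a).memLp.toLp _) =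
      - inner ℝ g (hφ.memLp.toLp φ)) : IsDeriv a u g := by
  have hcont : ∀ x : Lp ℝ 2 μ, Continuous fun r : ℝ => translate μ (r • a) x := fun x =>
    continuous_translate (by fun_prop) continuous_const
  have key : ∀ s : ℝ, translate μ (s • a) u = u + ∫ r in (0:ℝ)..s, translate μ (r • a) g := by
    intro s
    refine eq_of_inner_test fun φ hφ => ?_
    have hder : ∀ r : ℝ, HasDerivAt (fun r : ℝ => inner ℝ (translate μ (r • a) u) (hφ.memLp.toLp φ))
        (inner ℝ (translate μ (r • a) g) (hφ.memLp.toLp φ)) r := by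
      intro r
      have h1 := (hφ.isDeriv (μ := μ) a).translated (-(r • a))
      have h2 : HasDerivAt (fun s : ℝ => translate μ (-(s • a)) (hφ.memLp.toLp φ))
          (-translate μ (-(r • a)) ((hφ.fderiv_apply a).memLp.toLp _)) r := by
        have h3 : HasDerivAt (fun s : ℝ => r - s) (-1) r := by
          simpa using (hasDerivAt_id r).const_sub r
        have h1' : HasDerivAt (fun h : ℝ => translate μ (h • a) (translate μ (-(r • a))
          (hφ.memLp (μ := μ).toLp φ))) (translate μ (-(r • a)) ((hφ.fderiv_apply a).memLp.toLp _)) (r - r) := by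
          rw [sub_self]; exact h1
        have := h1'.scomp r h3
        simp only [neg_smul, one_smul] at this
        refine this.congr_of_eventuallyEq (Eventually.of_forall fun s => ?_)
        simp only [Function.comp]
        rw [← translate_add]
        congr 2
        rw [sub_smul]; abel
      have h4 := (innerSL ℝ u).hasFDerivAt.comp_hasDerivAt r h2
      simp only [innerSL_apply_apply, Function.comp_def] at h4
      have h5 : inner ℝ u (-translate μ (-(r • a)) ((hφ.fderiv_apply a).memLp.toLp _)) =
          inner ℝ (translate μ (r • a) g) (hφ.memLp.toLp φ) := by
        rw [inner_neg_right, translate_test_fderiv hφ, h _ (hφ.comp_add_right _), neg_neg,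
          inner_translate_left, translate_test hφ]
      rw [h5] at h4
      simpa only [inner_translate_left] using h4
    have hint : IntervalIntegrable (fun r : ℝ => translate μ (r • a) g) volume 0 s :=
      (hcont g).intervalIntegrable _ _
    rw [inner_add_left]
    have h6 : inner ℝ (∫ r in (0:ℝ)..s, translate μ (r • a) g) (hφ.memLp.toLp φ) =
        ∫ r in (0:ℝ)..s, inner ℝ (translate μ (r • a) g) (hφ.memLp.toLp φ) := by
      rw [real_inner_comm]
      have := (innerSL ℝ (hφ.memLp (μ := μ).toLp φ)).intervalIntegral_comp_comm hint
      simp only [innerSL_apply_apply] at this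
      rw [← this]
      simp only [real_inner_comm]
    rw [h6, intervalIntegral.integral_eq_sub_of_hasDerivAt (fun r _ => hder r)]
    · simp
    · exact ((hcont g).inner continuous_const).intervalIntegrable _ _
  have hd := (intervalIntegral.integral_hasDerivAt_right (a := (0:ℝ)) (b := 0)
    ((hcont g).intervalIntegrable _ _)
    ((hcont g).stronglyMeasurableAtFilter _ _) (hcont g).continuousAt).const_add u
  simp only [zero_smul, translate_zero] at hd
  exact hd.congr_of_eventuallyEq (Eventually.of_forall key)

lemma IsDeriv.weak {a : E} {u g : Lp ℝ 2 μ} (h : IsDeriv a u g) {φ : E → ℝ} (hφ : IsTest φ) :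
    inner ℝ u ((hφ.fderiv_apply a).memLp.toLp _) = - inner ℝ g (hφ.memLp.toLp φ) := by
  have h1 := (innerSL ℝ (hφ.memLp (μ := μ).toLp φ)).hasFDerivAt.comp_hasDerivAt (0 : ℝ) h
  have h2 : HasDerivAt (fun s : ℝ => translate μ (-(s • a)) (hφ.memLp.toLp φ))
          (-((hφ.fderiv_apply a).memLp (μ := μ).toLp _)) (0:ℝ) := by
    have := (hφ.isDeriv (μ := μ) a).smul_dir (-1)
    unfold IsDeriv at this
    simpa using this
  have h3 := (innerSL ℝ u).hasFDerivAt.comp_hasDerivAt (0 : ℝ) h2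
  simp only [innerSL_apply_apply, Function.comp_def, ← inner_translate_left,
    inner_neg_right] at h1 h3
  simp only [real_inner_comm _ (hφ.memLp (μ := μ).toLp φ)] at h1
  have := h1.unique h3
  rw [this]
  simp

end Derivatives

/-! ### Averages of translates -/

section Averages

variable {E : Type*} [NormedAddCommGroup E] [NormedSpace ℝ E] [FiniteDimensional ℝ E]
  [MeasurableSpace E] [BorelSpace E] {μ : Measure E} [μ.IsAddHaarMeasure]
  {V : Type*} [NormedAddCommGroup V] [NormedSpace ℝ V] [FiniteDimensional ℝ V]
  [MeasurableSpace V] [BorelSpace V] {ν : Measure V} [ν.IsAddHaarMeasure]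

lemma integrable_smul_translate (ι : V →L[ℝ] E) {ρ : V → ℝ} (hρ : Integrable ρ ν)
    (x : Lp ℝ 2 μ) : Integrable (fun y => ρ y • translate μ (ι y) x) ν := by
  have hc : Continuous fun y : V => translate μ (ι y) x :=
    continuous_translate ι.continuous continuous_const
  have hs : AEStronglyMeasurable (fun y => ρ y • translate μ (ι y) x) ν :=
    hρ.1.smul hc.aestronglyMeasurable
  refine (hρ.norm.mul_const ‖x‖).mono' hs (Eventually.of_forall fun y => ?_)
  rw [norm_smul, LinearIsometry.norm_map]

open Classical in
/-- The average `∫ ρ(y) τ_{ι y} x dy` of the translates of `x` along `ι : V → E` with the weight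
`ρ`; it is `0` by convention when `ρ` is not integrable. -/
def average (μ : Measure E) [μ.IsAddHaarMeasure] (ν : Measure V) (ι : V →L[ℝ] E) (ρ : V → ℝ) :
    Lp ℝ 2 μ →L[ℝ] Lp ℝ 2 μ :=
  if hρ : Integrable ρ ν ∧ ν.IsAddHaarMeasure then
    LinearMap.mkContinuous
      { toFun := fun x => ∫ y, ρ y • translate μ (ι y) x ∂ν
        map_add' := fun x y => by
          have := hρ.2
          rw [← integral_add (integrable_smul_translate ι hρ.1 x)
            (integrable_smul_translate ι hρ.1 y)]
          simp only [map_add, smul_add]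
        map_smul' := fun r x => by
          rw [RingHom.id_apply, ← integral_smul]
          simp only [map_smul, smul_comm r] }
      (∫ y, ‖ρ y‖ ∂ν) (fun x => by
        refine (norm_integral_le_integral_norm _).trans (le_of_eq ?_)
        simp only [norm_smul, LinearIsometry.norm_map]
        rw [integral_mul_const])
  else 0

lemma average_apply (ι : V →L[ℝ] E) {ρ : V → ℝ} (hρ : Integrable ρ ν) (x : Lp ℝ 2 μ) :
    average μ ν ι ρ x = ∫ y, ρ y • translate μ (ι y) x ∂ν := by
  unfold average
  rw [dif_pos ⟨hρ, inferInstance⟩]; rfl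

/-- An operator commuting with the translations along `ι` commutes with the averages. -/
lemma map_average {ι : V →L[ℝ] E} {ρ : V → ℝ} (hρ : Integrable ρ ν)
    (L : Lp ℝ 2 μ →L[ℝ] Lp ℝ 2 μ)
    (hL : ∀ y x, L (translate μ (ι y) x) = translate μ (ι y) (L x)) (x : Lp ℝ 2 μ) :
    L (average μ ν ι ρ x) = average μ ν ι ρ (L x) := by
  rw [average_apply ι hρ, average_apply ι hρ,
    ← L.integral_comp_comm (integrable_smul_translate ι hρ x)]
  simp only [map_smul, hL]

lemma translate_average {ι : V →L[ℝ] E} {ρ : V → ℝ} (hρ : Integrable ρ ν) (a : E)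
    (x : Lp ℝ 2 μ) :
    translate μ a (average μ ν ι ρ x) = average μ ν ι ρ (translate μ a x) :=
  map_average hρ (translate μ a).toContinuousLinearMap (fun y x => translate_comm a (ι y) x) x

lemma inner_average_left {ι : V →L[ℝ] E} {ρ : V → ℝ} (hρ : Integrable ρ ν) (x y : Lp ℝ 2 μ) :
    inner ℝ (average μ ν ι ρ x) y = ∫ w, ρ w * inner ℝ (translate μ (ι w) x) y ∂ν := by
  rw [average_apply ι hρ, real_inner_comm]
  have := (innerSL ℝ y).integral_comp_comm (integrable_smul_translate ι hρ x)
  simp only [innerSL_apply_apply, inner_smul_right] at this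
  rw [← this]
  simp only [real_inner_comm]

lemma integrable_mul_inner_translate (ι : V →L[ℝ] E) {ρ : V → ℝ} (hρ : Integrable ρ ν)
    (x y : Lp ℝ 2 μ) : Integrable (fun w => ρ w * inner ℝ (translate μ (ι w) x) y) ν := by
  have := (innerSL ℝ y).integrable_comp (integrable_smul_translate ι hρ x)
  simpa only [innerSL_apply_apply, inner_smul_right, real_inner_comm] using this

/-- Composition of averages corresponds to convolution of the weights. -/
lemma average_average {ι : V →L[ℝ] E} {ρ σ κ : V → ℝ} (hρ : Integrable ρ ν)
    (hσ : Integrable σ ν) (hκ : Integrable κ ν)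
    (h : ∀ y, ∫ w, σ (y - w) * ρ w ∂ν = κ y) (x : Lp ℝ 2 μ) :
    average μ ν ι σ (average μ ν ι ρ x) = average μ ν ι κ x := by
  rw [map_average hρ (average μ ν ι σ) (fun y x => (translate_average hσ _ x).symm),
    average_apply ι hκ, average_apply ι hρ]
  have hint : Integrable (fun p : V × V => (ρ p.2 * σ (p.1 - p.2)) • translate μ (ι p.1) x)
      (ν.prod ν) := by
    have h1 := hρ.convolution_integrand (ContinuousLinearMap.mul ℝ ℝ) hσ
    have hc : Continuous fun p : V × V => translate μ (ι p.1) x :=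
      continuous_translate (by fun_prop) continuous_const
    refine (h1.norm.mul_const ‖x‖).mono' (h1.1.smul hc.aestronglyMeasurable)
      (Eventually.of_forall fun p => ?_)
    rw [norm_smul, LinearIsometry.norm_map]; simp
  have h2 : ∀ w, ρ w • translate μ (ι w) (average μ ν ι σ x) =
      ∫ y, (ρ w * σ (y - w)) • translate μ (ι y) x ∂ν := by
    intro w
    rw [translate_average hσ, average_apply ι hσ, ← integral_smul,
      ← integral_sub_right_eq_self _ w]
    refine integral_congr_ae (Eventually.of_forall fun y => ?_)
    simp only
    rw [← translate_add, smul_smul, map_sub, sub_add_cancel]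
  simp only [h2]
  rw [integral_integral_swap]
  · refine integral_congr_ae (Eventually.of_forall fun y => ?_)
    simp only
    rw [integral_smul_const, ← h y]
    simp only [mul_comm]
  · exact hint.swap

/-- An average with a differentiable weight is differentiable. -/
lemma isDeriv_average {ι : V →L[ℝ] E} {ρ ρ' : V → ℝ} {b : V} (hρ : Integrable ρ ν)
    (hρ' : Integrable ρ' ν) (hd : ∀ y, HasLineDerivAt ℝ ρ (ρ' y) y b) (x : Lp ℝ 2 μ) :
    IsDeriv (ι b) (average μ ν ι ρ x) (- average μ ν ι ρ' x) := by
  refine isDeriv_of_weak fun φ hφ => ?_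
  have hd2 : ∀ y : V, HasLineDerivAt ℝ
      (fun y => inner ℝ (translate μ (ι y) x) (hφ.memLp.toLp φ))
      (- inner ℝ (translate μ (ι y) x) ((hφ.fderiv_apply (ι b)).memLp.toLp _)) y b := by
    intro y
    have h1 := ((hφ.isDeriv (μ := μ) (ι b)).smul_dir (-1)).hasLineDerivAt (-(ι y))
    have h2 := (innerSL ℝ x).hasFDerivAt.comp_hasDerivAt (0 : ℝ) h1
    simp only [Function.comp_def, innerSL_apply_apply, neg_smul, one_smul, map_neg] at h2
    unfold HasLineDerivAt
    simp only [inner_translate_left]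
    refine h2.congr_of_eventuallyEq (Eventually.of_forall fun s => ?_)
    simp only
    congr 3
    simp [add_comm]
  have hi := fun (σ : V → ℝ) (hσ : Integrable σ ν) y =>
    integrable_mul_inner_translate (μ := μ) ι hσ x y
  have := integral_bilinear_hasLineDerivAt_right_eq_neg_left_of_integrable
    (B := ContinuousLinearMap.mul ℝ ℝ) (μ := ν) (f := ρ) (f' := ρ')
    (g := fun y => inner ℝ (translate μ (ι y) x) (hφ.memLp.toLp φ))
    (g' := fun y => - inner ℝ (translate μ (ι y) x) ((hφ.fderiv_apply (ι b)).memLp.toLp _))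
    (v := b) (hi _ hρ' _) (by simpa using (hi _ hρ _).neg) (hi _ hρ _) (fun y _ => hd y)
    (fun y _ => hd2 y)
  simp only [ContinuousLinearMap.mul_apply', mul_neg, integral_neg, neg_inj] at this
  rw [inner_average_left hρ, this, inner_neg_left, inner_average_left hρ', neg_neg]

/-- Averaging a derivative moves the derivative to the weight. -/
lemma average_deriv {ι : V →L[ℝ] E} {ρ ρ' : V → ℝ} {b : V} (hρ : Integrable ρ ν)
    (hρ' : Integrable ρ' ν) (hd : ∀ y, HasLineDerivAt ℝ ρ (ρ' y) y b) {u g : Lp ℝ 2 μ}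
    (h : IsDeriv (ι b) u g) : average μ ν ι ρ g = - average μ ν ι ρ' u := by
  have h1 := h.map (average μ ν ι ρ) fun s x => translate_average hρ _ x
  exact h1.unique (isDeriv_average hρ hρ' hd u)

/-- Averages over shrinking neighbourhoods of `0` converge to the identity. -/
lemma tendsto_average (ι : V →L[ℝ] E) {ρ : V → ℝ} (hρ : Integrable ρ ν)
    (h1 : ∫ y, ρ y ∂ν = 1) (x : Lp ℝ 2 μ) :
    Tendsto (fun k : ℕ => average μ ν ((1 / ((k : ℝ) + 1)) • ι) ρ x) atTop (𝓝 x) := by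
  suffices Tendsto (fun k : ℕ => average μ ν ((1 / ((k : ℝ) + 1)) • ι) ρ x) atTop
      (𝓝 (∫ y, ρ y • x ∂ν)) by
    rwa [integral_smul_const, h1, one_smul] at this
  simp only [average_apply _ hρ]
  refine tendsto_integral_of_dominated_convergence (fun y => ‖ρ y‖ * ‖x‖)
    (fun k => (integrable_smul_translate _ hρ x).1) (hρ.norm.mul_const _)
    (fun k => Eventually.of_forall fun y => ?_) (Eventually.of_forall fun y => ?_)
  · rw [norm_smul, LinearIsometry.norm_map]
  · refine Tendsto.const_smul ?_ _
    have hc : Continuous fun r : ℝ => translate μ ((r • ι) y) x :=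
      continuous_translate (by simp only [_root_.smul_apply]; fun_prop)
        continuous_const
    have := (hc.tendsto 0).comp tendsto_one_div_add_atTop_nhds_zero_nat
    simpa [Function.comp_def] using this

end Averages

/-! ### Band-limited kernels -/

section BandLimited

open scoped FourierTransform SchwartzMap Convolution

variable {V : Type*} [NormedAddCommGroup V] [InnerProductSpace ℝ V] [FiniteDimensional ℝ V]
  [MeasurableSpace V] [BorelSpace V]

/-- A smooth bump function on the frequency side, as a complex Schwartz function. -/
def bumpSchwartz (β : ContDiffBump (0 : V)) : 𝓢(V, ℂ) :=
  HasCompactSupport.toSchwartzMap (f := fun x => ((β x : ℝ) : ℂ))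
    (β.hasCompactSupport.comp_left Complex.ofReal_zero)
    (Complex.ofRealCLM.contDiff.comp β.contDiff)

lemma bumpSchwartz_apply (β : ContDiffBump (0 : V)) (x : V) :
    bumpSchwartz β x = ((β x : ℝ) : ℂ) := rfl

/-- The inverse Fourier transform of an even real function is real. -/
lemma ofReal_re_fourierInv_bump (β : ContDiffBump (0 : V)) (x : V) :
    (((𝓕⁻ (bumpSchwartz β) x).re : ℝ) : ℂ) = 𝓕⁻ (bumpSchwartz β) x := by
  rw [← Complex.conj_eq_iff_re, SchwartzMap.fourierInv_coe, Real.fourierInv_eq', ← integral_conj,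
    ← integral_neg_eq_self]
  refine integral_congr_ae (Eventually.of_forall fun v => ?_)
  simp only [bumpSchwartz_apply, smul_eq_mul, map_mul, Complex.conj_ofReal, ← Complex.exp_conj,
    inner_neg_left, β.neg]
  congr 2
  simp

lemma convolution_fourierInv_bump {β γ : ContDiffBump (0 : V)} (h : β.rOut ≤ γ.rIn) (y : V) :
    ∫ w, 𝓕⁻ (bumpSchwartz β) w * 𝓕⁻ (bumpSchwartz γ) (y - w) = 𝓕⁻ (bumpSchwartz β) y := by
  have h1 := SchwartzMap.convolution_apply (ContinuousLinearMap.mul ℂ ℂ) (𝓕⁻ (bumpSchwartz β))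
    (𝓕⁻ (bumpSchwartz γ)) y
  rw [convolution_def] at h1
  simp only [ContinuousLinearMap.mul_apply'] at h1
  rw [← h1]
  have h2 : 𝓕 (SchwartzMap.convolution (ContinuousLinearMap.mul ℂ ℂ) (𝓕⁻ (bumpSchwartz β))
      (𝓕⁻ (bumpSchwartz γ))) = bumpSchwartz β := by
    rw [SchwartzMap.fourier_convolution]
    ext x
    simp only [SchwartzMap.pairing_apply_apply, FourierTransform.fourier_fourierInv_eq,
      bumpSchwartz_apply, ContinuousLinearMap.mul_apply']
    by_cases hx : dist x 0 < β.rOut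
    · rw [γ.one_of_mem_closedBall (Metric.mem_closedBall.2 (hx.le.trans h))]; simp
    · rw [β.zero_of_le_dist (not_lt.1 hx)]; simp
  conv_rhs => rw [← h2]
  rw [FourierTransform.fourierInv_fourier_eq]

/-- There are real integrable kernels `ρ` and `σ` with `ρ * σ = ρ`, `∫ ρ = 1` and `σ` smooth with
integrable derivatives: both are band-limited, and the Fourier transform of `σ` is `1` on the
support of that of `ρ`. -/
lemma exists_bandlimited (V : Type*) [NormedAddCommGroup V] [InnerProductSpace ℝ V]
    [FiniteDimensional ℝ V] [MeasurableSpace V] [BorelSpace V] :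
    ∃ ρ σ : V → ℝ, Integrable ρ ∧ Integrable σ ∧ ∫ y, ρ y = 1 ∧
      (∀ y, ∫ w, σ (y - w) * ρ w = ρ y) ∧ Differentiable ℝ σ ∧
      ∀ b, Integrable fun y => fderiv ℝ σ y b := by
  let β : ContDiffBump (0 : V) := ⟨1, 2, one_pos, one_lt_two⟩
  let γ : ContDiffBump (0 : V) := ⟨2, 3, two_pos, by norm_num⟩
  have hγd : Differentiable ℝ ⇑(𝓕⁻ (bumpSchwartz γ) : 𝓢(V, ℂ)) := (𝓕⁻ (bumpSchwartz γ)).differentiable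
  refine ⟨fun y => (𝓕⁻ (bumpSchwartz β) y).re, fun y => (𝓕⁻ (bumpSchwartz γ) y).re,
    (𝓕⁻ (bumpSchwartz β)).integrable.re, (𝓕⁻ (bumpSchwartz γ)).integrable.re, ?_, ?_, ?_, ?_⟩
  · have h1 : 𝓕 (𝓕⁻ (bumpSchwartz β)) 0 = 1 := by
      rw [FourierTransform.fourier_fourierInv_eq, bumpSchwartz_apply,
        β.one_of_mem_closedBall (by simp [β])]
      simp
    rw [SchwartzMap.fourier_coe, Real.fourier_eq'] at h1
    simp only [inner_zero_right, mul_zero, Complex.ofReal_zero, zero_mul, Complex.exp_zero,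
      one_smul] at h1
    have := integral_re (𝕜 := ℂ) (𝓕⁻ (bumpSchwartz β)).integrable (μ := volume)
    simp only [RCLike.re_to_complex] at this
    rw [this, h1, Complex.one_re]
  · intro y
    have := convolution_fourierInv_bump (β := β) (γ := γ) le_rfl y
    rw [← Complex.ofReal_inj, ofReal_re_fourierInv_bump, ← this, ← integral_complex_ofReal]
    refine integral_congr_ae (Eventually.of_forall fun w => ?_)
    simp only [Complex.ofReal_mul, ofReal_re_fourierInv_bump]
    rw [mul_comm]
  · exact Complex.reCLM.differentiable.comp hγd
  · intro b
    have h1 : ∀ y, fderiv ℝ (fun y => (𝓕⁻ (bumpSchwartz γ) y).re) y b =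
        (fderiv ℝ ⇑(𝓕⁻ (bumpSchwartz γ) : 𝓢(V, ℂ)) y b).re := by
      intro y
      have := (Complex.reCLM.hasFDerivAt.comp y (hγd y).hasFDerivAt).fderiv
      simp only [Function.comp_def, Complex.reCLM_apply] at this
      rw [this]; rfl
    simp only [h1]
    have h2 := (LineDeriv.lineDerivOp b (𝓕⁻ (bumpSchwartz γ) : 𝓢(V, ℂ))).integrable (μ := volume)
    exact h2.re.congr (Eventually.of_forall fun y => by
      simp [SchwartzMap.lineDerivOp_apply_eq_fderiv])

end BandLimited

/-! ### Weak equations tested with `L²` functions -/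

section WeakEquations

variable {E : Type*} [NormedAddCommGroup E] [NormedSpace ℝ E] [FiniteDimensional ℝ E]
  [MeasurableSpace E] [BorelSpace E] {μ : Measure E} [μ.IsAddHaarMeasure]

lemma IsTest.integrable {φ : E → ℝ} (h : IsTest φ) : Integrable φ μ :=
  h.contDiff.continuous.integrable_of_hasCompactSupport h.hasCompactSupport

lemma exists_mollifier (μ : Measure E) [μ.IsAddHaarMeasure] :
    ∃ η : E → ℝ, IsTest η ∧ ∫ e, η e ∂μ = 1 := by
  let β : ContDiffBump (0 : E) := ⟨1, 2, one_pos, one_lt_two⟩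
  exact ⟨β.normed μ, ⟨β.contDiff_normed, β.hasCompactSupport_normed⟩, β.integral_normed⟩

/-- A first order weak equation may be tested with every `L²` function that has strong derivatives
in the directions of the equation. The test functions need not be cut off: after averaging with
the kernel `η`, both sides depend continuously on the `L²` norm of the function alone, so that it
suffices that test functions are dense in `L²`. -/
lemma weak_eq_extend {γ : Type*} [Fintype γ] {dir : γ → E} {a : γ → Lp ℝ 2 μ} {F : Lp ℝ 2 μ}
    (h : ∀ (φ : E → ℝ) (hφ : IsTest φ),
      ∑ i, inner ℝ (a i) ((hφ.fderiv_apply (dir i)).memLp.toLp _) = inner ℝ F (hφ.memLp.toLp φ))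
    {x : Lp ℝ 2 μ} {x' : γ → Lp ℝ 2 μ} (hx : ∀ i, IsDeriv (dir i) x (x' i)) :
    ∑ i, inner ℝ (a i) (x' i) = inner ℝ F x := by
  obtain ⟨η, hη, hη1⟩ := exists_mollifier μ
  have hηi : Integrable η μ := hη.integrable
  have key : ∀ k : ℕ, ∑ i, inner ℝ (a i)
      (average μ μ ((1 / ((k : ℝ) + 1)) • ContinuousLinearMap.id ℝ E) η (x' i)) =
      inner ℝ F (average μ μ ((1 / ((k : ℝ) + 1)) • ContinuousLinearMap.id ℝ E) η x) := by
    intro k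
    set ι : E →L[ℝ] E := (1 / ((k : ℝ) + 1)) • ContinuousLinearMap.id ℝ E with hι
    have hιd : ∀ i, ι (((k : ℝ) + 1) • dir i) = dir i := fun i => by
      have : (k : ℝ) + 1 ≠ 0 := by positivity
      simp [hι, smul_smul, this]
    set η' : γ → E → ℝ := fun i e => fderiv ℝ η e (((k : ℝ) + 1) • dir i)
    have hη'i : ∀ i, Integrable (η' i) μ := fun i => (hη.fderiv_apply _).integrable
    have hd : ∀ i y, HasLineDerivAt ℝ η (η' i y) y (((k : ℝ) + 1) • dir i) := fun i y =>
      ((hη.contDiff.differentiable (by simp)) y).hasFDerivAt.hasLineDerivAt _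
    have hmove : ∀ {y : Lp ℝ 2 μ} {y' : γ → Lp ℝ 2 μ}, (∀ i, IsDeriv (dir i) y (y' i)) →
        ∀ i, average μ μ ι η (y' i) = - average μ μ ι (η' i) y := by
      intro y y' hy i
      have hi : IsDeriv (ι (((k : ℝ) + 1) • dir i)) y (y' i) := by rw [hιd]; exact hy i
      exact average_deriv hηi (hη'i i) (hd i) hi
    -- for arbitrary `y` in `L²`, by density
    have hall : ∀ y : Lp ℝ 2 μ, ∑ i, inner ℝ (a i) (- average μ μ ι (η' i) y) =
        inner ℝ F (average μ μ ι η y) := by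
      refine fun y => dense_test.induction (P := fun y => ∑ i, inner ℝ (a i)
        (- average μ μ ι (η' i) y) = inner ℝ F (average μ μ ι η y)) ?_ ?_ y
      · rintro _ ⟨φ, hφ, rfl⟩
        have hφd : ∀ i, IsDeriv (dir i) (hφ.memLp (μ := μ).toLp φ)
            ((hφ.fderiv_apply (dir i)).memLp.toLp _) := fun i => hφ.isDeriv _
        simp only [← hmove hφd]
        simp only [real_inner_comm _ F, real_inner_comm _ (a _), inner_average_left hηi]
        rw [← integral_finsetSum _ fun i _ => integrable_mul_inner_translate ι hηi _ _]
        refine integral_congr_ae (Eventually.of_forall fun w => ?_)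
        simp only
        rw [← Finset.mul_sum]
        congr 1
        rw [real_inner_comm, translate_test hφ, ← h _ (hφ.comp_add_right _)]
        refine Finset.sum_congr rfl fun i _ => ?_
        rw [real_inner_comm, translate_test_fderiv hφ]
      · exact isClosed_eq (by fun_prop) (by fun_prop)
    rw [← hall x]
    exact Finset.sum_congr rfl fun i _ => by rw [hmove hx]
  have hl : ∀ y : Lp ℝ 2 μ, Tendsto (fun k : ℕ =>
      average μ μ ((1 / ((k : ℝ) + 1)) • ContinuousLinearMap.id ℝ E) η y) atTop (𝓝 y) := fun y =>
    tendsto_average _ hηi hη1 y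
  have h1 : Tendsto (fun k : ℕ => ∑ i, inner ℝ (a i)
      (average μ μ ((1 / ((k : ℝ) + 1)) • ContinuousLinearMap.id ℝ E) η (x' i))) atTop
      (𝓝 (∑ i, inner ℝ (a i) (x' i))) :=
    tendsto_finsetSum _ fun i _ => tendsto_const_nhds.inner (hl _)
  have h2 : Tendsto (fun k : ℕ => inner ℝ F
      (average μ μ ((1 / ((k : ℝ) + 1)) • ContinuousLinearMap.id ℝ E) η x)) atTop
      (𝓝 (inner ℝ F x)) := tendsto_const_nhds.inner (hl _)
  simp only [key] at h1
  exact tendsto_nhds_unique h1 h2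

end WeakEquations

/-! ### Time weights -/

section TimeWeights

variable {m n : ℕ}

instance instIsAddHaarMeasureVolumeVW : (volume : Measure (EuclideanSpace ℝ (Fin m) ×
    EuclideanSpace ℝ (Fin n))).IsAddHaarMeasure :=
  inferInstanceAs ((volume : Measure (EuclideanSpace ℝ (Fin m))).prod
    (volume : Measure (EuclideanSpace ℝ (Fin n)))).IsAddHaarMeasure

instance instIsAddHaarMeasureVolumeSpace : (volume : Measure (Space m n)).IsAddHaarMeasure :=
  inferInstanceAs ((volume : Measure ℝ).prod
    (volume : Measure (EuclideanSpace ℝ (Fin m) × EuclideanSpace ℝ (Fin n)))).IsAddHaarMeasure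

/-- The space `L²(ℝ × ℝ^m × ℝ^n)`. -/
abbrev L2Space (m n : ℕ) : Type := Lp ℝ 2 (volume : Measure (Space m n))

/-- The unit vector in the direction of time. -/
def dirT : Space m n := (1, 0, 0)

/-- The unit vector in the direction of `v_i`. -/
def dirV (i : Fin m) : Space m n := (0, EuclideanSpace.single i 1, 0)

/-- The unit vector in the direction of the `k`-th of the last `n` variables. -/
def dirW (k : Fin n) : Space m n := (0, 0, EuclideanSpace.single k 1)

/-- Multiplication by the function `ϑ` of the time variable. -/
abbrev timeMul (m n : ℕ) (ϑ : ℝ → ℝ) : L2Space m n →L[ℝ] L2Space m n :=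
  mulL volume fun e => ϑ e.1

/-- Smooth compactly supported functions of time. -/
structure IsTimeWeight (ϑ : ℝ → ℝ) : Prop where
  contDiff : ContDiff ℝ ∞ ϑ
  hasCompactSupport : HasCompactSupport ϑ

lemma IsTimeWeight.bounded {ϑ : ℝ → ℝ} (h : IsTimeWeight ϑ) : ∃ C, ∀ t, |ϑ t| ≤ C :=
  h.contDiff.continuous.bounded_above_of_compact_support h.hasCompactSupport

lemma IsTimeWeight.isMultiplier {ϑ : ℝ → ℝ} (h : IsTimeWeight ϑ) :
    IsMultiplier fun e : Space m n => ϑ e.1 :=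
  ⟨h.contDiff.continuous.measurable.comp measurable_fst, h.bounded.imp fun _ hC _ => hC _⟩

lemma IsTimeWeight.deriv {ϑ : ℝ → ℝ} (h : IsTimeWeight ϑ) : IsTimeWeight (deriv ϑ) :=
  ⟨(contDiff_infty_iff_deriv.1 h.contDiff).2, h.hasCompactSupport.deriv⟩

lemma IsTimeWeight.mul {ϑ ζ : ℝ → ℝ} (h : IsTimeWeight ϑ) (h' : IsTimeWeight ζ) :
    IsTimeWeight fun t => ϑ t * ζ t :=
  ⟨h.contDiff.mul h'.contDiff, h.hasCompactSupport.mul_right⟩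

lemma IsTimeWeight.comp_sub {ϑ : ℝ → ℝ} (h : IsTimeWeight ϑ) (s : ℝ) :
    IsTimeWeight fun t => ϑ (t - s) :=
  ⟨h.contDiff.comp (contDiff_id.sub contDiff_const),
    h.hasCompactSupport.comp_homeomorph (Homeomorph.subRight s)⟩

lemma IsTimeWeight.lipschitz {ϑ : ℝ → ℝ} (h : IsTimeWeight ϑ) :
    ∃ K : ℝ, 0 ≤ K ∧ ∀ s t, |ϑ s - ϑ t| ≤ K * |s - t| := by
  obtain ⟨C, hC⟩ := ContDiff.lipschitzWith_of_hasCompactSupport h.hasCompactSupport h.contDiff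
    (by simp)
  exact ⟨C, C.2, fun x y => by simpa [Real.dist_eq] using hC.dist_le_mul x y⟩

/-- Differentiation of a shifted time weight, in operator norm. -/
lemma hasDerivAt_timeMul_shift {ϑ : ℝ → ℝ} (h : IsTimeWeight ϑ) (x : L2Space m n) :
    HasDerivAt (fun s : ℝ => timeMul m n (fun t => ϑ (t - s)) x)
      (- timeMul m n (deriv ϑ) x) 0 := by
  obtain ⟨K, hK0, hK⟩ := h.deriv.lipschitz
  refine hasDerivAt_zero_of_norm_le (K := K * ‖x‖) fun s _ => ?_
  have h1 : timeMul m n (fun t => ϑ (t - s)) x - timeMul m n (fun t => ϑ (t - 0)) x -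
      s • (- timeMul m n (deriv ϑ) x) = mulL volume (fun e : Space m n =>
        (ϑ (e.1 - s) - ϑ (e.1 - 0)) - (-s) * deriv ϑ e.1) x := by
    rw [mulL_sub_fun (((h.comp_sub s).isMultiplier).sub (h.comp_sub 0).isMultiplier)
      ((IsMultiplier.const (-s)).mul h.deriv.isMultiplier), mulL_sub_fun (h.comp_sub s).isMultiplier
      (h.comp_sub 0).isMultiplier, ← mulL_mulL (IsMultiplier.const (-s)) h.deriv.isMultiplier,
      mulL_const, smul_neg, neg_smul]
  rw [h1, mul_right_comm]
  refine norm_mulL_le ?_ (fun e => ?_) x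
  · exact ((((h.comp_sub s).isMultiplier).sub (h.comp_sub 0).isMultiplier).sub
      ((IsMultiplier.const (-s)).mul h.deriv.isMultiplier)).1
  · have hd : ∀ r : ℝ, HasDerivAt (fun r => ϑ (e.1 - r)) (- deriv ϑ (e.1 - r)) r := by
      intro r
      have := ((h.contDiff.differentiable (by simp)) (e.1 - r)).hasDerivAt.comp r
        ((hasDerivAt_id r).const_sub e.1)
      simpa [Function.comp_def] using this
    have := taylor_one_le hd (K := K) (fun r => by
      have := hK (e.1 - r) (e.1 - 0)
      rw [neg_sub_neg, abs_sub_comm]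
      simpa using this) s
    convert this using 2
    simp

lemma add_smul_dirT_fst (e : Space m n) (s : ℝ) : (e + s • (dirT : Space m n)).1 = e.1 + s := by
  simp [dirT]

/-- Translating a time weight. -/
lemma translate_timeMul {ϑ : ℝ → ℝ} (h : IsTimeWeight ϑ) (s : ℝ) (x : L2Space m n) :
    translate volume (s • dirT) (timeMul m n (fun t => ϑ (t - s)) x) =
      timeMul m n ϑ (translate volume (s • dirT) x) := by
  rw [timeMul, translate_mulL (h.comp_sub s).isMultiplier]
  simp only [add_smul_dirT_fst, add_sub_cancel_right]

lemma inner_timeMul_translate {ϑ : ℝ → ℝ} (h : IsTimeWeight ϑ) (s : ℝ) (x y : L2Space m n) :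
    inner ℝ (timeMul m n ϑ (translate volume (s • dirT) x)) (translate volume (s • dirT) y) =
      inner ℝ (timeMul m n (fun t => ϑ (t - s)) x) y := by
  rw [← translate_timeMul h, LinearIsometry.inner_map_map]

/-- Integration by parts in time for the energy with the weight `ϑ`. -/
lemma energy_identity {ϑ : ℝ → ℝ} (h : IsTimeWeight ϑ) {u f : L2Space m n}
    (hu : IsDeriv dirT u f) :
    - inner ℝ (timeMul m n (deriv ϑ) u) u = 2 * inner ℝ (timeMul m n ϑ u) f := by
  have h1 := ((timeMul m n ϑ).hasFDerivAt.comp_hasDerivAt (0 : ℝ) hu).inner ℝ hu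
  have h2 := (hasDerivAt_timeMul_shift h u).inner ℝ (hasDerivAt_const (0 : ℝ) u)
  simp only [Function.comp_def, inner_timeMul_translate h, zero_smul, translate_zero,
    inner_zero_right, zero_add, inner_neg_left] at h1 h2
  rw [← h1.unique h2, timeMul, inner_mulL_left h.isMultiplier, real_inner_comm, two_mul]

end TimeWeights

/-! ### Weak equations in divergence form -/

section WeakDivergence

variable {E : Type*} [NormedAddCommGroup E] [NormedSpace ℝ E] [FiniteDimensional ℝ E]
  [MeasurableSpace E] [BorelSpace E] {μ : Measure E} [μ.IsAddHaarMeasure]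
  {V : Type*} [NormedAddCommGroup V] [NormedSpace ℝ V] [FiniteDimensional ℝ V]
  [MeasurableSpace V] [BorelSpace V] {ν : Measure V} [ν.IsAddHaarMeasure]

/-- The first order equation `- ∑ i, ∂_{dir i} (a i) = F` in the sense of distributions. -/
def WeakDiv {γ : Type*} [Fintype γ] (dir : γ → E) (a : γ → Lp ℝ 2 μ) (F : Lp ℝ 2 μ) : Prop :=
  ∀ (φ : E → ℝ) (hφ : IsTest φ),
    ∑ i, inner ℝ (a i) ((hφ.fderiv_apply (dir i)).memLp.toLp _) = inner ℝ F (hφ.memLp.toLp φ)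

/-- Averages preserve weak equations. -/
lemma WeakDiv.average {γ : Type*} [Fintype γ] {dir : γ → E} {a : γ → Lp ℝ 2 μ} {F : Lp ℝ 2 μ}
    (h : WeakDiv dir a F) (ι : V →L[ℝ] E) {ρ : V → ℝ} (hρ : Integrable ρ ν) :
    WeakDiv dir (fun i => average μ ν ι ρ (a i)) (average μ ν ι ρ F) := by
  intro φ hφ
  simp only [inner_average_left hρ]
  rw [← integral_finsetSum _ fun i _ => integrable_mul_inner_translate ι hρ _ _]
  refine integral_congr_ae (Eventually.of_forall fun w => ?_)
  simp only
  rw [← Finset.mul_sum]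
  simp only [inner_translate_left, translate_test hφ, translate_test_fderiv hφ]
  rw [h _ (hφ.comp_add_right _)]

end WeakDivergence

/-! ### The equation in straightened variables and its frequency localization -/

section System

variable {m n : ℕ}

/-- The inclusion of the last `n` variables. -/
def inclW (m n : ℕ) : EuclideanSpace ℝ (Fin n) →L[ℝ] Space m n :=
  (ContinuousLinearMap.inr ℝ ℝ (EuclideanSpace ℝ (Fin m) × EuclideanSpace ℝ (Fin n))).comp
    (ContinuousLinearMap.inr ℝ (EuclideanSpace ℝ (Fin m)) (EuclideanSpace ℝ (Fin n)))

lemma inclW_apply (y : EuclideanSpace ℝ (Fin n)) : inclW m n y = (0, 0, y) := rfl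

/-- `b` does not depend on the last `n` variables. -/
def InvW (b : Space m n → ℝ) : Prop := ∀ e y, b (e + inclW m n y) = b e

lemma invW_time (ϑ : ℝ → ℝ) : InvW fun e : Space m n => ϑ e.1 := fun e y => by
  simp [inclW_apply]

/-- The indicator function of a set of times. -/
def timeInd (S : Set ℝ) : ℝ → ℝ := S.indicator fun _ => 1

lemma isMultiplier_timeInd {S : Set ℝ} (hS : MeasurableSet S) :
    IsMultiplier fun e : Space m n => timeInd S e.1 := by
  refine ⟨(measurable_const.indicator hS).comp measurable_fst, 1, fun e => ?_⟩
  unfold timeInd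
  by_cases h : e.1 ∈ S <;> simp [h]

lemma ae_mem_of_timeInd {S : Set ℝ} (hS : MeasurableSet S) {x : L2Space m n}
    (h : timeMul m n (timeInd S) x = x) : ∀ᵐ e, x e ≠ 0 → e.1 ∈ S := by
  have := coeFn_mulL (isMultiplier_timeInd (m := m) (n := n) hS) x
  rw [h] at this
  filter_upwards [this] with e he hne
  by_contra hS'
  rw [timeInd, indicator_of_notMem hS', zero_mul] at he
  exact hne he

/-- The coefficients of the equation in the straightened variables. -/
structure Coeffs (m n : ℕ) where
  /-- The diffusion matrix. -/
  A : Fin m → Fin m → Space m n → ℝ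
  /-- The entries of the matrix `q(t)` for which the derivatives along `v` have become
  `∂_{v_i} - ∑ k, q_{k i}(t) ∂_{w_k}`. -/
  q : Fin n → Fin m → ℝ → ℝ
  /-- The coefficient of order zero. -/
  c : Space m n → ℝ
  /-- The coefficients of the first derivatives. -/
  d : Fin m → Space m n → ℝ

/-- The assumptions on the coefficients. -/
structure Coeffs.Admissible (co : Coeffs m n) (T l : ℝ) : Prop where
  A_mult : ∀ i j, IsMultiplier (co.A i j)
  A_inv : ∀ i j, InvW (co.A i j)
  A_symm : ∀ i j e, co.A i j e = co.A j i e
  A_lip : ∃ K : ℝ, ∀ i j e s, |co.A i j (e + s • dirT) - co.A i j e| ≤ K * |s|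
  A_ell : ∀ e ∈ strip m n T, ∀ ξ : Fin m → ℝ, ∑ i, ξ i ^ 2 ≤ l * ∑ i, ∑ j, co.A i j e * ξ i * ξ j
  q_weight : ∀ k i, IsTimeWeight (co.q k i)
  c_mult : IsMultiplier co.c
  c_inv : InvW co.c
  d_mult : ∀ j, IsMultiplier (co.d j)
  d_inv : ∀ j, InvW (co.d j)

/-- The flux `A g`. -/
def Coeffs.flux (co : Coeffs m n) (g : Fin m → L2Space m n) (i : Fin m) : L2Space m n :=
  ∑ j, mulL volume (co.A i j) (g j)

/-- The system satisfied by `u`, its time derivative `f`, its gradient `g` along `v` and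
`F = - div_v (A g)` in the straightened variables. The functions live in `0 < t < T`; the source
`E₀` comes from a cutoff in time and vanishes for `t < T₁`. -/
structure WeakSystem (co : Coeffs m n) (T T₁ : ℝ) (u f F E₀ : L2Space m n)
    (g : Fin m → L2Space m n) : Prop where
  deriv_time : IsDeriv dirT u f
  deriv_v : ∀ i, WeakDiv (fun o : Option (Fin n) => o.elim (dirV i) dirW)
    (fun o => o.elim u fun k => - timeMul m n (co.q k i) u) (- g i)
  elliptic : WeakDiv (Sum.elim dirV dirW : Fin m ⊕ Fin n → Space m n)
    (Sum.elim (co.flux g) fun k => - ∑ i, timeMul m n (co.q k i) (co.flux g i)) F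
  split : f = F + (mulL volume co.c u + ∑ j, mulL volume (co.d j) (g j) + E₀)
  supp_u : timeMul m n (timeInd (Ioo 0 T)) u = u
  supp_g : ∀ i, timeMul m n (timeInd (Ioo 0 T)) (g i) = g i
  supp_F : timeMul m n (timeInd (Ioo 0 T)) F = F
  supp_E₀ : timeMul m n (timeInd (Iio T₁)) E₀ = 0

/-- Bounded operators `D k` that represent the derivatives of `u` in the last `n` variables. -/
structure HasBoundedW (u : L2Space m n) (D : Fin n → L2Space m n →L[ℝ] L2Space m n) : Prop where
  deriv : ∀ k, IsDeriv (dirW k) u (D k u)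
  map_mulL : ∀ k b, IsMultiplier b → InvW b → ∀ x, D k (mulL volume b x) = mulL volume b (D k x)

variable {ρ : EuclideanSpace ℝ (Fin n) → ℝ} {r : ℝ}

/-- The average in the last `n` variables with the weight `ρ` at scale `r`. -/
abbrev avgW (m n : ℕ) (r : ℝ) (ρ : EuclideanSpace ℝ (Fin n) → ℝ) :
    L2Space m n →L[ℝ] L2Space m n :=
  average volume volume (r • inclW m n) ρ

lemma avgW_mulL (hρ : Integrable ρ) {b : Space m n → ℝ} (hb : IsMultiplier b) (hi : InvW b)
    (x : L2Space m n) : avgW m n r ρ (mulL volume b x) = mulL volume b (avgW m n r ρ x) := by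
  refine (map_average hρ (mulL volume b) (fun y x => ?_) x).symm
  refine (translate_mulL_of_invariant hb (fun e => ?_) x).symm
  have := hi e (r • y)
  rwa [map_smul] at this

lemma avgW_timeMul (hρ : Integrable ρ) {ϑ : ℝ → ℝ}
    (hb : IsMultiplier fun e : Space m n => ϑ e.1) (x : L2Space m n) :
    avgW m n r ρ (timeMul m n ϑ x) = timeMul m n ϑ (avgW m n r ρ x) :=
  avgW_mulL hρ hb (invW_time ϑ) x

lemma avgW_flux {co : Coeffs m n} {T l : ℝ} (hco : co.Admissible T l) (hρ : Integrable ρ)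
    (g : Fin m → L2Space m n) (i : Fin m) :
    avgW m n r ρ (co.flux g i) = co.flux (fun j => avgW m n r ρ (g j)) i := by
  unfold Coeffs.flux
  rw [map_sum]
  exact Finset.sum_congr rfl fun j _ => avgW_mulL hρ (hco.A_mult i j) (hco.A_inv i j) _

/-- The coefficients do not depend on `w`, so that averages in `w` preserve the system. -/
lemma WeakSystem.avgW {co : Coeffs m n} {T T₁ l : ℝ} (hco : co.Admissible T l)
    {u f F E₀ : L2Space m n} {g : Fin m → L2Space m n} (h : WeakSystem co T T₁ u f F E₀ g)
    (r : ℝ) (hρ : Integrable ρ) :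
    WeakSystem co T T₁ (avgW m n r ρ u) (avgW m n r ρ f) (avgW m n r ρ F) (avgW m n r ρ E₀)
      (fun j => Ultraparabolic.avgW m n r ρ (g j)) where
  deriv_time := h.deriv_time.map _ fun s x => translate_average hρ _ x
  deriv_v i := by
    have := (h.deriv_v i).average (r • inclW m n) hρ
    rw [map_neg] at this
    convert this using 2 with o
    cases o with
    | none => rfl
    | some k => simp only [Option.elim, map_neg]; rw [← avgW_timeMul hρ (hco.q_weight k i).isMultiplier]
  elliptic := by
    have := h.elliptic.average (r • inclW m n) hρ
    convert this using 2 with o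
    cases o with
    | inl i => exact (avgW_flux hco hρ g i).symm
    | inr k =>
      simp only [Sum.elim_inr, map_neg, map_sum]
      refine congrArg _ (Finset.sum_congr rfl fun i _ => ?_)
      rw [← avgW_flux hco hρ g i, ← avgW_timeMul hρ (hco.q_weight k i).isMultiplier]
  split := by
    rw [← avgW_mulL hρ hco.c_mult hco.c_inv]
    simp only [← avgW_mulL hρ (hco.d_mult _) (hco.d_inv _)]
    conv_lhs => rw [h.split]
    simp only [map_add, map_sum]
  supp_u := by
    rw [← avgW_timeMul hρ (isMultiplier_timeInd measurableSet_Ioo), h.supp_u]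
  supp_g i := by
    rw [← avgW_timeMul hρ (isMultiplier_timeInd measurableSet_Ioo), h.supp_g]
  supp_F := by
    rw [← avgW_timeMul hρ (isMultiplier_timeInd measurableSet_Ioo), h.supp_F]
  supp_E₀ := by
    rw [← avgW_timeMul hρ (isMultiplier_timeInd measurableSet_Iio), h.supp_E₀, map_zero]

/-- Averages with a band-limited kernel have bounded derivatives in `w`. -/
lemma exists_hasBoundedW {ρ σ : EuclideanSpace ℝ (Fin n) → ℝ} (hρ : Integrable ρ)
    (hσ : Integrable σ) (hρσ : ∀ y, ∫ w, σ (y - w) * ρ w = ρ y) (hσd : Differentiable ℝ σ)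
    (hσ' : ∀ b, Integrable fun y => fderiv ℝ σ y b) (hr : r ≠ 0) (u : L2Space m n) :
    ∃ D, HasBoundedW (avgW m n r ρ u) D := by
  refine ⟨fun k => (-r⁻¹) • avgW m n r fun y => fderiv ℝ σ y (EuclideanSpace.single k 1), ?_, ?_⟩
  · intro k
    have h1 := isDeriv_average (ι := r • inclW m n) hσ (hσ' (EuclideanSpace.single k 1))
      (fun y => (hσd y).hasFDerivAt.hasLineDerivAt _) (avgW m n r ρ u)
    rw [average_average hρ hσ hρ hρσ] at h1
    have h2 := h1.smul_dir r⁻¹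
    have h3 : r⁻¹ • (r • inclW m n) (EuclideanSpace.single k 1) = dirW k := by
      rw [_root_.smul_apply, smul_smul, inv_mul_cancel₀ hr, one_smul]; rfl
    rw [h3] at h2
    simpa using h2
  · intro k b hb hi x
    simp only [_root_.smul_apply, map_smul]
    rw [avgW_mulL (hσ' _) hb hi]

end System

/-! ### The commutator inequality -/

section Commutator

variable {m n : ℕ} {co : Coeffs m n} {T T₁ l : ℝ} {u f F E₀ : L2Space m n}
  {g : Fin m → L2Space m n} {D : Fin n → L2Space m n →L[ℝ] L2Space m n}

/-- Translation in time. -/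
abbrev translateT (m n : ℕ) (s : ℝ) : L2Space m n →ₗᵢ[ℝ] L2Space m n :=
  translate volume (s • (dirT : Space m n))

lemma inner_translateT_translateT (s : ℝ) (x y : L2Space m n) :
    inner ℝ (translateT m n s x) (translateT m n s y) = inner ℝ x y :=
  LinearIsometry.inner_map_map _ _ _

lemma translate_timeMul_of_fst_eq_zero {ϑ : ℝ → ℝ}
    (hϑ : IsMultiplier fun e : Space m n => ϑ e.1) {a : Space m n} (ha : a.1 = 0)
    (x : L2Space m n) :
    translate volume a (timeMul m n ϑ x) = timeMul m n ϑ (translate volume a x) :=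
  translate_mulL_of_invariant hϑ (fun e => by simp [ha]) x

lemma IsDeriv.timeMul_translateT {ϑ : ℝ → ℝ} (hϑ : IsMultiplier fun e : Space m n => ϑ e.1)
    {a : Space m n} (ha : a.1 = 0) {x y : L2Space m n} (h : IsDeriv a x y) (s : ℝ) :
    IsDeriv a (timeMul m n ϑ (translateT m n s x)) (timeMul m n ϑ (translateT m n s y)) :=
  (h.translated (s • dirT)).map (timeMul m n ϑ) fun r z =>
    translate_timeMul_of_fst_eq_zero hϑ (by simp [ha]) z

/-- Once the derivatives in `w` are bounded, `u` has strong derivatives in `v`. -/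
lemma WeakSystem.isDeriv_dirV (hco : co.Admissible T l) (h : WeakSystem co T T₁ u f F E₀ g)
    (hD : HasBoundedW u D) (i : Fin m) :
    IsDeriv (dirV i) u (g i + ∑ k, timeMul m n (co.q k i) (D k u)) := by
  refine isDeriv_of_weak fun φ hφ => ?_
  have h1 := h.deriv_v i φ hφ
  rw [Fintype.sum_option] at h1
  simp only [Option.elim, inner_neg_left] at h1
  have h2 : ∀ k, inner ℝ (timeMul m n (co.q k i) u) ((hφ.fderiv_apply (dirW k)).memLp.toLp _) =
      - inner ℝ (timeMul m n (co.q k i) (D k u)) (hφ.memLp.toLp φ) := fun k =>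
    (((hD.deriv k).map (timeMul m n (co.q k i)) fun r z =>
      translate_timeMul_of_fst_eq_zero (hco.q_weight k i).isMultiplier (by simp [dirW]) z)).weak hφ
  simp only [h2, neg_neg] at h1
  rw [inner_add_left, sum_inner]
  linarith

lemma inner_timeMul_left {ϑ : ℝ → ℝ} (hϑ : IsTimeWeight ϑ) (x y : L2Space m n) :
    inner ℝ (timeMul m n ϑ x) y = inner ℝ x (timeMul m n ϑ y) :=
  inner_mulL_left hϑ.isMultiplier x y

/-- The increment of a function of time. -/
def increment (ϑ : ℝ → ℝ) (s t : ℝ) : ℝ := ϑ (t + s) - ϑ t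

lemma IsTimeWeight.comp_add {ϑ : ℝ → ℝ} (h : IsTimeWeight ϑ) (s : ℝ) :
    IsTimeWeight fun t => ϑ (t + s) := by
  simpa using h.comp_sub (-s)

lemma isMultiplier_increment {ϑ : ℝ → ℝ} (h : IsTimeWeight ϑ) (s : ℝ) :
    IsMultiplier fun e : Space m n => increment ϑ s e.1 :=
  (h.comp_add s).isMultiplier.sub h.isMultiplier

/-- The elliptic equation tested with a time translate of `u`. The translate of `u` is
differentiated by operators whose coefficients are taken at a different time. -/
lemma WeakSystem.inner_translateT (hco : co.Admissible T l) (h : WeakSystem co T T₁ u f F E₀ g)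
    (hD : HasBoundedW u D) {ϑ : ℝ → ℝ} (hϑ : IsTimeWeight ϑ) (s : ℝ) :
    inner ℝ F (timeMul m n ϑ (translateT m n s u)) =
      ∑ i, inner ℝ (co.flux g i) (timeMul m n ϑ (translateT m n s (g i))) +
      ∑ i, ∑ k, inner ℝ (co.flux g i)
        (timeMul m n ϑ (timeMul m n (increment (co.q k i) s) (translateT m n s (D k u)))) := by
  have h1 := weak_eq_extend h.elliptic (x := timeMul m n ϑ (translateT m n s u))
    (x' := Sum.elim
      (fun i => timeMul m n ϑ (translateT m n s (g i + ∑ k, timeMul m n (co.q k i) (D k u))))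
      (fun k => timeMul m n ϑ (translateT m n s (D k u)))) (by
      rintro (i | k)
      · exact (h.isDeriv_dirV hco hD i).timeMul_translateT hϑ.isMultiplier (by simp [dirV]) s
      · exact (hD.deriv k).timeMul_translateT hϑ.isMultiplier (by simp [dirW]) s)
  rw [← h1, Fintype.sum_sum_type]
  simp only [Sum.elim_inl, Sum.elim_inr, map_add, map_sum, inner_add_right, inner_sum,
    inner_neg_left, sum_inner, Finset.sum_neg_distrib, Finset.sum_add_distrib]
  rw [add_assoc, add_right_inj, Finset.sum_comm (γ := Fin n), ← sub_eq_add_neg,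
    ← Finset.sum_sub_distrib]
  refine Finset.sum_congr rfl fun i _ => ?_
  rw [← Finset.sum_sub_distrib]
  refine Finset.sum_congr rfl fun k _ => ?_
  rw [inner_timeMul_left (hco.q_weight k i), ← inner_sub_right]
  congr 1
  have hq := hco.q_weight k i
  have e1 : translateT m n s (timeMul m n (co.q k i) (D k u)) =
      timeMul m n (fun t => co.q k i (t + s)) (translateT m n s (D k u)) := by
    rw [timeMul, translate_mulL hq.isMultiplier]
    simp only [add_smul_dirT_fst]
  have e2 : timeMul m n (increment (co.q k i) s) (translateT m n s (D k u)) =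
      timeMul m n (fun t => co.q k i (t + s)) (translateT m n s (D k u)) -
        timeMul m n (co.q k i) (translateT m n s (D k u)) :=
    mulL_sub_fun (hq.comp_add s).isMultiplier hq.isMultiplier _
  rw [e1, e2, map_sub, mulL_comm hq.isMultiplier hϑ.isMultiplier]

lemma inner_timeMul_shift {ϑ : ℝ → ℝ} (hϑ : IsTimeWeight ϑ) (s : ℝ) (x y : L2Space m n) :
    inner ℝ y (timeMul m n (fun t => ϑ (t - s)) (translateT m n (-s) x)) =
      inner ℝ (translateT m n s y) (timeMul m n ϑ x) := by
  rw [← inner_translateT_translateT s y, translateT, translate_timeMul hϑ, translateT, neg_smul,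
    translate_translate_neg]

lemma timeMul_increment_neg {ϑ : ℝ → ℝ} (hϑ : IsTimeWeight ϑ) (s : ℝ) (x : L2Space m n) :
    timeMul m n (increment ϑ (-s)) (translateT m n (-s) x) =
      - translateT m n (-s) (timeMul m n (increment ϑ s) x) := by
  rw [timeMul, timeMul, translate_mulL (isMultiplier_increment hϑ s), eq_neg_iff_add_eq_zero,
    ← mulL_add_fun (isMultiplier_increment hϑ (-s))
      ((isMultiplier_increment hϑ s).comp_add_right _)]
  have : (fun e : Space m n => increment ϑ (-s) e.1 + increment ϑ s (e + -s • dirT).1) =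
      fun _ => (0 : ℝ) := by
    funext e
    rw [add_smul_dirT_fst]
    simp [increment]
  rw [this, mulL_const, zero_smul]

lemma Coeffs.Admissible.isMultiplier_A_sub (hco : co.Admissible T l) (i j : Fin m) (s : ℝ) :
    IsMultiplier fun e => co.A i j (e + s • dirT) - co.A i j e :=
  ((hco.A_mult i j).comp_add_right _).sub (hco.A_mult i j)

/-- The commutator of the elliptic part with the translation in time, exactly. -/
lemma WeakSystem.commutator_eq (hco : co.Admissible T l) (h : WeakSystem co T T₁ u f F E₀ g)
    (hD : HasBoundedW u D) {ϑ : ℝ → ℝ} (hϑ : IsTimeWeight ϑ) (s : ℝ) :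
    inner ℝ (timeMul m n ϑ (translateT m n s F)) u -
        inner ℝ (timeMul m n ϑ F) (translateT m n s u) =
      ∑ i, ∑ j, inner ℝ (mulL volume (fun e => co.A i j (e + s • dirT) - co.A i j e)
        (translateT m n s (g j))) (timeMul m n ϑ (g i)) -
      ∑ i, ∑ k, inner ℝ (translateT m n s (co.flux g i))
        (timeMul m n ϑ (timeMul m n (increment (co.q k i) s) (D k u))) -
      ∑ i, ∑ k, inner ℝ (co.flux g i)
        (timeMul m n ϑ (timeMul m n (increment (co.q k i) s) (translateT m n s (D k u)))) := by
  rw [inner_timeMul_left hϑ, ← inner_timeMul_shift hϑ,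
    h.inner_translateT hco hD (hϑ.comp_sub s) (-s), inner_timeMul_left hϑ,
    h.inner_translateT hco hD hϑ s]
  have h1 : ∀ i k, inner ℝ (co.flux g i) (timeMul m n (fun t => ϑ (t - s))
      (timeMul m n (increment (co.q k i) (-s)) (translateT m n (-s) (D k u)))) =
      - inner ℝ (translateT m n s (co.flux g i))
        (timeMul m n ϑ (timeMul m n (increment (co.q k i) s) (D k u))) := fun i k => by
    rw [timeMul_increment_neg (hco.q_weight k i), map_neg, inner_neg_right,
      inner_timeMul_shift hϑ]
  simp only [h1, Finset.sum_neg_distrib, inner_timeMul_shift hϑ]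
  have h2 : ∑ i, inner ℝ (translateT m n s (co.flux g i)) (timeMul m n ϑ (g i)) -
      ∑ i, inner ℝ (co.flux g i) (timeMul m n ϑ (translateT m n s (g i))) =
      ∑ i, ∑ j, inner ℝ (mulL volume (fun e => co.A i j (e + s • dirT) - co.A i j e)
        (translateT m n s (g j))) (timeMul m n ϑ (g i)) := by
    simp only [Coeffs.flux, map_sum, sum_inner]
    -- the second double sum is transposed, by the symmetry of `A`
    rw [Finset.sum_comm (f := fun i j => inner ℝ (mulL volume (co.A i j) (g j))
      (timeMul m n ϑ (translateT m n s (g i)))), ← Finset.sum_sub_distrib]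
    refine Finset.sum_congr rfl fun i _ => ?_
    rw [← Finset.sum_sub_distrib]
    refine Finset.sum_congr rfl fun j _ => ?_
    rw [mulL_sub_fun ((hco.A_mult i j).comp_add_right _) (hco.A_mult i j), inner_sub_left,
      translateT, translate_mulL (hco.A_mult i j)]
    congr 1
    have hs : co.A j i = co.A i j := funext fun e => hco.A_symm j i e
    rw [hs, ← inner_timeMul_left hϑ, mulL_comm hϑ.isMultiplier (hco.A_mult i j), real_inner_comm,
      inner_mulL_left (hco.A_mult i j)]
  linarith

end Commutator

section CommutatorInequality

variable {m n : ℕ} {co : Coeffs m n} {T T₁ l : ℝ} {u f F E₀ : L2Space m n}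
  {g : Fin m → L2Space m n} {D : Fin n → L2Space m n →L[ℝ] L2Space m n}

lemma timeMul_sq {w : ℝ → ℝ} (hw : IsTimeWeight w) (x : L2Space m n) :
    timeMul m n (fun t => w t * w t) x = timeMul m n w (timeMul m n w x) :=
  (mulL_mulL hw.isMultiplier hw.isMultiplier x).symm

lemma inner_timeMul_sq {w : ℝ → ℝ} (hw : IsTimeWeight w) (x y : L2Space m n) :
    inner ℝ x (timeMul m n (fun t => w t * w t) y) =
      inner ℝ (timeMul m n w x) (timeMul m n w y) := by
  rw [timeMul_sq hw, inner_timeMul_left hw]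

lemma abs_inner_mulL_le {w : ℝ → ℝ} (hw : IsTimeWeight w) {b : Space m n → ℝ} (hb : Measurable b)
    {C : ℝ} (hC : ∀ e, |b e| ≤ C) (x y : L2Space m n) :
    |inner ℝ (mulL volume b x) (timeMul m n (fun t => w t * w t) y)| ≤
      C * (‖timeMul m n w x‖ * ‖timeMul m n w y‖) := by
  rw [inner_timeMul_sq hw, mulL_comm hw.isMultiplier ⟨hb, C, hC⟩, ← mul_assoc]
  exact (abs_real_inner_le_norm _ _).trans
    (mul_le_mul_of_nonneg_right (norm_mulL_le hb hC _) (norm_nonneg _))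

lemma translateT_zero (x : L2Space m n) : translateT m n 0 x = x := by
  rw [translateT, zero_smul, translate_zero]

/-- The bound for the commutator, up to the factor `K |s|`. -/
def commutatorBound (co : Coeffs m n) (u : L2Space m n) (g : Fin m → L2Space m n)
    (D : Fin n → L2Space m n →L[ℝ] L2Space m n) (w : ℝ → ℝ) (s : ℝ) : ℝ :=
  ∑ i, ∑ j, ‖timeMul m n w (translateT m n s (g j))‖ * ‖timeMul m n w (g i)‖ +
  ∑ i, ∑ k, ‖timeMul m n w (translateT m n s (co.flux g i))‖ * ‖timeMul m n w (D k u)‖ +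
  ∑ i, ∑ k, ‖timeMul m n w (co.flux g i)‖ * ‖timeMul m n w (translateT m n s (D k u))‖

lemma Coeffs.Admissible.exists_lipschitz (hco : co.Admissible T l) : ∃ K : ℝ, 0 ≤ K ∧
    (∀ i j e s, |co.A i j (e + s • dirT) - co.A i j e| ≤ K * |s|) ∧
    ∀ k i s t, |increment (co.q k i) s t| ≤ K * |s| := by
  obtain ⟨K, hK⟩ := hco.A_lip
  choose L hL0 hL using fun k i => (hco.q_weight k i).lipschitz
  refine ⟨|K| + ∑ k, ∑ i, L k i, add_nonneg (abs_nonneg K)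
    (Finset.sum_nonneg fun k _ => Finset.sum_nonneg fun i _ => hL0 k i), fun i j e s => (hK i j e s).trans ?_,
    fun k i s t => ?_⟩
  · refine mul_le_mul_of_nonneg_right ((le_abs_self K).trans ?_) (abs_nonneg s)
    exact le_add_of_nonneg_right
      (Finset.sum_nonneg fun k _ => Finset.sum_nonneg fun i _ => hL0 k i)
  · have h1 := hL k i (t + s) t
    rw [add_sub_cancel_left] at h1
    refine h1.trans (mul_le_mul_of_nonneg_right ?_ (abs_nonneg s))
    have h2 : L k i ≤ ∑ i, L k i :=
      Finset.single_le_sum (f := fun i => L k i) (fun i _ => hL0 k i) (Finset.mem_univ i)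
    have h3 : ∑ i, L k i ≤ ∑ k, ∑ i, L k i :=
      Finset.single_le_sum (f := fun k => ∑ i, L k i)
        (fun k _ => Finset.sum_nonneg fun i _ => hL0 k i) (Finset.mem_univ k)
    linarith [abs_nonneg K]

lemma WeakSystem.abs_commutator_le (hco : co.Admissible T l) (h : WeakSystem co T T₁ u f F E₀ g)
    (hD : HasBoundedW u D) {K : ℝ}
    (hA : ∀ i j e s, |co.A i j (e + s • dirT) - co.A i j e| ≤ K * |s|)
    (hq : ∀ k i s t, |increment (co.q k i) s t| ≤ K * |s|) {w : ℝ → ℝ} (hw : IsTimeWeight w)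
    (s : ℝ) :
    |inner ℝ (timeMul m n (fun t => w t * w t) (translateT m n s F)) u -
        inner ℝ (timeMul m n (fun t => w t * w t) F) (translateT m n s u)| ≤
      K * |s| * commutatorBound co u g D w s := by
  rw [h.commutator_eq hco hD (hw.mul hw) s, commutatorBound, mul_add, mul_add]
  refine (abs_sub _ _).trans (add_le_add ((abs_sub _ _).trans (add_le_add ?_ ?_)) ?_)
  · simp only [Finset.mul_sum]
    refine (Finset.abs_sum_le_sum_abs _ _).trans (Finset.sum_le_sum fun i _ => ?_)
    refine (Finset.abs_sum_le_sum_abs _ _).trans (Finset.sum_le_sum fun j _ => ?_)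
    exact abs_inner_mulL_le hw (hco.isMultiplier_A_sub i j s).1 (fun e => hA i j e s) _ _
  · simp only [Finset.mul_sum]
    refine (Finset.abs_sum_le_sum_abs _ _).trans (Finset.sum_le_sum fun i _ => ?_)
    refine (Finset.abs_sum_le_sum_abs _ _).trans (Finset.sum_le_sum fun k _ => ?_)
    have hm := isMultiplier_increment (m := m) (n := n) (hco.q_weight k i) s
    rw [timeMul, timeMul, mulL_comm (hw.mul hw).isMultiplier hm, ← inner_mulL_left hm]
    exact abs_inner_mulL_le hw hm.1 (fun e => hq k i s e.1) _ _
  · simp only [Finset.mul_sum]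
    refine (Finset.abs_sum_le_sum_abs _ _).trans (Finset.sum_le_sum fun i _ => ?_)
    refine (Finset.abs_sum_le_sum_abs _ _).trans (Finset.sum_le_sum fun k _ => ?_)
    have hm := isMultiplier_increment (m := m) (n := n) (hco.q_weight k i) s
    rw [timeMul, timeMul, mulL_comm (hw.mul hw).isMultiplier hm, ← inner_mulL_left hm]
    exact abs_inner_mulL_le hw hm.1 (fun e => hq k i s e.1) _ _

lemma continuous_commutatorBound (co : Coeffs m n) (u : L2Space m n) (g : Fin m → L2Space m n)
    (D : Fin n → L2Space m n →L[ℝ] L2Space m n) (w : ℝ → ℝ) :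
    Continuous (commutatorBound co u g D w) := by
  have h : ∀ x : L2Space m n, Continuous fun s : ℝ => timeMul m n w (translateT m n s x) :=
    fun x => (timeMul m n w).continuous.comp
      (continuous_translate (by fun_prop) continuous_const)
  unfold commutatorBound
  refine ((continuous_finsetSum _ fun i _ => continuous_finsetSum _ fun j _ => ?_).add
    (continuous_finsetSum _ fun i _ => continuous_finsetSum _ fun k _ => ?_)).add
    (continuous_finsetSum _ fun i _ => continuous_finsetSum _ fun k _ => ?_)
  · exact (h _).norm.mul continuous_const
  · exact (h _).norm.mul continuous_const
  · exact continuous_const.mul (h _).norm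

/-- The weighted Dirichlet energy `⟨ϑ F, u⟩` is differentiated in time: up to the commutator, its
derivative is `2 ⟨ϑ F, ∂_t u⟩`. Difference quotients in time are used, so that no derivative of
`F` or `g` is needed. -/
lemma WeakSystem.dirichlet_inequality (hco : co.Admissible T l)
    (h : WeakSystem co T T₁ u f F E₀ g) (hD : HasBoundedW u D) {K : ℝ}
    (hA : ∀ i j e s, |co.A i j (e + s • dirT) - co.A i j e| ≤ K * |s|)
    (hq : ∀ k i s t, |increment (co.q k i) s t| ≤ K * |s|) {w : ℝ → ℝ} (hw : IsTimeWeight w) :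
    2 * inner ℝ (timeMul m n (fun t => w t * w t) F) f ≤
      - inner ℝ (timeMul m n (deriv fun t => w t * w t) F) u +
        K * commutatorBound co u g D w 0 := by
  have hϑ := hw.mul hw
  set ϑ : ℝ → ℝ := fun t => w t * w t with hϑdef
  have h1 : HasDerivAt (fun s => inner ℝ (timeMul m n ϑ (translateT m n s F)) (translateT m n s u))
      (- inner ℝ (timeMul m n (deriv ϑ) F) u) 0 := by
    have := (hasDerivAt_timeMul_shift hϑ F).inner ℝ (hasDerivAt_const (0 : ℝ) u)
    simp only [inner_zero_right, zero_add, inner_neg_left] at this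
    simpa only [← inner_timeMul_translate hϑ] using this
  have hslope := h1.tendsto_slope_zero_right
  simp only [zero_add] at hslope
  have h2 : Tendsto (fun s : ℝ => inner ℝ (timeMul m n ϑ (translateT m n s F + F))
      (s⁻¹ • (translateT m n s u - u)) - K * commutatorBound co u g D w s) (𝓝[>] 0)
      (𝓝 (inner ℝ (timeMul m n ϑ (F + F)) f - K * commutatorBound co u g D w 0)) := by
    refine Tendsto.sub (Tendsto.inner ?_ ?_) ?_
    · have hc : Continuous fun s : ℝ => timeMul m n ϑ (translateT m n s F + F) :=
        (timeMul m n ϑ).continuous.comp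
          ((continuous_translate (by fun_prop) continuous_const).add continuous_const)
      have := (hc.tendsto 0).mono_left (nhdsWithin_le_nhds (s := Ioi 0))
      simpa [translateT_zero] using this
    · have := h.deriv_time.tendsto_slope_zero_right
      simpa [translateT_zero] using this
    · exact (((continuous_commutatorBound co u g D w).tendsto 0).mono_left
        nhdsWithin_le_nhds).const_mul K
  have h3 := le_of_tendsto_of_tendsto h2 hslope (by
    filter_upwards [self_mem_nhdsWithin] with s hs
    have hs0 : (0:ℝ) < s := hs
    have h4 := (abs_le.1 (h.abs_commutator_le hco hD hA hq hw s)).1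
    rw [abs_of_pos hs0] at h4
    have h5 : inner ℝ (timeMul m n ϑ (translateT m n s F)) (translateT m n s u) -
        inner ℝ (timeMul m n ϑ (translateT m n 0 F)) (translateT m n 0 u) =
        inner ℝ (timeMul m n ϑ (translateT m n s F + F)) (translateT m n s u - u) +
        (inner ℝ (timeMul m n ϑ (translateT m n s F)) u -
          inner ℝ (timeMul m n ϑ F) (translateT m n s u)) := by
      simp only [translateT_zero, map_add, inner_add_left, inner_sub_right]
      ring
    simp only [smul_eq_mul]
    rw [inner_smul_right, h5, mul_add]
    have h6 : s⁻¹ * -(K * s * commutatorBound co u g D w s) =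
        - (K * commutatorBound co u g D w s) := by
      field_simp
    have h7 := mul_le_mul_of_nonneg_left h4 (inv_nonneg.2 hs0.le)
    rw [h6] at h7
    linarith)
  rw [map_add, inner_add_left] at h3
  linarith

lemma norm_timeMul_flux_le {Λ : ℝ} (hco : co.Admissible T l) (hΛ : ∀ i j e, |co.A i j e| ≤ Λ)
    {w : ℝ → ℝ} (hw : IsTimeWeight w) (i : Fin m) :
    ‖timeMul m n w (co.flux g i)‖ ≤ Λ * ∑ j, ‖timeMul m n w (g j)‖ := by
  rw [Coeffs.flux, map_sum, Finset.mul_sum]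
  refine (norm_sum_le _ _).trans (Finset.sum_le_sum fun j _ => ?_)
  rw [mulL_comm hw.isMultiplier (hco.A_mult i j)]
  exact norm_mulL_le (hco.A_mult i j).1 (hΛ i j) _

lemma Coeffs.Admissible.exists_bound (hco : co.Admissible T l) :
    ∃ Λ : ℝ, 0 ≤ Λ ∧ ∀ i j e, |co.A i j e| ≤ Λ := by
  choose L hL using fun i j => (hco.A_mult i j).2
  have h0 : ∀ i j, 0 ≤ L i j := fun i j => (abs_nonneg _).trans (hL i j 0)
  refine ⟨∑ i, ∑ j, L i j, Finset.sum_nonneg fun i _ => Finset.sum_nonneg fun j _ => h0 i j,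
    fun i j e => (hL i j e).trans ?_⟩
  exact (Finset.single_le_sum (f := fun j => L i j) (fun j _ => h0 i j) (Finset.mem_univ j)).trans
    (Finset.single_le_sum (f := fun i => ∑ j, L i j)
      (fun i _ => Finset.sum_nonneg fun j _ => h0 i j) (Finset.mem_univ i))

/-- The commutator inequality with a constant that does not depend on the weight. -/
lemma WeakSystem.exists_dirichlet_inequality (hco : co.Admissible T l)
    (h : WeakSystem co T T₁ u f F E₀ g) (hD : HasBoundedW u D) :
    ∃ C : ℝ, 0 ≤ C ∧ ∀ w : ℝ → ℝ, IsTimeWeight w →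
      2 * inner ℝ (timeMul m n (fun t => w t * w t) F) f ≤
        - inner ℝ (timeMul m n (deriv fun t => w t * w t) F) u +
          C * (∑ i, ‖timeMul m n w (g i)‖ ^ 2 + ‖timeMul m n w u‖ ^ 2) := by
  obtain ⟨K, hK0, hA, hq⟩ := hco.exists_lipschitz
  obtain ⟨Λ, hΛ0, hΛ⟩ := hco.exists_bound
  set B : ℝ := ∑ k, ‖D k‖ with hB
  have hB0 : 0 ≤ B := Finset.sum_nonneg fun k _ => norm_nonneg _
  refine ⟨K * ((1 + m * n * Λ * B) * (m + 1)), by positivity, fun w hw => ?_⟩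
  refine (h.dirichlet_inequality hco hD hA hq hw).trans (add_le_add_right ?_ _)
  rw [mul_assoc]
  refine mul_le_mul_of_nonneg_left ?_ hK0
  set N : ℝ := ∑ j, ‖timeMul m n w (g j)‖ with hN
  have hN0 : 0 ≤ N := Finset.sum_nonneg fun j _ => norm_nonneg _
  set U : ℝ := ‖timeMul m n w u‖
  have hU0 : 0 ≤ U := norm_nonneg _
  have hDk : ∀ k, ‖timeMul m n w (D k u)‖ ≤ B * U := fun k => by
    have e1 : timeMul m n w (D k u) = D k (timeMul m n w u) :=
      (hD.map_mulL k _ hw.isMultiplier (invW_time w) u).symm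
    rw [e1]
    refine ((D k).le_opNorm _).trans (mul_le_mul_of_nonneg_right ?_ (norm_nonneg _))
    exact Finset.single_le_sum (f := fun k => ‖D k‖) (fun k _ => norm_nonneg _) (Finset.mem_univ k)
  have h1 : ∀ i k, ‖timeMul m n w (co.flux g i)‖ * ‖timeMul m n w (D k u)‖ ≤ Λ * N * (B * U) :=
    fun i k => mul_le_mul (norm_timeMul_flux_le hco hΛ hw i) (hDk k) (norm_nonneg _)
      (mul_nonneg hΛ0 hN0)
  have h2 : commutatorBound co u g D w 0 ≤ N * N + m * (n * (Λ * N * (B * U))) +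
      m * (n * (Λ * N * (B * U))) := by
    unfold commutatorBound
    simp only [translateT_zero]
    have h3 : ∑ i, ∑ k, ‖timeMul m n w (co.flux g i)‖ * ‖timeMul m n w (D k u)‖ ≤
        m * (n * (Λ * N * (B * U))) := by
      refine (Finset.sum_le_sum fun i _ => Finset.sum_le_sum fun k _ => h1 i k).trans_eq ?_
      simp
    have h4 : ∑ i, ∑ j, ‖timeMul m n w (g j)‖ * ‖timeMul m n w (g i)‖ = N * N := by
      simp only [← Finset.sum_mul, ← Finset.mul_sum]; rfl
    rw [h4]
    exact add_le_add (add_le_add le_rfl h3) h3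
  have h5 : N ^ 2 ≤ m * ∑ i, ‖timeMul m n w (g i)‖ ^ 2 := by
    simpa using sq_sum_le_card_mul_sum_sq (s := Finset.univ)
      (f := fun i => ‖timeMul m n w (g i)‖)
  have hS0 : 0 ≤ ∑ i, ‖timeMul m n w (g i)‖ ^ 2 := Finset.sum_nonneg fun i _ => sq_nonneg _
  set S : ℝ := ∑ i, ‖timeMul m n w (g i)‖ ^ 2
  obtain ⟨M, hM⟩ : ∃ M : ℝ, M = m * n * Λ * B := ⟨_, rfl⟩
  have hM0 : 0 ≤ M := by rw [hM]; exact mul_nonneg (by positivity) hB0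
  calc _ ≤ N * N + M * (2 * N * U) := by rw [hM]; linarith
    _ ≤ (1 + M) * (N ^ 2 + U ^ 2) := by
        nlinarith [mul_nonneg hM0 (sq_nonneg (N - U)), sq_nonneg U]
    _ ≤ (1 + M) * ((m + 1) * (S + U ^ 2)) := by
        refine mul_le_mul_of_nonneg_left ?_ (by positivity)
        nlinarith [mul_nonneg (Nat.cast_nonneg (α := ℝ) m) (sq_nonneg U)]
    _ = (1 + m * n * Λ * B) * (m + 1) * (S + U ^ 2) := by rw [hM]; ring

end CommutatorInequality

/-! ### The Carleman estimate -/

/-- The algebra of the Carleman estimate: `a`, `y`, `r`, `e` stand for `u`, `- div (A ∇ u)`, the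
lower order terms and the source after multiplication by the weight, `b` for `- φ' a`, where
`exp φ` is the weight, and `G` for the square of the norm of the gradient. -/
lemma carleman_algebra {H : Type*} [NormedAddCommGroup H] [InnerProductSpace ℝ H]
    {a y r b : H} {α C₁ C₂ l G ε : ℝ} (hC₁ : 0 ≤ C₁) (hC₂ : 0 ≤ C₂)
    (h1 : α * inner ℝ b a + 2 * ‖b‖ ^ 2 = 2 * inner ℝ b (y + r))
    (h2 : 2 * inner ℝ y (y + r) ≤ 2 * inner ℝ y b + C₁ * (G + ‖a‖ ^ 2))
    (hG : G ≤ l * inner ℝ y a)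
    (hr : ‖r‖ ^ 2 ≤ C₂ * (G + ‖a‖ ^ 2) + ε) (hb : ‖a‖ ^ 2 ≤ inner ℝ b a)
    (hα : α = (C₁ + C₂) * l + (C₁ + C₂) + ((C₁ + C₂) * l) ^ 2 + 1) : ‖a‖ ^ 2 ≤ ε := by
  set z := y - b with hz
  obtain ⟨C, hC⟩ : ∃ C, C = C₁ + C₂ := ⟨_, rfl⟩
  have hC0 : 0 ≤ C := by rw [hC]; positivity
  have hy : y = z + b := by rw [hz, sub_add_cancel]
  have hX0 : 0 ≤ inner ℝ b a := (sq_nonneg _).trans hb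
  -- one half of `2 ‖z‖ ^ 2` absorbs `⟪z, r⟫`, the other one the part `⟪z, a⟫` of the energy
  have h3 : 0 ≤ ‖z‖ ^ 2 + 2 * inner ℝ z r + ‖r‖ ^ 2 := by
    rw [← norm_add_sq_real]; exact sq_nonneg _
  have h4 : 0 ≤ ‖z‖ ^ 2 - C * l * inner ℝ z a + (C * l) ^ 2 * ‖a‖ ^ 2 := by
    have h5 : 0 ≤ ‖z - (C * l / 2) • a‖ ^ 2 := sq_nonneg _
    rw [norm_sub_sq_real, inner_smul_right, norm_smul, mul_pow, Real.norm_eq_abs, sq_abs] at h5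
    nlinarith [mul_nonneg (sq_nonneg (C * l)) (sq_nonneg ‖a‖)]
  rw [hy] at h1 h2 hG
  simp only [inner_add_left, inner_add_right, real_inner_self_eq_norm_sq] at h1 h2 hG
  rw [real_inner_comm z b] at h1
  have h6 : α * inner ℝ b a + ‖z‖ ^ 2 ≤ C * (G + ‖a‖ ^ 2) + ε := by
    rw [hC]; rw [real_inner_comm z b] at h2; linarith
  have h7 : C * G ≤ C * (l * (inner ℝ z a + inner ℝ b a)) := mul_le_mul_of_nonneg_left hG hC0
  have h8 : C * ‖a‖ ^ 2 ≤ C * inner ℝ b a := mul_le_mul_of_nonneg_left hb hC0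
  have h9 : (C * l) ^ 2 * ‖a‖ ^ 2 ≤ (C * l) ^ 2 * inner ℝ b a :=
    mul_le_mul_of_nonneg_left hb (sq_nonneg _)
  rw [← hC] at hα
  rw [hα] at h6
  nlinarith

section Carleman

variable {m n : ℕ} {co : Coeffs m n} {T T₁ l : ℝ} {u f F E₀ : L2Space m n}
  {g : Fin m → L2Space m n} {D : Fin n → L2Space m n →L[ℝ] L2Space m n}

/-- A smooth cutoff in time that is `1` near `[0, T]`. -/
def timeBump (T : ℝ) (t : ℝ) : ℝ := Real.smoothTransition (t + 2) * Real.smoothTransition (T + 2 - t)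

lemma timeBump_eq_one {t : ℝ} (h0 : -1 ≤ t) (h1 : t ≤ T + 1) : timeBump T t = 1 := by
  rw [timeBump, Real.smoothTransition.one_of_one_le (by linarith),
    Real.smoothTransition.one_of_one_le (by linarith), one_mul]

lemma timeBump_nonneg (T t : ℝ) : 0 ≤ timeBump T t :=
  mul_nonneg (Real.smoothTransition.nonneg _) (Real.smoothTransition.nonneg _)

lemma timeBump_le_one (T t : ℝ) : timeBump T t ≤ 1 :=
  mul_le_one₀ (Real.smoothTransition.le_one _) (Real.smoothTransition.nonneg _)
    (Real.smoothTransition.le_one _)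

lemma isTimeWeight_timeBump (T : ℝ) : IsTimeWeight (timeBump T) := by
  refine ⟨(Real.smoothTransition.contDiff.comp (contDiff_id.add contDiff_const)).mul
    (Real.smoothTransition.contDiff.comp (contDiff_const.sub contDiff_id)), ?_⟩
  refine HasCompactSupport.intro (isCompact_Icc (a := -2) (b := T + 2)) fun t ht => ?_
  rw [timeBump]
  rcases not_and_or.1 ht with h | h
  · rw [Real.smoothTransition.zero_of_nonpos (by linarith [not_le.1 h]), zero_mul]
  · rw [Real.smoothTransition.zero_of_nonpos (x := T + 2 - t) (by linarith [not_le.1 h]), mul_zero]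

lemma isTimeWeight_bump_mul (T : ℝ) {b : ℝ → ℝ} (hb : ContDiff ℝ ∞ b) :
    IsTimeWeight fun t => timeBump T t * b t :=
  ⟨(isTimeWeight_timeBump T).contDiff.mul hb, (isTimeWeight_timeBump T).hasCompactSupport.mul_right⟩

/-- The Carleman weight `exp (κ exp (- α t))`, cut off outside `[0, T]`. -/
def carlemanWeight (T α κ t : ℝ) : ℝ := timeBump T t * Real.exp (κ * Real.exp (-(α * t)))

/-- Minus the logarithmic derivative of the Carleman weight, cut off outside `[0, T]`. -/
def carlemanRate (T α κ t : ℝ) : ℝ := timeBump T t * (κ * α * Real.exp (-(α * t)))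

lemma isTimeWeight_carlemanWeight (T α κ : ℝ) : IsTimeWeight (carlemanWeight T α κ) :=
  isTimeWeight_bump_mul T (by fun_prop)

lemma isTimeWeight_carlemanRate (T α κ : ℝ) : IsTimeWeight (carlemanRate T α κ) :=
  isTimeWeight_bump_mul T (by fun_prop)

lemma eventually_timeBump_eq_one {t : ℝ} (ht : t ∈ Ioo 0 T) : ∀ᶠ r in 𝓝 t, timeBump T r = 1 := by
  filter_upwards [Ioo_mem_nhds ht.1 ht.2] with r hr
  exact timeBump_eq_one (by linarith [hr.1]) (by linarith [hr.2])

lemma hasDerivAt_carlemanRate {α κ t : ℝ} (ht : t ∈ Ioo 0 T) :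
    HasDerivAt (carlemanRate T α κ) (-(α * carlemanRate T α κ t)) t := by
  have h1 : HasDerivAt (fun t : ℝ => κ * α * Real.exp (-(α * t)))
      (κ * α * (Real.exp (-(α * t)) * (-(α * 1)))) t :=
    (((hasDerivAt_id t).const_mul α).neg.exp).const_mul _
  have h2 : carlemanRate T α κ t = κ * α * Real.exp (-(α * t)) := by
    rw [carlemanRate, (eventually_timeBump_eq_one ht).self_of_nhds, one_mul]
  rw [h2]
  refine (h1.congr_of_eventuallyEq ?_).congr_deriv (by ring)
  filter_upwards [eventually_timeBump_eq_one ht] with r hr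
  rw [carlemanRate, hr, one_mul]

lemma hasDerivAt_carlemanWeight {α κ t : ℝ} (ht : t ∈ Ioo 0 T) :
    HasDerivAt (carlemanWeight T α κ) (-(carlemanRate T α κ t * carlemanWeight T α κ t)) t := by
  have h1 : HasDerivAt (fun t : ℝ => Real.exp (κ * Real.exp (-(α * t))))
      (Real.exp (κ * Real.exp (-(α * t))) * (κ * (Real.exp (-(α * t)) * (-(α * 1))))) t :=
    ((((hasDerivAt_id t).const_mul α).neg.exp).const_mul _).exp
  have hb := (eventually_timeBump_eq_one ht).self_of_nhds
  rw [carlemanRate, carlemanWeight, hb, one_mul, one_mul]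
  refine (h1.congr_of_eventuallyEq ?_).congr_deriv (by ring)
  filter_upwards [eventually_timeBump_eq_one ht] with r hr
  rw [carlemanWeight, hr, one_mul]

/-- Time weights that agree in `(0, T)` act in the same way on functions living there. -/
lemma timeMul_congr {b c : ℝ → ℝ} (hb : IsTimeWeight b) (hc : IsTimeWeight c) {x : L2Space m n}
    (hx : timeMul m n (timeInd (Ioo 0 T)) x = x) (h : ∀ t ∈ Ioo 0 T, b t = c t) :
    timeMul m n b x = timeMul m n c x := by
  refine mulL_congr hb.isMultiplier hc.isMultiplier ?_
  filter_upwards [ae_mem_of_timeInd measurableSet_Ioo hx] with e he hne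
  exact h _ (he hne)

lemma IsTimeWeight.const_mul {b : ℝ → ℝ} (hb : IsTimeWeight b) (r : ℝ) :
    IsTimeWeight fun t => r * b t :=
  ⟨contDiff_const.mul hb.contDiff, hb.hasCompactSupport.mul_left⟩

lemma IsTimeWeight.add {b c : ℝ → ℝ} (hb : IsTimeWeight b) (hc : IsTimeWeight c) :
    IsTimeWeight fun t => b t + c t :=
  ⟨hb.contDiff.add hc.contDiff, hb.hasCompactSupport.add hc.hasCompactSupport⟩

lemma timeMul_mul {b c : ℝ → ℝ} (hb : IsTimeWeight b) (hc : IsTimeWeight c) (x : L2Space m n) :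
    timeMul m n (fun t => b t * c t) x = timeMul m n b (timeMul m n c x) :=
  (mulL_mulL hb.isMultiplier hc.isMultiplier x).symm

lemma timeMul_const_mul {b : ℝ → ℝ} (hb : IsTimeWeight b) (r : ℝ) (x : L2Space m n) :
    timeMul m n (fun t => r * b t) x = r • timeMul m n b x := by
  rw [← mulL_const]
  exact (mulL_mulL (IsMultiplier.const r) hb.isMultiplier x).symm

lemma timeMul_add {b c : ℝ → ℝ} (hb : IsTimeWeight b) (hc : IsTimeWeight c) (x : L2Space m n) :
    timeMul m n (fun t => b t + c t) x = timeMul m n b x + timeMul m n c x :=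
  mulL_add_fun hb.isMultiplier hc.isMultiplier x

lemma timeMul_comm {b c : ℝ → ℝ} (hb : IsTimeWeight b) (hc : IsTimeWeight c) (x : L2Space m n) :
    timeMul m n b (timeMul m n c x) = timeMul m n c (timeMul m n b x) :=
  mulL_comm hb.isMultiplier hc.isMultiplier x

lemma supp_timeMul {w : ℝ → ℝ} (hw : IsTimeWeight w) {x : L2Space m n}
    (hx : timeMul m n (timeInd (Ioo 0 T)) x = x) :
    timeMul m n (timeInd (Ioo 0 T)) (timeMul m n w x) = timeMul m n w x := by
  have h1 := mulL_comm (isMultiplier_timeInd measurableSet_Ioo) hw.isMultiplier x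
    (μ := (volume : Measure (Space m n))) (b := fun e => timeInd (Ioo 0 T) e.1)
  rw [timeMul, timeMul, h1]
  exact congrArg _ hx

lemma norm_sq_eq_integral (x : L2Space m n) : ‖x‖ ^ 2 = ∫ e, x e * x e := by
  rw [← real_inner_self_eq_norm_sq, real_inner_eq_integral]

/-- Integrated ellipticity. -/
lemma Coeffs.Admissible.ellipticity (hco : co.Admissible T l) {x : Fin m → L2Space m n}
    (hx : ∀ i, timeMul m n (timeInd (Ioo 0 T)) (x i) = x i) :
    ∑ i, ‖x i‖ ^ 2 ≤ l * ∑ i, ∑ j, inner ℝ (mulL volume (co.A i j) (x j)) (x i) := by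
  simp only [norm_sq_eq_integral, real_inner_eq_integral]
  rw [← integral_finsetSum _ fun i _ => integrable_mul_Lp _ _]
  simp only [← integral_finsetSum Finset.univ fun j _ =>
    integrable_mul_Lp (mulL volume (co.A _ j) (x j)) (x _)]
  rw [← integral_finsetSum Finset.univ fun i _ => integrable_finsetSum _ fun j _ =>
    integrable_mul_Lp (mulL volume (co.A i j) (x j)) (x i), ← integral_const_mul]
  refine integral_mono_ae (integrable_finsetSum _ fun i _ => integrable_mul_Lp _ _)
    ((integrable_finsetSum _ fun i _ => integrable_finsetSum _ fun j _ =>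
      integrable_mul_Lp (mulL volume (co.A i j) (x j)) (x i)).const_mul l) ?_
  have h1 : ∀ᵐ e, ∀ i, x i e ≠ 0 → e.1 ∈ Ioo 0 T :=
    ae_all_iff.2 fun i => ae_mem_of_timeInd measurableSet_Ioo (hx i)
  have h2 : ∀ᵐ e, ∀ i j, mulL volume (co.A i j) (x j) e = co.A i j e * x j e :=
    ae_all_iff.2 fun i => ae_all_iff.2 fun j => coeFn_mulL (hco.A_mult i j) (x j)
  filter_upwards [h1, h2] with e he1 he2
  simp only [he2]
  by_cases hz : ∀ i, x i e = 0
  · simp [hz]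
  · obtain ⟨i, hi⟩ := not_forall.1 hz
    have := hco.A_ell e ⟨he1 i hi, mem_univ _⟩ fun i => x i e
    simp only [sq] at this
    refine this.trans_eq ?_
    congr 1
    exact Finset.sum_congr rfl fun i _ => Finset.sum_congr rfl fun j _ => by ring

/-- Lower bound of the weighted Dirichlet energy. -/
lemma WeakSystem.energy_lower_bound (hco : co.Admissible T l)
    (h : WeakSystem co T T₁ u f F E₀ g) (hD : HasBoundedW u D) {w : ℝ → ℝ}
    (hw : IsTimeWeight w) :
    ∑ i, ‖timeMul m n w (g i)‖ ^ 2 ≤ l * inner ℝ (timeMul m n w F) (timeMul m n w u) := by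
  refine (hco.ellipticity fun i => supp_timeMul hw (h.supp_g i)).trans_eq ?_
  have h1 := h.inner_translateT hco hD (hw.mul hw) 0
  have h2 : ∀ k i (x : L2Space m n), timeMul m n (increment (co.q k i) 0) x = 0 := fun k i x => by
    have : increment (co.q k i) 0 = fun _ => 0 := by funext t; simp [increment]
    rw [timeMul, this, mulL_const, zero_smul]
  simp only [translateT_zero, h2, map_zero, inner_zero_right, Finset.sum_const_zero, add_zero,
    inner_timeMul_sq hw] at h1
  rw [h1]
  congr 1
  refine Finset.sum_congr rfl fun i _ => ?_
  rw [Coeffs.flux, map_sum, sum_inner]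
  exact Finset.sum_congr rfl fun j _ => by rw [mulL_comm hw.isMultiplier (hco.A_mult i j)]

/-- Bound of the lower order terms. -/
lemma WeakSystem.exists_lower_order_bound (hco : co.Admissible T l)
    (h : WeakSystem co T T₁ u f F E₀ g) :
    ∃ C : ℝ, 0 ≤ C ∧ ∀ w : ℝ → ℝ, IsTimeWeight w →
      ‖timeMul m n w (f - F)‖ ^ 2 ≤
        C * (∑ i, ‖timeMul m n w (g i)‖ ^ 2 + ‖timeMul m n w u‖ ^ 2) +
          3 * ‖timeMul m n w E₀‖ ^ 2 := by
  obtain ⟨L, hL⟩ := hco.c_mult.2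
  choose M hM using fun j => (hco.d_mult j).2
  have hM0 : ∀ j, 0 ≤ M j := fun j => (abs_nonneg _).trans (hM j 0)
  set B := ∑ j, M j
  have hB0 : 0 ≤ B := Finset.sum_nonneg fun j _ => hM0 j
  refine ⟨3 * (L ^ 2 + B ^ 2 * m), by positivity, fun w hw => ?_⟩
  have e1 : timeMul m n w (f - F) = mulL volume co.c (timeMul m n w u) +
      ∑ j, mulL volume (co.d j) (timeMul m n w (g j)) + timeMul m n w E₀ := by
    rw [h.split, add_sub_cancel_left, map_add, map_add, map_sum, mulL_comm hw.isMultiplier hco.c_mult]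
    congr 2
    exact Finset.sum_congr rfl fun j _ => mulL_comm hw.isMultiplier (hco.d_mult j) _
  set N := ∑ j, ‖timeMul m n w (g j)‖ with hN
  have hN0 : 0 ≤ N := Finset.sum_nonneg fun j _ => norm_nonneg _
  have h1 : ‖mulL volume co.c (timeMul m n w u)‖ ≤ L * ‖timeMul m n w u‖ :=
    norm_mulL_le hco.c_mult.1 hL _
  have h2 : ‖∑ j, mulL volume (co.d j) (timeMul m n w (g j))‖ ≤ B * N := by
    rw [hN, Finset.mul_sum]
    refine (norm_sum_le _ _).trans (Finset.sum_le_sum fun j _ => ?_)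
    refine (norm_mulL_le (hco.d_mult j).1 (hM j) _).trans
      (mul_le_mul_of_nonneg_right ?_ (norm_nonneg _))
    exact Finset.single_le_sum (f := M) (fun j _ => hM0 j) (Finset.mem_univ j)
  have h3 : ‖timeMul m n w (f - F)‖ ≤ L * ‖timeMul m n w u‖ + B * N + ‖timeMul m n w E₀‖ := by
    rw [e1]
    exact (norm_add_le _ _).trans (add_le_add_left ((norm_add_le _ _).trans (add_le_add h1 h2)) _)
  have h4 : N ^ 2 ≤ m * ∑ i, ‖timeMul m n w (g i)‖ ^ 2 := by
    simpa using sq_sum_le_card_mul_sum_sq (s := Finset.univ)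
      (f := fun i => ‖timeMul m n w (g i)‖)
  have hS0 : 0 ≤ ∑ i, ‖timeMul m n w (g i)‖ ^ 2 := Finset.sum_nonneg fun i _ => sq_nonneg _
  set S := ∑ i, ‖timeMul m n w (g i)‖ ^ 2
  set U := ‖timeMul m n w u‖
  set V := ‖timeMul m n w E₀‖
  have h5 : ‖timeMul m n w (f - F)‖ ^ 2 ≤ (L * U + B * N + V) ^ 2 :=
    pow_le_pow_left₀ (norm_nonneg _) h3 2
  have h6 : (L * U + B * N + V) ^ 2 ≤ 3 * ((L * U) ^ 2 + (B * N) ^ 2 + V ^ 2) := by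
    nlinarith [sq_nonneg (L * U - B * N), sq_nonneg (L * U - V), sq_nonneg (B * N - V)]
  have h7 : B ^ 2 * N ^ 2 ≤ B ^ 2 * (m * S) := mul_le_mul_of_nonneg_left h4 (sq_nonneg _)
  have h8 : 0 ≤ L ^ 2 * S := by positivity
  have h9 : 0 ≤ B ^ 2 * m * U ^ 2 := by positivity
  nlinarith

/-- **Carleman estimate.** The exponent `α` is fixed by the system; the estimate holds with a
uniform constant for all large `κ`. -/
lemma WeakSystem.carleman (hl : 0 ≤ l) (hco : co.Admissible T l)
    (h : WeakSystem co T T₁ u f F E₀ g) (hD : HasBoundedW u D) :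
    ∃ α : ℝ, 0 < α ∧ ∀ κ : ℝ, 1 ≤ κ * α * Real.exp (-(α * T)) →
      ‖timeMul m n (carlemanWeight T α κ) u‖ ^ 2 ≤
        3 * ‖timeMul m n (carlemanWeight T α κ) E₀‖ ^ 2 := by
  obtain ⟨C₁, hC₁, hdir⟩ := h.exists_dirichlet_inequality hco hD
  obtain ⟨C₂, hC₂, hlow⟩ := h.exists_lower_order_bound hco
  obtain ⟨α, hα⟩ : ∃ α, α = (C₁ + C₂) * l + (C₁ + C₂) + ((C₁ + C₂) * l) ^ 2 + 1 := ⟨_, rfl⟩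
  have hα0 : 0 < α := by rw [hα]; positivity
  refine ⟨α, hα0, fun κ hκ => ?_⟩
  have hw := isTimeWeight_carlemanWeight T α κ
  have hp := isTimeWeight_carlemanRate T α κ
  have hw' := fun t (ht : t ∈ Ioo 0 T) => hasDerivAt_carlemanWeight (α := α) (κ := κ) ht
  have hp' := fun t (ht : t ∈ Ioo 0 T) => hasDerivAt_carlemanRate (α := α) (κ := κ) ht
  have hp1 : ∀ t ∈ Ioo 0 T, 1 ≤ carlemanRate T α κ t := by
    intro t ht
    rw [carlemanRate, (eventually_timeBump_eq_one ht).self_of_nhds, one_mul]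
    refine hκ.trans (mul_le_mul_of_nonneg_left (Real.exp_le_exp.2 ?_) ?_)
    · have := mul_le_mul_of_nonneg_left ht.2.le hα0.le
      linarith
    · by_contra hneg
      have := mul_nonpos_of_nonpos_of_nonneg (not_le.1 hneg).le (Real.exp_pos (-(α * T))).le
      linarith
  set w := carlemanWeight T α κ
  set p := carlemanRate T α κ
  have hww := hw.mul hw
  refine carleman_algebra (y := timeMul m n w F) (r := timeMul m n w (f - F))
    (b := timeMul m n p (timeMul m n w u)) hC₁ hC₂ ?_ ?_
    (h.energy_lower_bound hco hD hw) (hlow w hw) ?_ hα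
  -- the energy identity with the weight `p w²`, where `(p w²)' = - α p w² - 2 p² w²`
  · have e1 := energy_identity (hp.mul hww) h.deriv_time
    have e2 : timeMul m n (deriv fun t => p t * (w t * w t)) u = timeMul m n
        (fun t => (-α) * (p t * (w t * w t)) + (-2) * (p t * (p t * (w t * w t)))) u := by
      refine timeMul_congr (hp.mul hww).deriv (((hp.mul hww).const_mul _).add
        ((hp.mul (hp.mul hww)).const_mul _)) h.supp_u fun t ht => ?_
      rw [((hp' t ht).fun_mul ((hw' t ht).fun_mul (hw' t ht))).deriv]
      ring
    rw [e2, timeMul_add ((hp.mul hww).const_mul _) ((hp.mul (hp.mul hww)).const_mul _),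
      timeMul_const_mul (hp.mul hww), timeMul_const_mul (hp.mul (hp.mul hww)),
      timeMul_mul hp (hp.mul hww), timeMul_mul hp hww, timeMul_sq hw] at e1
    rw [← map_add, add_sub_cancel]
    have e3 : inner ℝ (timeMul m n p (timeMul m n w (timeMul m n w u))) u =
        inner ℝ (timeMul m n p (timeMul m n w u)) (timeMul m n w u) := by
      rw [timeMul_comm hp hw, inner_timeMul_left hw]
    have e4 : inner ℝ (timeMul m n p (timeMul m n p (timeMul m n w (timeMul m n w u)))) u =
        ‖timeMul m n p (timeMul m n w u)‖ ^ 2 := by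
      rw [timeMul_comm hp hw, timeMul_comm hp hw, inner_timeMul_left hw, inner_timeMul_left hp,
        real_inner_self_eq_norm_sq]
    have e5 : inner ℝ (timeMul m n p (timeMul m n w (timeMul m n w u))) f =
        inner ℝ (timeMul m n p (timeMul m n w u)) (timeMul m n w f) := by
      rw [timeMul_comm hp hw, inner_timeMul_left hw]
    rw [inner_add_left, inner_smul_left, inner_smul_left, e3, e4, e5] at e1
    simp only [conj_trivial] at e1
    linarith
  -- the inequality for the Dirichlet energy, where `(w²)' = - 2 p w²`
  · have e1 := hdir w hw
    have e2 : timeMul m n (deriv fun t => w t * w t) F =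
        timeMul m n (fun t => (-2) * (p t * (w t * w t))) F := by
      refine timeMul_congr hww.deriv ((hp.mul hww).const_mul _) h.supp_F fun t ht => ?_
      rw [((hw' t ht).fun_mul (hw' t ht)).deriv]
      ring
    rw [e2, timeMul_const_mul (hp.mul hww), timeMul_mul hp hww, timeMul_sq hw, inner_smul_left,
      conj_trivial] at e1
    have e3 : inner ℝ (timeMul m n p (timeMul m n w (timeMul m n w F))) u =
        inner ℝ (timeMul m n w F) (timeMul m n p (timeMul m n w u)) := by
      rw [inner_timeMul_left hp, inner_timeMul_left hw, timeMul_comm hp hw]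
    rw [e3, inner_timeMul_left hw] at e1
    rw [← map_add, add_sub_cancel]
    linarith
  -- `1 ≤ p` in `(0, T)`
  · rw [← real_inner_self_eq_norm_sq]
    have e1 := inner_mulL_mono (x := timeMul m n w u) (IsMultiplier.const 1) hp.isMultiplier (by
      filter_upwards [ae_mem_of_timeInd measurableSet_Ioo (supp_timeMul hw h.supp_u)] with e he hne
      exact hp1 _ (he hne))
    rw [mulL_const, one_smul] at e1
    exact e1

end Carleman

/-! ### Vanishing of the solutions of the straightened system -/

section Vanishing

variable {m n : ℕ} {co : Coeffs m n} {T T₁ l : ℝ} {u f F E₀ : L2Space m n}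
  {g : Fin m → L2Space m n} {D : Fin n → L2Space m n →L[ℝ] L2Space m n}

lemma norm_timeInd_mul_le {α κ T₀ : ℝ} (hα : 0 < α) (hκ : 0 ≤ κ)
    (hu : timeMul m n (timeInd (Ioo 0 T)) u = u) :
    ‖timeMul m n (timeInd (Iio T₀)) u‖ ≤
      Real.exp (-(κ * Real.exp (-(α * T₀)))) * ‖timeMul m n (carlemanWeight T α κ) u‖ := by
  set b : ℝ → ℝ := (Iio T₀).indicator fun t => Real.exp (-(κ * Real.exp (-(α * t)))) with hb
  have hbC : ∀ t, |b t| ≤ Real.exp (-(κ * Real.exp (-(α * T₀)))) := by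
    intro t
    by_cases ht : t ∈ Iio T₀
    · rw [hb, indicator_of_mem ht, abs_of_pos (Real.exp_pos _)]
      refine Real.exp_le_exp.2 (neg_le_neg (mul_le_mul_of_nonneg_left (Real.exp_le_exp.2 ?_) hκ))
      exact neg_le_neg (mul_le_mul_of_nonneg_left (le_of_lt ht) hα.le)
    · rw [hb, indicator_of_notMem ht, abs_zero]; positivity
  have hbm : Measurable b := (by fun_prop : Measurable fun t : ℝ =>
    Real.exp (-(κ * Real.exp (-(α * t))))).indicator measurableSet_Iio
  have hbm' : Measurable fun e : Space m n => b e.1 := hbm.comp measurable_fst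
  have hw := (isTimeWeight_carlemanWeight T α κ).isMultiplier (m := m) (n := n)
  have e1 : timeMul m n (timeInd (Iio T₀)) u =
      timeMul m n b (timeMul m n (carlemanWeight T α κ) u) := by
    rw [timeMul, timeMul, timeMul, mulL_mulL ⟨hbm', _, fun e => hbC e.1⟩ hw]
    refine mulL_congr (isMultiplier_timeInd measurableSet_Iio)
      (IsMultiplier.mul ⟨hbm', _, fun e => hbC e.1⟩ hw) ?_
    filter_upwards [ae_mem_of_timeInd measurableSet_Ioo hu] with e he hne
    have ht := he hne
    rw [carlemanWeight, (eventually_timeBump_eq_one ht).self_of_nhds, one_mul]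
    by_cases h0 : e.1 ∈ Iio T₀
    · rw [timeInd, hb, indicator_of_mem h0, indicator_of_mem h0, ← Real.exp_add, neg_add_cancel,
        Real.exp_zero]
    · rw [timeInd, hb, indicator_of_notMem h0, indicator_of_notMem h0, zero_mul]
  rw [e1]
  exact norm_mulL_le hbm' (fun e => hbC e.1) _

lemma norm_carlemanWeight_mul_le {α κ : ℝ} (hα : 0 < α) (hκ : 0 ≤ κ)
    (hE : timeMul m n (timeInd (Iio T₁)) E₀ = 0) :
    ‖timeMul m n (carlemanWeight T α κ) E₀‖ ≤
      Real.exp (κ * Real.exp (-(α * T₁))) * ‖E₀‖ := by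
  set b : ℝ → ℝ := (Ici T₁).indicator (carlemanWeight T α κ) with hb
  have hw := isTimeWeight_carlemanWeight T α κ
  have hbC : ∀ t, |b t| ≤ Real.exp (κ * Real.exp (-(α * T₁))) := by
    intro t
    by_cases ht : t ∈ Ici T₁
    · rw [hb, indicator_of_mem ht, carlemanWeight, abs_mul, abs_of_nonneg (timeBump_nonneg T t),
        abs_of_pos (Real.exp_pos _)]
      refine (mul_le_of_le_one_left (Real.exp_pos _).le (timeBump_le_one T t)).trans ?_
      refine Real.exp_le_exp.2 (mul_le_mul_of_nonneg_left (Real.exp_le_exp.2 ?_) hκ)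
      exact neg_le_neg (mul_le_mul_of_nonneg_left ht hα.le)
    · rw [hb, indicator_of_notMem ht, abs_zero]; positivity
  have hbm : Measurable b := hw.contDiff.continuous.measurable.indicator measurableSet_Ici
  have hbm' : Measurable fun e : Space m n => b e.1 := hbm.comp measurable_fst
  have e1 : timeMul m n (carlemanWeight T α κ) E₀ = timeMul m n b E₀ := by
    refine mulL_congr hw.isMultiplier ⟨hbm', _, fun e => hbC e.1⟩ ?_
    have h0 := coeFn_mulL (isMultiplier_timeInd (m := m) (n := n) (S := Iio T₁) measurableSet_Iio) E₀
    have h1 : mulL volume (fun e : Space m n => timeInd (Iio T₁) e.1) E₀ = 0 := hE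
    rw [h1] at h0
    filter_upwards [h0, Lp.coeFn_zero ℝ 2 (volume : Measure (Space m n))] with e he hz hne
    have ht : e.1 ∈ Ici T₁ := by
      by_contra hlt
      have hlt' : e.1 < T₁ := not_le.1 hlt
      rw [timeInd, indicator_of_mem (mem_Iio.2 hlt'), hz, one_mul] at he
      exact hne he.symm
    rw [hb, indicator_of_mem ht]
  rw [e1]
  exact norm_mulL_le hbm' (fun e => hbC e.1) _

/-- Letting `κ → ∞` in the Carleman estimate. -/
lemma WeakSystem.vanish_of_bounded (hl : 0 ≤ l) (hco : co.Admissible T l)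
    (h : WeakSystem co T T₁ u f F E₀ g) (hD : HasBoundedW u D) {T₀ : ℝ} (hT : T₀ < T₁) :
    timeMul m n (timeInd (Iio T₀)) u = 0 := by
  obtain ⟨α, hα, hcar⟩ := h.carleman hl hco hD
  set δ : ℝ := Real.exp (-(α * T₀)) - Real.exp (-(α * T₁)) with hδ
  have hδ0 : 0 < δ := sub_pos.2 (Real.exp_lt_exp.2 (neg_lt_neg (mul_lt_mul_of_pos_left hT hα)))
  have hbound : ∀ᶠ κ : ℝ in atTop, ‖timeMul m n (timeInd (Iio T₀)) u‖ ≤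
      Real.exp (-(κ * δ)) * (2 * ‖E₀‖) := by
    filter_upwards [eventually_ge_atTop 0,
      eventually_ge_atTop (1 / (α * Real.exp (-(α * T))))] with κ hκ0 hκ
    have h1 : 1 ≤ κ * α * Real.exp (-(α * T)) := by
      rw [mul_assoc]
      rwa [div_le_iff₀ (by positivity)] at hκ
    have h2 : ‖timeMul m n (carlemanWeight T α κ) u‖ ≤
        2 * ‖timeMul m n (carlemanWeight T α κ) E₀‖ := by
      refine le_of_sq_le_sq ?_ (by positivity)
      have := hcar κ h1
      nlinarith [sq_nonneg ‖timeMul m n (carlemanWeight T α κ) E₀‖]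
    calc _ ≤ Real.exp (-(κ * Real.exp (-(α * T₀)))) * ‖timeMul m n (carlemanWeight T α κ) u‖ :=
          norm_timeInd_mul_le hα hκ0 h.supp_u
      _ ≤ Real.exp (-(κ * Real.exp (-(α * T₀)))) *
          (2 * (Real.exp (κ * Real.exp (-(α * T₁))) * ‖E₀‖)) := by
          refine mul_le_mul_of_nonneg_left (h2.trans ?_) (Real.exp_pos _).le
          exact mul_le_mul_of_nonneg_left (norm_carlemanWeight_mul_le hα hκ0 h.supp_E₀) two_pos.le
      _ = Real.exp (-(κ * δ)) * (2 * ‖E₀‖) := by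
          rw [show -(κ * δ) = -(κ * Real.exp (-(α * T₀))) + κ * Real.exp (-(α * T₁)) by
            rw [hδ]; ring, Real.exp_add]
          ring
  have hlim : Tendsto (fun κ : ℝ => Real.exp (-(κ * δ)) * (2 * ‖E₀‖)) atTop (𝓝 0) := by
    have : Tendsto (fun κ : ℝ => Real.exp (-(κ * δ))) atTop (𝓝 0) :=
      Real.tendsto_exp_neg_atTop_nhds_zero.comp (tendsto_id.atTop_mul_const hδ0)
    simpa using this.mul_const (2 * ‖E₀‖)
  exact norm_le_zero_iff.1 (ge_of_tendsto hlim hbound)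

/-- Uniqueness for the straightened system, by approximation with band-limited functions. -/
lemma WeakSystem.vanish (hl : 0 ≤ l) (hco : co.Admissible T l)
    (h : WeakSystem co T T₁ u f F E₀ g) {T₀ : ℝ} (hT : T₀ < T₁) :
    timeMul m n (timeInd (Iio T₀)) u = 0 := by
  obtain ⟨ρ, σ, hρ, hσ, hρ1, hρσ, hσd, hσ'⟩ := exists_bandlimited (EuclideanSpace ℝ (Fin n))
  have h1 : ∀ k : ℕ, timeMul m n (timeInd (Iio T₀))
      (Ultraparabolic.avgW m n (1 / ((k : ℝ) + 1)) ρ u) = 0 := by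
    intro k
    have hk : (1 / ((k : ℝ) + 1)) ≠ 0 := by positivity
    obtain ⟨D, hD⟩ := exists_hasBoundedW hρ hσ hρσ hσd hσ' hk u
    exact (h.avgW hco _ hρ).vanish_of_bounded hl hco hD hT
  have h2 := ((timeMul m n (timeInd (Iio T₀))).continuous.tendsto u).comp
    (tendsto_average (μ := (volume : Measure (Space m n))) (inclW m n) hρ hρ1 u)
  refine tendsto_nhds_unique h2 ?_
  simp only [Function.comp_def]
  have h3 : (fun k : ℕ => timeMul m n (timeInd (Iio T₀)) (average volume volume
      ((1 / ((k : ℝ) + 1)) • inclW m n) ρ u)) = fun _ => 0 := funext h1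
  rw [h3]
  exact tendsto_const_nhds

end Vanishing

/-! ### Straightening of the transport field -/

section Straightening

variable {m n : ℕ} (b₁ : EuclideanSpace ℝ (Fin m) →L[ℝ] EuclideanSpace ℝ (Fin n))
  (b₂ : EuclideanSpace ℝ (Fin n) →L[ℝ] EuclideanSpace ℝ (Fin n))

/-- The group `exp (t B₂)`. -/
def flowExp (t : ℝ) : EuclideanSpace ℝ (Fin n) →L[ℝ] EuclideanSpace ℝ (Fin n) :=
  NormedSpace.exp (t • b₂)

lemma flowExp_neg_mul (t : ℝ) : flowExp b₂ (-t) * flowExp b₂ t = 1 := by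
  have hc : Commute ((-t) • b₂) (t • b₂) := by
    ext x
    simp
  have h0 : (-t) • b₂ + t • b₂ = 0 := by
    ext x
    simp
  let +nondep : NormedAlgebra ℚ (EuclideanSpace ℝ (Fin n) →L[ℝ] EuclideanSpace ℝ (Fin n)) :=
    NormedAlgebra.restrictScalars ℚ ℝ _
  rw [flowExp, flowExp, ← NormedSpace.exp_add_of_commute hc, h0, NormedSpace.exp_zero]

lemma flowExp_mul_neg (t : ℝ) : flowExp b₂ t * flowExp b₂ (-t) = 1 := by
  simpa using flowExp_neg_mul b₂ (-t)

lemma hasDerivAt_flowExp (t : ℝ) : HasDerivAt (flowExp b₂) (flowExp b₂ t * b₂) t :=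
  hasDerivAt_exp_smul_const b₂ t

lemma contDiff_flowExp : ContDiff ℝ ∞ (flowExp b₂) := by
  have h : ContDiff ℝ ∞ (NormedSpace.exp : (EuclideanSpace ℝ (Fin n) →L[ℝ]
      EuclideanSpace ℝ (Fin n)) → _) := by
    rw [contDiff_iff_contDiffAt]
    exact fun x => (NormedSpace.exp_analytic (𝕂 := ℝ) x).contDiffAt
  exact h.comp (contDiff_id.smul contDiff_const)

/-- The matrix `Q(t) = ∫₀ᵗ exp (- s B₂) B₁ ds`. -/
def shear (t : ℝ) : EuclideanSpace ℝ (Fin m) →L[ℝ] EuclideanSpace ℝ (Fin n) :=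
  ∫ s in (0:ℝ)..t, (flowExp b₂ (-s)).comp b₁

lemma contDiff_shear_deriv : ContDiff ℝ ∞ fun s => (flowExp b₂ (-s)).comp b₁ :=
  ((contDiff_flowExp b₂).comp contDiff_neg).clm_comp contDiff_const

lemma hasDerivAt_shear (t : ℝ) :
    HasDerivAt (shear b₁ b₂) ((flowExp b₂ (-t)).comp b₁) t := by
  have hc := (contDiff_shear_deriv b₁ b₂).continuous
  exact intervalIntegral.integral_hasDerivAt_right (hc.intervalIntegrable _ _)
    (hc.stronglyMeasurableAtFilter _ _) hc.continuousAt

lemma contDiff_shear : ContDiff ℝ ∞ (shear b₁ b₂) := by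
  rw [contDiff_infty_iff_deriv]
  refine ⟨fun t => (hasDerivAt_shear b₁ b₂ t).differentiableAt, ?_⟩
  rw [funext fun t => (hasDerivAt_shear b₁ b₂ t).deriv]
  exact contDiff_shear_deriv b₁ b₂

/-- The straightening map `(t, v, w) ↦ (t, v, exp (- t B₂) w - Q(t) v)`. -/
def straighten (p : Space m n) : Space m n :=
  (p.1, p.2.1, flowExp b₂ (-p.1) p.2.2 - shear b₁ b₂ p.1 p.2.1)

/-- The inverse of the straightening map. -/
def unstraighten (e : Space m n) : Space m n :=
  (e.1, e.2.1, flowExp b₂ e.1 (e.2.2 + shear b₁ b₂ e.1 e.2.1))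

lemma straighten_unstraighten (e : Space m n) :
    straighten b₁ b₂ (unstraighten b₁ b₂ e) = e := by
  have h : flowExp b₂ (-e.1) (flowExp b₂ (e.1) (e.2.2 + shear b₁ b₂ e.1 e.2.1)) = (e.2.2 + shear b₁ b₂ e.1 e.2.1) :=
    congrArg (fun L => L (e.2.2 + shear b₁ b₂ e.1 e.2.1)) (flowExp_neg_mul b₂ e.1)
  refine Prod.ext rfl (Prod.ext rfl ?_)
  simp only [straighten, unstraighten]
  rw [h, add_sub_cancel_right]

lemma unstraighten_straighten (p : Space m n) :
    unstraighten b₁ b₂ (straighten b₁ b₂ p) = p := by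
  have h : flowExp b₂ (p.1) (flowExp b₂ (-p.1) p.2.2) = p.2.2 :=
    congrArg (fun L => L p.2.2) (flowExp_mul_neg b₂ p.1)
  refine Prod.ext rfl (Prod.ext rfl ?_)
  simp only [straighten, unstraighten]
  rw [sub_add_cancel, h]

lemma contDiff_straighten : ContDiff ℝ ∞ (straighten b₁ b₂) := by
  refine contDiff_fst.prodMk (contDiff_snd.fst.prodMk ?_)
  exact (((contDiff_flowExp b₂).comp contDiff_fst.neg).clm_apply contDiff_snd.snd).sub
    (((contDiff_shear b₁ b₂).comp contDiff_fst).clm_apply contDiff_snd.fst)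

lemma contDiff_unstraighten : ContDiff ℝ ∞ (unstraighten b₁ b₂) := by
  refine contDiff_fst.prodMk (contDiff_snd.fst.prodMk ?_)
  exact ((contDiff_flowExp b₂).comp contDiff_fst).clm_apply (contDiff_snd.snd.add
    (((contDiff_shear b₁ b₂).comp contDiff_fst).clm_apply contDiff_snd.fst))

/-- The straightening map as a homeomorphism. -/
def straightenHomeomorph : Space m n ≃ₜ Space m n where
  toFun := straighten b₁ b₂
  invFun := unstraighten b₁ b₂
  left_inv := unstraighten_straighten b₁ b₂
  right_inv := straighten_unstraighten b₁ b₂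
  continuous_toFun := (contDiff_straighten b₁ b₂).continuous
  continuous_invFun := (contDiff_unstraighten b₁ b₂).continuous

lemma fderiv_comp_straighten {φ : Space m n → ℝ} (hφ : ContDiff ℝ ∞ φ) (p X : Space m n)
    {Y : Space m n} (h : HasDerivAt (fun r : ℝ => straighten b₁ b₂ (p + r • X)) Y 0) :
    fderiv ℝ (fun p => φ (straighten b₁ b₂ p)) p X = fderiv ℝ φ (straighten b₁ b₂ p) Y := by
  have hd : DifferentiableAt ℝ (fun p => φ (straighten b₁ b₂ p)) p :=
    ((hφ.comp (contDiff_straighten b₁ b₂)).differentiable (by simp)) p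
  have h1 := hd.hasFDerivAt.hasLineDerivAt X
  have h2 : HasFDerivAt φ (fderiv ℝ φ (straighten b₁ b₂ p))
      (straighten b₁ b₂ (p + (0:ℝ) • X)) := by
    rw [zero_smul, add_zero]
    exact ((hφ.differentiable (by simp)) _).hasFDerivAt
  exact h1.unique (h2.comp_hasDerivAt (0:ℝ) h)

/-- In the straightened variables the transport field is the time derivative. -/
lemma fderiv_comp_straighten_transport {φ : Space m n → ℝ} (hφ : ContDiff ℝ ∞ φ)
    (p : Space m n) :
    fderiv ℝ (fun p => φ (straighten b₁ b₂ p)) p (1, 0, b₁ p.2.1 + b₂ p.2.2) =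
      fderiv ℝ φ (straighten b₁ b₂ p) dirT := by
  refine fderiv_comp_straighten b₁ b₂ hφ p _ ?_
  have ht : HasDerivAt (fun r : ℝ => p.1 + r * 1) 1 0 := by
    simpa using (hasDerivAt_id (0:ℝ)).const_add p.1
  have ht' : HasDerivAt (fun r : ℝ => -(p.1 + r * 1)) (-1) 0 := ht.neg
  have hw : HasDerivAt (fun r : ℝ => p.2.2 + r • (b₁ p.2.1 + b₂ p.2.2))
      (b₁ p.2.1 + b₂ p.2.2) 0 := by
    simpa using ((hasDerivAt_id (0:ℝ)).smul_const (b₁ p.2.1 + b₂ p.2.2)).const_add p.2.2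
  have h1 : HasDerivAt (fun r : ℝ => flowExp b₂ (-(p.1 + r * 1)))
      (-(flowExp b₂ (-p.1) * b₂)) 0 := by
    have := (hasDerivAt_flowExp b₂ (-(p.1 + 0 * 1))).scomp (0:ℝ) ht'
    simpa [Function.comp_def] using this
  have h2 : HasDerivAt (fun r : ℝ => shear b₁ b₂ (p.1 + r * 1)) ((flowExp b₂ (-p.1)).comp b₁) 0 := by
    have := (hasDerivAt_shear b₁ b₂ (p.1 + 0 * 1)).scomp (0:ℝ) ht
    simpa [Function.comp_def] using this
  have h3 := (h1.clm_apply hw).sub (h2.clm_apply (hasDerivAt_const (0:ℝ) p.2.1))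
  have h4 : HasDerivAt (fun r : ℝ => (p.1 + r * 1, p.2.1, flowExp b₂ (-(p.1 + r * 1))
      (p.2.2 + r • (b₁ p.2.1 + b₂ p.2.2)) - shear b₁ b₂ (p.1 + r * 1) p.2.1))
      ((1, 0, 0) : Space m n) 0 := by
    refine ht.prodMk ((hasDerivAt_const (0:ℝ) p.2.1).prodMk ?_)
    refine h3.congr_deriv ?_
    simp
  refine h4.congr_of_eventuallyEq (Eventually.of_forall fun r => ?_)
  simp [straighten]

/-- In the straightened variables `∂_{v_i}` becomes `∂_{v_i} - ∑ k, Q_{k i}(t) ∂_{w_k}`. -/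
lemma fderiv_comp_straighten_dirV {φ : Space m n → ℝ} (hφ : ContDiff ℝ ∞ φ)
    (i : Fin m) (p : Space m n) :
    fderiv ℝ (fun p => φ (straighten b₁ b₂ p)) p (dirV i) =
      fderiv ℝ φ (straighten b₁ b₂ p) (dirV i) -
        ∑ k, shear b₁ b₂ p.1 (EuclideanSpace.single i 1) k *
          fderiv ℝ φ (straighten b₁ b₂ p) (dirW k) := by
  set q := shear b₁ b₂ p.1 (EuclideanSpace.single i 1) with hq
  have hv : HasDerivAt (fun r : ℝ => p.2.1 + r • (EuclideanSpace.single i 1 :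
      EuclideanSpace ℝ (Fin m))) (EuclideanSpace.single i 1) 0 := by
    simpa using ((hasDerivAt_id (0:ℝ)).smul_const (EuclideanSpace.single i 1 :
      EuclideanSpace ℝ (Fin m))).const_add p.2.1
  have h4 : HasDerivAt (fun r : ℝ => straighten b₁ b₂ (p + r • (dirV i : Space m n)))
      (0, EuclideanSpace.single i 1, -q) 0 := by
    have h3 : HasDerivAt (fun r : ℝ => (p.1, p.2.1 + r • (EuclideanSpace.single i 1 :
        EuclideanSpace ℝ (Fin m)), flowExp b₂ (-p.1) p.2.2 - shear b₁ b₂ p.1 (p.2.1 + r •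
        (EuclideanSpace.single i 1 : EuclideanSpace ℝ (Fin m)))))
        ((0, EuclideanSpace.single i 1, -q) : Space m n) 0 := by
      refine (hasDerivAt_const (0:ℝ) p.1).prodMk (hv.prodMk ?_)
      have := (shear b₁ b₂ p.1).hasFDerivAt.comp_hasDerivAt (0:ℝ) hv
      simpa using this.const_sub (flowExp b₂ (-p.1) p.2.2)
    refine h3.congr_of_eventuallyEq (Eventually.of_forall fun r => ?_)
    simp [straighten, dirV]
  rw [fderiv_comp_straighten b₁ b₂ hφ p _ h4]
  have hsplit : ((0, EuclideanSpace.single i 1, -q) : Space m n) =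
      dirV i - ∑ k, q k • dirW k := by
    have h5 : (∑ k, q k • (dirW k : Space m n)) = inclW m n q := by
      have h6 : q = ∑ k, q k • EuclideanSpace.single k (1:ℝ) := by
        ext j
        simp [Finset.sum_apply, Pi.single_apply]
      conv_rhs => rw [h6]
      rw [map_sum]
      exact Finset.sum_congr rfl fun k _ => by rw [map_smul]; rfl
    rw [h5]
    simp [dirV, inclW_apply]
  rw [hsplit, map_sub, map_sum]
  simp

end Straightening

/-! ### The change of variables in integrals -/

section ChangeOfVariables

open scoped NNReal ENNReal

variable {m n : ℕ} (b₁ : EuclideanSpace ℝ (Fin m) →L[ℝ] EuclideanSpace ℝ (Fin n))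
  (b₂ : EuclideanSpace ℝ (Fin n) →L[ℝ] EuclideanSpace ℝ (Fin n))

/-- The Jacobian of `unstraighten`, a function of time alone. -/
def jac (t : ℝ) : ℝ≥0 := ‖(flowExp b₂ t).det‖₊

lemma continuous_jac : Continuous (jac b₂) :=
  (ContinuousLinearMap.continuous_det.comp (contDiff_flowExp b₂).continuous).nnnorm

lemma det_flowExp_ne_zero (t : ℝ) : (flowExp b₂ t).det ≠ 0 := by
  have h : (flowExp b₂ (-t) * flowExp b₂ t).det = 1 := by
    rw [flowExp_neg_mul]
    exact LinearMap.det_id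
  have h2 : (flowExp b₂ (-t)).det * (flowExp b₂ t).det = 1 := by
    rw [← h]
    exact (LinearMap.det_comp _ _).symm
  exact right_ne_zero_of_mul_eq_one h2

lemma jac_pos (t : ℝ) : 0 < jac b₂ t := nnnorm_pos.2 (det_flowExp_ne_zero b₂ t)

lemma lintegral_flowExp (t : ℝ) (c : EuclideanSpace ℝ (Fin n))
    {F : EuclideanSpace ℝ (Fin n) → ℝ≥0∞} (hF : Measurable F) :
    ∫⁻ w, jac b₂ t * F (flowExp b₂ t (w + c)) = ∫⁻ w, F w := by
  have hL : Measurable fun w => flowExp b₂ t w := (flowExp b₂ t).continuous.measurable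
  have hm : Measurable fun w => F (flowExp b₂ t (w + c)) := hF.comp (hL.comp (measurable_add_const c))
  rw [lintegral_const_mul _ hm, lintegral_add_right_eq_self fun w => F (flowExp b₂ t w)]
  have h := Measure.map_linearMap_addHaar_eq_smul_addHaar
    (volume : Measure (EuclideanSpace ℝ (Fin n))) (f := (flowExp b₂ t).toLinearMap)
    (det_flowExp_ne_zero b₂ t)
  have h1 : ∫⁻ w, F (flowExp b₂ t w) = ∫⁻ w, F w ∂(volume.map (flowExp b₂ t).toLinearMap) :=
    (lintegral_map hF hL).symm
  rw [h1, h, lintegral_smul_measure, smul_eq_mul, ← mul_assoc]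
  have h2 : (jac b₂ t : ℝ≥0∞) * ENNReal.ofReal |(LinearMap.det (flowExp b₂ t).toLinearMap)⁻¹| = 1 := by
    rw [jac, abs_inv, ← enorm_eq_nnnorm, Real.enorm_eq_ofReal_abs,
      ← ENNReal.ofReal_mul (abs_nonneg _)]
    rw [ContinuousLinearMap.det, mul_inv_cancel₀ (abs_ne_zero.2 (det_flowExp_ne_zero b₂ t)),
      ENNReal.ofReal_one]
  rw [h2, one_mul]

lemma measurable_jac_fst : Measurable fun e : Space m n => jac b₂ e.1 :=
  (continuous_jac b₂).measurable.comp measurable_fst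

lemma measurable_unstraighten : Measurable (unstraighten b₁ b₂) :=
  (contDiff_unstraighten b₁ b₂).continuous.measurable

lemma measurableEmbedding_unstraighten : MeasurableEmbedding (unstraighten b₁ b₂) :=
  (straightenHomeomorph b₁ b₂).symm.measurableEmbedding

lemma lintegral_space {F : Space m n → ℝ≥0∞} (hF : Measurable F) :
    ∫⁻ e, F e = ∫⁻ t, ∫⁻ v, ∫⁻ w, F (t, v, w) := by
  refine (lintegral_prod F hF.aemeasurable).trans (lintegral_congr fun t => ?_)
  have hF' : Measurable fun y => F (t, y) := hF.comp measurable_prodMk_left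
  exact lintegral_prod _ hF'.aemeasurable

lemma measurePreserving_unstraighten : MeasurePreserving (unstraighten b₁ b₂)
    (volume.withDensity fun e : Space m n => (jac b₂ e.1 : ℝ≥0∞)) volume := by
  refine ⟨measurable_unstraighten b₁ b₂, Measure.ext_of_lintegral _ fun F hF => ?_⟩
  have hFu : Measurable fun e => F (unstraighten b₁ b₂ e) :=
    hF.comp (measurable_unstraighten b₁ b₂)
  rw [lintegral_map hF (measurable_unstraighten b₁ b₂),
    lintegral_withDensity_eq_lintegral_mul _ (measurable_jac_fst b₂).coe_nnreal_ennreal hFu]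
  have hm := (measurable_jac_fst (m := m) b₂).coe_nnreal_ennreal.mul hFu
  rw [lintegral_space hm, lintegral_space hF]
  refine lintegral_congr fun t => lintegral_congr fun v => ?_
  have hF' : Measurable fun w => F (t, v, w) :=
    hF.comp (measurable_prodMk_left.comp measurable_prodMk_left)
  exact lintegral_flowExp b₂ t (shear b₁ b₂ t v) hF'

lemma quasiMeasurePreserving_unstraighten :
    Measure.QuasiMeasurePreserving (unstraighten b₁ b₂) (volume : Measure (Space m n)) volume :=
  (measurePreserving_unstraighten b₁ b₂).quasiMeasurePreserving.mono_left
    (withDensity_absolutelyContinuous' (measurable_jac_fst b₂).coe_nnreal_ennreal.aemeasurable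
      (Eventually.of_forall fun e => ENNReal.coe_ne_zero.2 (jac_pos b₂ e.1).ne'))

lemma integral_unstraighten (F : Space m n → ℝ) :
    ∫ e, (jac b₂ e.1 : ℝ) * F (unstraighten b₁ b₂ e) = ∫ p, F p := by
  rw [← (measurePreserving_unstraighten b₁ b₂).integral_comp
    (measurableEmbedding_unstraighten b₁ b₂) F,
    integral_withDensity_eq_integral_smul (measurable_jac_fst b₂)]
  rfl

lemma integrable_unstraighten {F : Space m n → ℝ} :
    Integrable (fun e => (jac b₂ e.1 : ℝ) * F (unstraighten b₁ b₂ e)) ↔ Integrable F := by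
  rw [← (measurePreserving_unstraighten b₁ b₂).integrable_comp_emb
    (measurableEmbedding_unstraighten b₁ b₂) (g := F),
    integrable_withDensity_iff_integrable_smul (measurable_jac_fst b₂)]
  rfl

variable (T : ℝ)

lemma measurableSet_strip : MeasurableSet (strip m n T) := measurableSet_Ioo.prod MeasurableSet.univ

/-- The function `x` on the strip in the straightened variables. The Jacobian is included, so that
integrals against test functions are preserved. -/
def pull (x : Space m n → ℝ) (e : Space m n) : ℝ :=
  jac b₂ e.1 * (strip m n T).indicator x (unstraighten b₁ b₂ e)

variable {T} {x y : Space m n → ℝ}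

lemma pull_of_mem {e : Space m n} (he : e.1 ∈ Ioo 0 T) :
    pull b₁ b₂ T x e = jac b₂ e.1 * x (unstraighten b₁ b₂ e) := by
  rw [pull, indicator_of_mem (show unstraighten b₁ b₂ e ∈ strip m n T from ⟨he, mem_univ _⟩)]

lemma pull_of_notMem {e : Space m n} (he : e.1 ∉ Ioo 0 T) : pull b₁ b₂ T x e = 0 := by
  rw [pull, indicator_of_notMem (show unstraighten b₁ b₂ e ∉ strip m n T from fun h => he h.1),
    mul_zero]

lemma integral_pull_mul (x ψ : Space m n → ℝ) :
    ∫ e, pull b₁ b₂ T x e * ψ e = ∫ p in strip m n T, ψ (straighten b₁ b₂ p) * x p := by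
  rw [← integral_indicator (measurableSet_strip T), ← integral_unstraighten b₁ b₂ ((strip m n T).indicator _)]
  refine integral_congr_ae (Eventually.of_forall fun e => ?_)
  simp only [pull]
  by_cases h : unstraighten b₁ b₂ e ∈ strip m n T
  · rw [indicator_of_mem h, indicator_of_mem h, straighten_unstraighten]
    ring
  · rw [indicator_of_notMem h, indicator_of_notMem h]
    ring

lemma memLp_pull (hx : MemLp x 2 (volume.restrict (strip m n T))) :
    MemLp (pull b₁ b₂ T x) 2 volume := by
  have hs := measurableSet_strip (m := m) (n := n) T
  have hx' : MemLp ((strip m n T).indicator x) 2 volume := (memLp_indicator_iff_restrict hs).2 hx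
  have hm : AEStronglyMeasurable (pull b₁ b₂ T x) volume :=
    (measurable_jac_fst b₂).coe_nnreal_real.aestronglyMeasurable.mul
      (hx'.1.comp_quasiMeasurePreserving (quasiMeasurePreserving_unstraighten b₁ b₂))
  rw [memLp_two_iff_integrable_sq hm]
  obtain ⟨C, hC⟩ := (isCompact_Icc (a := (0:ℝ)) (b := T)).exists_bound_of_continuousOn
    (continuous_jac b₂).subtype_val.continuousOn
  have h1 : Integrable fun p : Space m n =>
      (jac b₂ p.1 : ℝ) * (strip m n T).indicator x p ^ 2 := by
    refine (hx'.integrable_sq.const_mul C).mono'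
      ((measurable_jac_fst b₂).coe_nnreal_real.aestronglyMeasurable.mul (hx'.1.pow 2))
      (Eventually.of_forall fun p => ?_)
    by_cases h : p ∈ strip m n T
    · rw [norm_mul, Real.norm_of_nonneg (sq_nonneg _)]
      exact mul_le_mul_of_nonneg_right (hC p.1 ⟨h.1.1.le, h.1.2.le⟩) (sq_nonneg _)
    · simp [indicator_of_notMem h]
  refine ((integrable_unstraighten b₁ b₂).2 h1).congr (Eventually.of_forall fun e => ?_)
  simp only [pull]
  change (jac b₂ e.1 : ℝ) * (jac b₂ e.1 * _) = _
  ring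

/-- The change of variables does not create zeros. -/
lemma ae_eq_zero_of_pull {S : Set ℝ} (h : ∀ᵐ e, e.1 ∈ S → pull b₁ b₂ T x e = 0) :
    ∀ᵐ p ∂volume.restrict (strip m n T), p.1 ∈ S → x p = 0 := by
  rw [ae_restrict_iff' (measurableSet_strip T)]
  have h2 : ∀ᵐ e, unstraighten b₁ b₂ e ∈ strip m n T →
      (unstraighten b₁ b₂ e).1 ∈ S → x (unstraighten b₁ b₂ e) = 0 := by
    filter_upwards [h] with e he h1 h2
    have := he h2
    rw [pull_of_mem b₁ b₂ (show e.1 ∈ Ioo 0 T from h1.1)] at this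
    exact (mul_eq_zero.1 this).resolve_left (NNReal.coe_ne_zero.2 (jac_pos b₂ _).ne')
  have h3 := (measurePreserving_unstraighten b₁ b₂).map_eq
  rw [← h3, ((measurableEmbedding_unstraighten b₁ b₂).ae_map_iff)]
  exact (withDensity_absolutelyContinuous _ _).ae_le h2

end ChangeOfVariables

/-! ### Test functions that do not vanish near the initial time -/

section TimeCutoff

variable {m n : ℕ} {T : ℝ}

/-- A smooth function of time that vanishes near `t = 0` and tends to `1` for `t > 0`. -/
def initCutoff (k : ℕ) (t : ℝ) : ℝ := Real.smoothTransition (((k : ℝ) + 1) * t - 1)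

lemma contDiff_initCutoff (k : ℕ) : ContDiff ℝ ∞ (initCutoff k) :=
  Real.smoothTransition.contDiff.comp ((contDiff_const.mul contDiff_id).sub contDiff_const)

lemma abs_initCutoff_le (k : ℕ) (t : ℝ) : |initCutoff k t| ≤ 1 := by
  rw [initCutoff, abs_of_nonneg (Real.smoothTransition.nonneg _)]
  exact Real.smoothTransition.le_one _

lemma tendsto_initCutoff {t : ℝ} (ht : 0 < t) :
    Tendsto (fun k => initCutoff k t) atTop (𝓝 1) := by
  have h : Tendsto (fun k : ℕ => ((k : ℝ) + 1) * t - 1) atTop atTop :=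
    tendsto_atTop_add_const_right _ _
      ((tendsto_atTop_add_const_right _ _ tendsto_natCast_atTop_atTop).atTop_mul_const ht)
  refine tendsto_const_nhds.congr' ?_
  filter_upwards [h.eventually_ge_atTop 1] with k hk
  exact (Real.smoothTransition.one_of_one_le hk).symm

/-- The derivative of `initCutoff k` is of size `k`, in an interval of length of order `1 / k`. -/
lemma exists_deriv_initCutoff_le : ∃ C : ℝ, 0 ≤ C ∧ ∀ (k : ℕ) (t : ℝ),
    |deriv (initCutoff k) t| ≤ C * (k + 1) ∧
      (t ∉ Ioo 0 (3 / ((k : ℝ) + 1)) → deriv (initCutoff k) t = 0) := by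
  have hd : ∀ (k : ℕ) (t : ℝ), deriv (initCutoff k) t =
      deriv Real.smoothTransition (((k : ℝ) + 1) * t - 1) * (k + 1) := by
    intro k t
    have h1 : HasDerivAt (fun t : ℝ => ((k : ℝ) + 1) * t - 1) ((k : ℝ) + 1) t := by
      simpa using ((hasDerivAt_id t).const_mul ((k : ℝ) + 1)).sub_const 1
    have h2 : DifferentiableAt ℝ Real.smoothTransition (((k : ℝ) + 1) * t - 1) :=
      ((Real.smoothTransition.contDiff (n := 1)).differentiable (by simp)) _
    exact (h2.hasDerivAt.comp t h1).deriv
  have hz : ∀ r : ℝ, r ∉ Icc 0 1 → deriv Real.smoothTransition r = 0 := by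
    intro r hr
    rcases not_and_or.1 hr with h | h
    · have : Real.smoothTransition =ᶠ[𝓝 r] fun _ => 0 := by
        filter_upwards [Iio_mem_nhds (not_le.1 h)] with s hs
        exact Real.smoothTransition.zero_of_nonpos hs.le
      rw [this.deriv_eq, deriv_const]
    · have : Real.smoothTransition =ᶠ[𝓝 r] fun _ => 1 := by
        filter_upwards [Ioi_mem_nhds (not_le.1 h)] with s hs
        exact Real.smoothTransition.one_of_one_le (le_of_lt hs)
      rw [this.deriv_eq, deriv_const]
  obtain ⟨C, hC⟩ := (isCompact_Icc (a := (0:ℝ)) (b := 1)).exists_bound_of_continuousOn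
    ((Real.smoothTransition.contDiff (n := 1)).continuous_deriv le_rfl).continuousOn
  have hC0 : 0 ≤ C := (norm_nonneg _).trans (hC 0 (by simp))
  refine ⟨C, hC0, fun k t => ⟨?_, fun ht => ?_⟩⟩
  · have hk : (0:ℝ) ≤ (k : ℝ) + 1 := by positivity
    rw [hd, abs_mul, abs_of_nonneg hk]
    refine mul_le_mul_of_nonneg_right ?_ hk
    by_cases h : ((k : ℝ) + 1) * t - 1 ∈ Icc (0:ℝ) 1
    · exact hC _ h
    · rw [hz _ h, abs_zero]; exact hC0
  · have hk : (0:ℝ) < (k : ℝ) + 1 := by positivity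
    rw [hd, hz _ fun h => ht ⟨?_, ?_⟩, zero_mul]
    · exact pos_of_mul_pos_right (a := (k : ℝ) + 1) (by linarith [h.1]) hk.le
    · rw [lt_div_iff₀ hk]
      linarith [h.2]

variable {φ : Space m n → ℝ}

lemma fderiv_time_mul {ϑ : ℝ → ℝ} (hϑ : ContDiff ℝ ∞ ϑ) (hφ : ContDiff ℝ ∞ φ) (p X : Space m n) :
    fderiv ℝ (fun p => ϑ p.1 * φ p) p X =
      ϑ p.1 * fderiv ℝ φ p X + deriv ϑ p.1 * X.1 * φ p := by
  have h1 : HasFDerivAt (fun p : Space m n => ϑ p.1)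
      (deriv ϑ p.1 • ContinuousLinearMap.fst ℝ ℝ _) p :=
    ((hϑ.differentiable (by simp)) p.1).hasDerivAt.comp_hasFDerivAt p hasFDerivAt_fst
  have h2 : HasFDerivAt φ (fderiv ℝ φ p) p := ((hφ.differentiable (by simp)) p).hasFDerivAt
  have h3 : HasFDerivAt (fun p => ϑ p.1 * φ p) _ p := h1.mul h2
  rw [h3.fderiv]
  simp
  ring

/-- Multiplication by `initCutoff k` and by a cutoff for large times makes a test function for the
strip. -/
lemma isTestFunction_cutoff {χ : ℝ → ℝ} (hχ : ContDiff ℝ ∞ χ) {T₂ : ℝ} (hT₂ : T₂ < T)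
    (hχ0 : ∀ t, T₂ ≤ t → χ t = 0) (hφ : IsTest φ) (k : ℕ) :
    IsTestFunction T fun p : Space m n => (initCutoff k p.1 * χ p.1) * φ p where
  contDiff := (((contDiff_initCutoff k).comp contDiff_fst).mul (hχ.comp contDiff_fst)).mul
    hφ.contDiff
  hasCompactSupport := hφ.hasCompactSupport.mul_left
  tsupport_subset := by
    have hk : (0:ℝ) < (k : ℝ) + 1 := by positivity
    have h : tsupport (fun p : Space m n => (initCutoff k p.1 * χ p.1) * φ p) ⊆
        Icc (1 / ((k : ℝ) + 1)) T₂ ×ˢ univ := by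
      refine closure_minimal (fun p hp => ?_) (isClosed_Icc.prod isClosed_univ)
      rw [Function.mem_support] at hp
      refine ⟨⟨?_, ?_⟩, mem_univ _⟩
      · by_contra hlt
        refine hp ?_
        have h2 : p.1 * ((k : ℝ) + 1) < 1 := by rwa [not_le, lt_div_iff₀ hk] at hlt
        rw [initCutoff, Real.smoothTransition.zero_of_nonpos (by linarith), zero_mul, zero_mul]
      · by_contra hlt
        exact hp (by rw [hχ0 _ (not_le.1 hlt).le, mul_zero, zero_mul])
    exact h.trans (prod_mono (fun t ht => ⟨lt_of_lt_of_le (by positivity) ht.1,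
      ht.2.trans_lt hT₂⟩) Subset.rfl)

/-- `initCutoff k` disappears from integrals over the strip as `k → ∞`. -/
lemma tendsto_integral_initCutoff {h : Space m n → ℝ}
    (hh : Integrable h (volume.restrict (strip m n T))) :
    Tendsto (fun k => ∫ p in strip m n T, initCutoff k p.1 * h p) atTop
      (𝓝 (∫ p in strip m n T, h p)) := by
  refine tendsto_integral_of_dominated_convergence (fun p => |h p|) (fun k => ?_) hh.abs
    (fun k => Eventually.of_forall fun p => ?_) ?_
  · exact ((contDiff_initCutoff k).continuous.comp continuous_fst).aestronglyMeasurable.mul hh.1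
  · rw [norm_mul]
    exact mul_le_of_le_one_left (norm_nonneg _) (abs_initCutoff_le k _)
  · rw [ae_restrict_iff' (measurableSet_strip T)]
    refine Eventually.of_forall fun p hp => ?_
    simpa using (tendsto_initCutoff hp.1.1).mul_const (h p)

/-- The smallness of `u` near the initial time, in the form in which it follows from a vanishing
trace. -/
def VanishesAtZero (u : Space m n → ℝ) : Prop :=
  ∀ ε : ℝ, 0 < ε → ∃ δ₀ : ℝ, 0 < δ₀ ∧ ∀ δ : ℝ, 0 < δ → δ < δ₀ →
    ∫ p in strip m n δ, u p ^ 2 ≤ ε * δ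

lemma integral_sq_test_le (hφc : Continuous φ) (hφ : HasCompactSupport φ) :
    ∃ M : ℝ, 0 ≤ M ∧ ∀ δ : ℝ, 0 ≤ δ → ∫ p in strip m n δ, φ p ^ 2 ≤ M * δ := by
  obtain ⟨C, hC⟩ := hφc.bounded_above_of_compact_support hφ
  set K : Set (EuclideanSpace ℝ (Fin m) × EuclideanSpace ℝ (Fin n)) := Prod.snd '' tsupport φ
  have hK : IsCompact K := hφ.isCompact.image continuous_snd
  refine ⟨C ^ 2 * volume.real K, by positivity, fun δ hδ => ?_⟩
  have hvol : (volume : Measure (Space m n)).real (Ioo 0 δ ×ˢ K) = δ * volume.real K := by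
    change ((volume : Measure ℝ).prod volume).real _ = _
    rw [measureReal_prod_prod, Real.volume_real_Ioo_of_le hδ, sub_zero]
  have hfin : (volume : Measure (Space m n)) (Ioo 0 δ ×ˢ K) < ⊤ := by
    change ((volume : Measure ℝ).prod volume) _ < _
    rw [Measure.prod_prod]
    exact ENNReal.mul_lt_top (by simp) hK.measure_lt_top
  have h1 : ∫ p in strip m n δ, φ p ^ 2 = ∫ p in Ioo 0 δ ×ˢ K, φ p ^ 2 := by
    refine (setIntegral_eq_of_subset_of_forall_sdiff_eq_zero (measurableSet_strip δ)
      (prod_mono Subset.rfl (subset_univ K)) fun p hp => ?_)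
    have : p ∉ tsupport φ := fun h => hp.2 ⟨hp.1.1, mem_image_of_mem _ h⟩
    rw [image_eq_zero_of_notMem_tsupport this]
    simp
  rw [h1]
  have h2 := norm_setIntegral_le_of_norm_le_const (μ := (volume : Measure (Space m n)))
    (f := fun p => φ p ^ 2) (C := C ^ 2) hfin (fun p _ => by
      rw [norm_pow]
      exact pow_le_pow_left₀ (norm_nonneg _) (hC p) 2)
  rw [hvol] at h2
  calc _ ≤ C ^ 2 * (δ * volume.real K) := (le_abs_self _).trans h2
    _ = _ := by ring

/-- The vanishing trace removes the term in which the derivative falls on `initCutoff k`. -/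
lemma tendsto_integral_deriv_initCutoff {u : Space m n → ℝ}
    (hu : MemLp u 2 (volume.restrict (strip m n T))) (hu0 : VanishesAtZero u) (hT : 0 < T)
    (hφc : Continuous φ) (hφ : HasCompactSupport φ) :
    Tendsto (fun k => ∫ p in strip m n T, deriv (initCutoff k) p.1 * (φ p * u p)) atTop (𝓝 0) := by
  obtain ⟨C, hC0, hC⟩ := exists_deriv_initCutoff_le
  obtain ⟨M, hM0, hM⟩ := integral_sq_test_le hφc hφ
  rw [Metric.tendsto_nhds]
  intro ε hε
  -- the weight `η` in `2 |φ u| ≤ η φ² + η⁻¹ u²`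
  obtain ⟨η, hη, hηε⟩ : ∃ η : ℝ, 0 < η ∧ 3 * C * (η * (M + 1)) < ε := by
    refine ⟨ε / (3 * (C + 1) * (M + 1)) / 2, by positivity, ?_⟩
    have : 3 * C * (ε / (3 * (C + 1) * (M + 1)) / 2 * (M + 1)) = (C / (C + 1)) * (ε / 2) := by
      field_simp
    rw [this]
    have h1 : C / (C + 1) ≤ 1 := by rw [div_le_one (by positivity)]; linarith
    nlinarith
  obtain ⟨δ₀, hδ₀, hu0⟩ := hu0 (η ^ 2) (by positivity)
  have hlim : Tendsto (fun k : ℕ => 3 / ((k : ℝ) + 1)) atTop (𝓝 0) :=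
    Tendsto.const_div_atTop (tendsto_atTop_add_const_right _ _ tendsto_natCast_atTop_atTop) 3
  filter_upwards [hlim.eventually (gt_mem_nhds hδ₀), hlim.eventually (gt_mem_nhds hT)] with k hk hkT
  set δ := 3 / ((k : ℝ) + 1) with hδ
  have hk0 : (0:ℝ) < (k : ℝ) + 1 := by positivity
  have hδ0 : 0 < δ := by positivity
  have hkδ : ((k : ℝ) + 1) * δ = 3 := by rw [hδ]; field_simp
  have hsub : strip m n δ ⊆ strip m n T := prod_mono (Ioo_subset_Ioo_right hkT.le) Subset.rfl
  have hus : IntegrableOn (fun p => u p ^ 2) (strip m n δ) :=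
    (hu.mono_measure (Measure.restrict_mono hsub le_rfl)).integrable_sq
  have hφs : IntegrableOn (fun p => φ p ^ 2) (strip m n δ) := by
    refine Integrable.integrableOn ?_
    exact (hφc.pow 2).integrable_of_hasCompactSupport
      (by simpa only [sq] using hφ.mul_right)
  have h1 : ∫ p in strip m n T, deriv (initCutoff k) p.1 * (φ p * u p) =
      ∫ p in strip m n δ, deriv (initCutoff k) p.1 * (φ p * u p) := by
    refine (setIntegral_eq_of_subset_of_forall_sdiff_eq_zero (measurableSet_strip T) hsub
      fun p hp => ?_)
    rw [(hC k p.1).2 fun h => hp.2 ⟨h, mem_univ _⟩, zero_mul]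
  rw [dist_zero_right, h1]
  have h2 : ‖∫ p in strip m n δ, deriv (initCutoff k) p.1 * (φ p * u p)‖ ≤
      ∫ p in strip m n δ, C * (k + 1) * (1 / 2) * (η * φ p ^ 2 + η⁻¹ * u p ^ 2) := by
    refine norm_integral_le_of_norm_le (((hφs.const_mul η).add (hus.const_mul η⁻¹)).const_mul _)
      (Eventually.of_forall fun p => ?_)
    rw [norm_mul, mul_assoc (C * _)]
    refine mul_le_mul (hC k p.1).1 ?_ (norm_nonneg _) (by positivity)
    have e1 : η * φ p ^ 2 + η⁻¹ * u p ^ 2 - 2 * |φ p * u p| =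
        η⁻¹ * (η * |φ p| - |u p|) ^ 2 := by
      rw [abs_mul, ← sq_abs (φ p), ← sq_abs (u p)]
      field_simp
      ring
    have e2 : 0 ≤ η⁻¹ * (η * |φ p| - |u p|) ^ 2 := by positivity
    rw [Real.norm_eq_abs]
    linarith
  refine h2.trans_lt ?_
  rw [integral_const_mul, integral_add (hφs.const_mul η) (hus.const_mul η⁻¹), integral_const_mul,
    integral_const_mul]
  have h3 : η * (∫ p in strip m n δ, φ p ^ 2) ≤ η * (M * δ) :=
    mul_le_mul_of_nonneg_left (hM δ hδ0.le) hη.le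
  have h4 : η⁻¹ * (∫ p in strip m n δ, u p ^ 2) ≤ η * δ := by
    calc _ ≤ η⁻¹ * (η ^ 2 * δ) := mul_le_mul_of_nonneg_left (hu0 δ hδ0 hk) (by positivity)
      _ = _ := by field_simp
  calc C * (k + 1) * (1 / 2) * (η * (∫ p in strip m n δ, φ p ^ 2) +
        η⁻¹ * ∫ p in strip m n δ, u p ^ 2)
      ≤ C * (k + 1) * (1 / 2) * (η * (M * δ) + η * δ) :=
        mul_le_mul_of_nonneg_left (add_le_add h3 h4) (by positivity)
    _ = 1 / 2 * C * (η * (M + 1)) * ((k + 1) * δ) := by ring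
    _ = 1 / 2 * (3 * C * (η * (M + 1))) := by rw [hkδ]; ring
    _ ≤ 3 * C * (η * (M + 1)) := by
        have : 0 ≤ 3 * C * (η * (M + 1)) := by positivity
        linarith
    _ < ε := hηε

end TimeCutoff

/-! ### From the strip to the straightened system -/

section StripSystem

variable {m n : ℕ} {T : ℝ} {b₁ : EuclideanSpace ℝ (Fin m) →L[ℝ] EuclideanSpace ℝ (Fin n)}
  {b₂ : EuclideanSpace ℝ (Fin n) →L[ℝ] EuclideanSpace ℝ (Fin n)} {τ : ℝ}
  {A : Fin m → Fin m → Space m n → ℝ} {c : Space m n → ℝ} {d : Fin m → Space m n → ℝ}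
  {u f F : Space m n → ℝ} {G H : Fin m → Space m n → ℝ}

/-- The system on the strip satisfied by a real solution `u`, its transport derivative `f`, its
gradient `G` along `v`, the flux `H = A G` and `F = - div_v H`. -/
structure StripSystem (T : ℝ) (b₁ : EuclideanSpace ℝ (Fin m) →L[ℝ] EuclideanSpace ℝ (Fin n))
    (b₂ : EuclideanSpace ℝ (Fin n) →L[ℝ] EuclideanSpace ℝ (Fin n)) (τ : ℝ)
    (A : Fin m → Fin m → Space m n → ℝ) (c : Space m n → ℝ) (d : Fin m → Space m n → ℝ)
    (u f F : Space m n → ℝ) (G H : Fin m → Space m n → ℝ) : Prop where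
  memLp_u : MemLp u 2 (volume.restrict (strip m n T))
  memLp_f : MemLp f 2 (volume.restrict (strip m n T))
  memLp_F : MemLp F 2 (volume.restrict (strip m n T))
  memLp_G : ∀ i, MemLp (G i) 2 (volume.restrict (strip m n T))
  memLp_H : ∀ i, MemLp (H i) 2 (volume.restrict (strip m n T))
  deriv_v : ∀ φ : Space m n → ℝ, IsTestFunction T φ → ∀ i,
    ∫ p in strip m n T, fderiv ℝ φ p (dirV i) * u p = - ∫ p in strip m n T, φ p * G i p
  transport : ∀ φ : Space m n → ℝ, IsTestFunction T φ →
    ∫ p in strip m n T, (fderiv ℝ φ p (1, 0, b₁ p.2.1 + b₂ p.2.2) + τ * φ p) * u p =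
      - ∫ p in strip m n T, φ p * f p
  elliptic : ∀ φ : Space m n → ℝ, IsTestFunction T φ →
    ∑ i, ∫ p in strip m n T, fderiv ℝ φ p (dirV i) * H i p = ∫ p in strip m n T, φ p * F p
  flux : ∀ p ∈ strip m n T, ∀ i, H i p = ∑ j, A i j p * G j p
  split : ∀ p ∈ strip m n T, f p = F p + (c p * u p + ∑ j, d j p * G j p)
  trace : VanishesAtZero u

lemma integrable_test_mul {φ x : Space m n → ℝ} (hφc : Continuous φ) (hφ : HasCompactSupport φ)
    (hx : MemLp x 2 (volume.restrict (strip m n T))) :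
    Integrable (fun p => φ p * x p) (volume.restrict (strip m n T)) :=
  ((hφc.memLp_of_hasCompactSupport (p := 2) hφ).restrict _).integrable_mul hx

lemma memLp_time_mul {χ : ℝ → ℝ} (hχ : Continuous χ) {x : Space m n → ℝ}
    (hx : MemLp x 2 (volume.restrict (strip m n T))) :
    MemLp (fun p => χ p.1 * x p) 2 (volume.restrict (strip m n T)) := by
  obtain ⟨C, hC⟩ := (isCompact_Icc (a := (0:ℝ)) (b := T)).exists_bound_of_continuousOn
    hχ.continuousOn
  refine hx.of_le_mul (c := C) ((hχ.comp continuous_fst).aestronglyMeasurable.mul hx.1) ?_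
  rw [ae_restrict_iff' (measurableSet_strip T)]
  refine Eventually.of_forall fun p hp => ?_
  rw [norm_mul]
  exact mul_le_mul_of_nonneg_right (hC p.1 ⟨hp.1.1.le, hp.1.2.le⟩) (norm_nonneg _)

variable {χ : ℝ → ℝ} {T₂ : ℝ} {φ : Space m n → ℝ}

lemma tendsto_test {φ x : Space m n → ℝ} (hχ : ContDiff ℝ ∞ χ) (hφc : Continuous φ)
    (hφ : HasCompactSupport φ) (hx : MemLp x 2 (volume.restrict (strip m n T))) :
    Tendsto (fun k => ∫ p in strip m n T, initCutoff k p.1 * (φ p * (χ p.1 * x p))) atTop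
      (𝓝 (∫ p in strip m n T, φ p * (χ p.1 * x p))) :=
  tendsto_integral_initCutoff (integrable_test_mul hφc hφ (memLp_time_mul hχ.continuous hx))

lemma fderiv_cutoff_dirV (hχ : ContDiff ℝ ∞ χ) (hφ : IsTest φ) (k : ℕ) (i : Fin m)
    (p : Space m n) :
    fderiv ℝ (fun p : Space m n => (initCutoff k p.1 * χ p.1) * φ p) p (dirV i) =
      initCutoff k p.1 * χ p.1 * fderiv ℝ φ p (dirV i) := by
  rw [fderiv_time_mul ((contDiff_initCutoff k).mul hχ) hφ.contDiff]
  simp [dirV]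

lemma StripSystem.deriv_v_cutoff (h : StripSystem T b₁ b₂ τ A c d u f F G H)
    (hχ : ContDiff ℝ ∞ χ) (hT₂ : T₂ < T) (hχ0 : ∀ t, T₂ ≤ t → χ t = 0) (hφ : IsTest φ) (i : Fin m) :
    ∫ p in strip m n T, fderiv ℝ φ p (dirV i) * (χ p.1 * u p) =
      - ∫ p in strip m n T, φ p * (χ p.1 * G i p) := by
  have h1 := tendsto_test hχ (hφ.fderiv_apply (dirV i)).contDiff.continuous
    (hφ.fderiv_apply (dirV i)).hasCompactSupport h.memLp_u
  have h2 := (tendsto_test hχ hφ.contDiff.continuous hφ.hasCompactSupport (h.memLp_G i)).neg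
  refine tendsto_nhds_unique (h1.congr fun k => ?_) h2
  have h3 := h.deriv_v _ (isTestFunction_cutoff hχ hT₂ hχ0 hφ k) i
  simp only [fderiv_cutoff_dirV hχ hφ] at h3
  refine (Eq.trans ?_ h3).trans (congrArg Neg.neg ?_) <;>
    exact integral_congr_ae (Eventually.of_forall fun p => by ring)

lemma StripSystem.elliptic_cutoff (h : StripSystem T b₁ b₂ τ A c d u f F G H)
    (hχ : ContDiff ℝ ∞ χ) (hT₂ : T₂ < T) (hχ0 : ∀ t, T₂ ≤ t → χ t = 0) (hφ : IsTest φ) :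
    ∑ i, ∫ p in strip m n T, fderiv ℝ φ p (dirV i) * (χ p.1 * H i p) =
      ∫ p in strip m n T, φ p * (χ p.1 * F p) := by
  have h1 := tendsto_finsetSum Finset.univ fun i (_ : i ∈ Finset.univ) =>
    tendsto_test hχ (hφ.fderiv_apply (dirV i)).contDiff.continuous
      (hφ.fderiv_apply (dirV i)).hasCompactSupport (h.memLp_H i)
  have h2 := tendsto_test hχ hφ.contDiff.continuous hφ.hasCompactSupport h.memLp_F
  refine tendsto_nhds_unique (h1.congr fun k => ?_) h2
  have h3 := h.elliptic _ (isTestFunction_cutoff hχ hT₂ hχ0 hφ k)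
  simp only [fderiv_cutoff_dirV hχ hφ] at h3
  refine ((Finset.sum_congr rfl fun i _ => ?_).trans h3).trans ?_ <;>
    exact integral_congr_ae (Eventually.of_forall fun p => by ring)

lemma StripSystem.transport_cutoff (h : StripSystem T b₁ b₂ τ A c d u f F G H) (hT : 0 < T)
    (hχ : ContDiff ℝ ∞ χ) (hT₂ : T₂ < T) (hχ0 : ∀ t, T₂ ≤ t → χ t = 0) (hφ : IsTest φ) :
    ∫ p in strip m n T, fderiv ℝ φ p (1, 0, b₁ p.2.1 + b₂ p.2.2) * (χ p.1 * u p) =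
      - ∫ p in strip m n T, φ p * (χ p.1 * f p + (deriv χ p.1 + τ * χ p.1) * u p) := by
  have hφc := hφ.contDiff.continuous
  have hX : Continuous fun p : Space m n => fderiv ℝ φ p (1, 0, b₁ p.2.1 + b₂ p.2.2) :=
    (hφ.contDiff.continuous_fderiv (by simp)).clm_apply (by fun_prop)
  have hXs : HasCompactSupport fun p : Space m n => fderiv ℝ φ p (1, 0, b₁ p.2.1 + b₂ p.2.2) := by
    refine hφ.hasCompactSupport.fderiv (𝕜 := ℝ) |>.mono fun p hp => ?_
    rw [Function.mem_support] at hp ⊢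
    exact fun h0 => hp (by rw [h0]; rfl)
  have hχ' : ContDiff ℝ ∞ (deriv χ) := (contDiff_infty_iff_deriv.1 hχ).2
  have hχ2 : ContDiff ℝ ∞ fun t => deriv χ t + τ * χ t := hχ'.add (contDiff_const.mul hχ)
  have i1 : ∀ k, Integrable (fun p => initCutoff k p.1 * (φ p * (χ p.1 * f p)))
      (volume.restrict (strip m n T)) := fun k => by
    refine (integrable_test_mul hφc hφ.hasCompactSupport (memLp_time_mul
      ((contDiff_initCutoff k).mul hχ).continuous h.memLp_f)).congr
      (Eventually.of_forall fun p => ?_)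
    simp only; ring
  have i2 : ∀ k, Integrable (fun p => initCutoff k p.1 * (φ p * ((deriv χ p.1 + τ * χ p.1) * u p)))
      (volume.restrict (strip m n T)) := fun k => by
    refine (integrable_test_mul hφc hφ.hasCompactSupport (memLp_time_mul
      ((contDiff_initCutoff k).mul hχ2).continuous h.memLp_u)).congr
      (Eventually.of_forall fun p => ?_)
    simp only; ring
  have i3 : ∀ k, Integrable (fun p => initCutoff k p.1 *
      (fderiv ℝ φ p (1, 0, b₁ p.2.1 + b₂ p.2.2) * (χ p.1 * u p)))
      (volume.restrict (strip m n T)) := fun k => by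
    refine (integrable_test_mul hX hXs (memLp_time_mul
      ((contDiff_initCutoff k).mul hχ).continuous h.memLp_u)).congr
      (Eventually.of_forall fun p => ?_)
    simp only; ring
  have i4 : ∀ k, Integrable (fun p => deriv (initCutoff k) p.1 * ((χ p.1 * φ p) * u p))
      (volume.restrict (strip m n T)) := fun k => by
    refine (integrable_test_mul hφc hφ.hasCompactSupport (memLp_time_mul
      ((contDiff_infty_iff_deriv.1 (contDiff_initCutoff k)).2.mul hχ).continuous
      h.memLp_u)).congr (Eventually.of_forall fun p => ?_)
    simp only; ring
  have h1 := tendsto_test hχ hX hXs h.memLp_u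
  have h2 := tendsto_test hχ hφc hφ.hasCompactSupport h.memLp_f
  have h3 := tendsto_test hχ2 hφc hφ.hasCompactSupport h.memLp_u
  have h4 := tendsto_integral_deriv_initCutoff (φ := fun p => χ p.1 * φ p) h.memLp_u h.trace hT
    ((hχ.continuous.comp continuous_fst).mul hφc) hφ.hasCompactSupport.mul_left
  have h5 := ((h2.add h3).add h4).neg
  rw [add_zero, ← integral_add (integrable_test_mul hφc hφ.hasCompactSupport
    (memLp_time_mul hχ.continuous h.memLp_f)) (integrable_test_mul hφc hφ.hasCompactSupport
    (memLp_time_mul hχ2.continuous h.memLp_u))] at h5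
  simp only [← mul_add] at h5
  refine tendsto_nhds_unique (h1.congr fun k => ?_) h5
  have h6 := h.transport _ (isTestFunction_cutoff hχ hT₂ hχ0 hφ k)
  have hζ : ∀ t, deriv (fun t => initCutoff k t * χ t) t =
      deriv (initCutoff k) t * χ t + initCutoff k t * deriv χ t := fun t =>
    deriv_fun_mul (((contDiff_initCutoff k).differentiable (by simp)) t)
      ((hχ.differentiable (by simp)) t)
  simp only [fderiv_time_mul ((contDiff_initCutoff k).mul hχ) hφ.contDiff, hζ] at h6
  have e2 : (∫ p in strip m n T, initCutoff k p.1 *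
        (fderiv ℝ φ p (1, 0, b₁ p.2.1 + b₂ p.2.2) * (χ p.1 * u p))) +
      (∫ p in strip m n T, initCutoff k p.1 * (φ p * ((deriv χ p.1 + τ * χ p.1) * u p))) +
      (∫ p in strip m n T, deriv (initCutoff k) p.1 * ((χ p.1 * φ p) * u p)) =
      - ∫ p in strip m n T, initCutoff k p.1 * (φ p * (χ p.1 * f p)) := by
    rw [← integral_add (i3 k) (i2 k)]
    refine (integral_add ((i3 k).add (i2 k)) (i4 k)).symm.trans ?_
    refine (Eq.trans ?_ h6).trans (congrArg Neg.neg ?_) <;>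
      refine integral_congr_ae (Eventually.of_forall fun p => ?_)
    · simp only [Pi.add_apply]
      ring
    · ring
  linarith

end StripSystem

/-! ### The straightened system -/

section Straightened

variable {m n : ℕ} {T : ℝ} {b₁ : EuclideanSpace ℝ (Fin m) →L[ℝ] EuclideanSpace ℝ (Fin n)}
  {b₂ : EuclideanSpace ℝ (Fin n) →L[ℝ] EuclideanSpace ℝ (Fin n)} {τ : ℝ}
  {A : Fin m → Fin m → Space m n → ℝ} {c : Space m n → ℝ} {d : Fin m → Space m n → ℝ}
  {u f F : Space m n → ℝ} {G H : Fin m → Space m n → ℝ}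

/-- The coefficients of the equation in the straightened variables. The matrix of the derivatives
is cut off in time, which does not matter in `(0, T)`. -/
def straightCoeffs (T : ℝ) (b₁ : EuclideanSpace ℝ (Fin m) →L[ℝ] EuclideanSpace ℝ (Fin n))
    (b₂ : EuclideanSpace ℝ (Fin n) →L[ℝ] EuclideanSpace ℝ (Fin n)) (τ : ℝ)
    (A : Fin m → Fin m → Space m n → ℝ) (c : Space m n → ℝ) (d : Fin m → Space m n → ℝ) :
    Coeffs m n where
  A := A
  q k i t := timeBump T t * shear b₁ b₂ t (EuclideanSpace.single i 1) k
  c e := c e + τ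
  d := d

lemma isTimeWeight_straightCoeffs (k : Fin n) (i : Fin m) :
    IsTimeWeight ((straightCoeffs T b₁ b₂ τ A c d).q k i) := by
  refine isTimeWeight_bump_mul T ?_
  have h : ContDiff ℝ ∞ fun t => shear b₁ b₂ t (EuclideanSpace.single i 1) :=
    (contDiff_shear b₁ b₂).clm_apply contDiff_const
  exact contDiff_euclidean.1 h k

/-- Elements of `L²` given by functions on the strip. -/
def pullL (b₁ : EuclideanSpace ℝ (Fin m) →L[ℝ] EuclideanSpace ℝ (Fin n))
    (b₂ : EuclideanSpace ℝ (Fin n) →L[ℝ] EuclideanSpace ℝ (Fin n)) {x : Space m n → ℝ}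
    (hx : MemLp x 2 (volume.restrict (strip m n T))) : L2Space m n :=
  (memLp_pull b₁ b₂ hx).toLp _

lemma coeFn_pullL {x : Space m n → ℝ} (hx : MemLp x 2 (volume.restrict (strip m n T))) :
    pullL b₁ b₂ hx =ᵐ[volume] pull b₁ b₂ T x := MemLp.coeFn_toLp _

lemma timeInd_pullL {x : Space m n → ℝ} (hx : MemLp x 2 (volume.restrict (strip m n T))) :
    timeMul m n (timeInd (Ioo 0 T)) (pullL b₁ b₂ hx) = pullL b₁ b₂ hx := by
  apply Lp.ext
  filter_upwards [coeFn_mulL (isMultiplier_timeInd measurableSet_Ioo) (pullL b₁ b₂ hx),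
    coeFn_pullL (b₁ := b₁) (b₂ := b₂) hx] with e h1 h2
  rw [h1, h2]
  by_cases he : e.1 ∈ Ioo 0 T
  · rw [timeInd, indicator_of_mem he, one_mul]
  · rw [pull_of_notMem b₁ b₂ he, mul_zero]

/-- Functions of `(t, v)` are not affected by the straightening. -/
lemma InvW.comp_unstraighten {b : Space m n → ℝ} (hb : InvW b) (e : Space m n) :
    b (unstraighten b₁ b₂ e) = b e := by
  rw [← hb e ((unstraighten b₁ b₂ e).2.2 - e.2.2)]
  congr 1
  refine Prod.ext ?_ (Prod.ext ?_ ?_) <;> simp [inclW_apply, unstraighten]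

lemma inner_pullL_test {x ψ : Space m n → ℝ} (hx : MemLp x 2 (volume.restrict (strip m n T)))
    (hψ : MemLp ψ 2 volume) : inner ℝ (pullL b₁ b₂ hx) (hψ.toLp ψ) =
      ∫ p in strip m n T, ψ (straighten b₁ b₂ p) * x p := by
  rw [real_inner_eq_integral, ← integral_pull_mul]
  apply integral_congr_ae
  filter_upwards [coeFn_pullL (b₁ := b₁) (b₂ := b₂) hx, hψ.coeFn_toLp] with e h1 h2
  rw [h1, h2]

lemma IsTest.comp_straighten {ψ : Space m n → ℝ} (hψ : IsTest ψ) :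
    IsTest fun p => ψ (straighten b₁ b₂ p) :=
  ⟨hψ.contDiff.comp (contDiff_straighten b₁ b₂),
    hψ.hasCompactSupport.comp_homeomorph (straightenHomeomorph b₁ b₂)⟩

/-- The derivative along `v_i` in the original variables, applied to a test function in the
straightened variables. -/
lemma inner_pullL_dirV {x ψ : Space m n → ℝ} (hx : MemLp x 2 (volume.restrict (strip m n T)))
    (hψ : IsTest ψ) (i : Fin m) :
    inner ℝ (pullL b₁ b₂ hx) ((hψ.fderiv_apply (dirV i)).memLp.toLp _) -
      ∑ k, inner ℝ (timeMul m n ((straightCoeffs T b₁ b₂ τ A c d).q k i) (pullL b₁ b₂ hx))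
        ((hψ.fderiv_apply (dirW k)).memLp.toLp _) =
      ∫ p in strip m n T, fderiv ℝ (fun p => ψ (straighten b₁ b₂ p)) p (dirV i) * x p := by
  set q := (straightCoeffs T b₁ b₂ τ A c d).q with hq
  have hqm : ∀ k, IsMultiplier fun e : Space m n => q k i e.1 := fun k =>
    (isTimeWeight_straightCoeffs k i).isMultiplier
  have hw : ∀ k, MemLp (fun e : Space m n => q k i e.1 * fderiv ℝ ψ e (dirW k)) 2 volume :=
    fun k => (hqm k).memLp (hψ.fderiv_apply (dirW k)).memLp
  have h1 : ∀ k, inner ℝ (timeMul m n (q k i) (pullL b₁ b₂ hx))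
      ((hψ.fderiv_apply (dirW k)).memLp.toLp _) =
      inner ℝ (pullL b₁ b₂ hx) ((hw k).toLp _) := by
    intro k
    rw [inner_mulL_left (hqm k)]
    congr 1
    apply Lp.ext
    filter_upwards [coeFn_mulL (hqm k) ((hψ.fderiv_apply (dirW k)).memLp.toLp _),
      (hw k).coeFn_toLp, (hψ.fderiv_apply (dirW k)).memLp.coeFn_toLp] with e h1 h2 h3
    rw [h1, h2, h3]
  have hiv : Integrable (fun p => fderiv ℝ ψ (straighten b₁ b₂ p) (dirV i) * x p)
      (volume.restrict (strip m n T)) := by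
    have ht := (hψ.fderiv_apply (dirV i)).comp_straighten (b₁ := b₁) (b₂ := b₂)
    exact integrable_test_mul ht.contDiff.continuous ht.hasCompactSupport hx
  have hiw : ∀ k, Integrable (fun p => q k i (straighten b₁ b₂ p).1 *
      fderiv ℝ ψ (straighten b₁ b₂ p) (dirW k) * x p) (volume.restrict (strip m n T)) := by
    intro k
    have ht := (hψ.fderiv_apply (dirW k)).comp_straighten (b₁ := b₁) (b₂ := b₂)
    have := integrable_test_mul ht.contDiff.continuous ht.hasCompactSupport (memLp_time_mul
      (isTimeWeight_straightCoeffs (T := T) (b₁ := b₁) (b₂ := b₂) (τ := τ) (A := A) (c := c)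
        (d := d) k i).contDiff.continuous hx)
    refine this.congr (Eventually.of_forall fun p => ?_)
    change _ * (q k i p.1 * x p) = q k i p.1 * _ * x p
    ring
  simp only [h1, inner_pullL_test]
  rw [← integral_finsetSum _ fun k _ => hiw k,
    ← integral_sub hiv (integrable_finsetSum _ fun k _ => hiw k)]
  refine setIntegral_congr_fun (measurableSet_strip T) fun p hp => ?_
  simp only [fderiv_comp_straighten_dirV b₁ b₂ hψ.contDiff, sub_mul, Finset.sum_mul]
  congr 1
  refine Finset.sum_congr rfl fun k _ => ?_
  have hb : timeBump T p.1 = 1 := timeBump_eq_one (by linarith [hp.1.1]) (by linarith [hp.1.2])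
  change (timeBump T p.1 * shear b₁ b₂ p.1 (EuclideanSpace.single i 1) k) * _ * _ = _
  rw [hb, one_mul]

variable {χ : ℝ → ℝ} {T₁ T₂ : ℝ}

lemma StripSystem.memLp_cutoff_f (h : StripSystem T b₁ b₂ τ A c d u f F G H)
    (hχ : ContDiff ℝ ∞ χ) :
    MemLp (fun p : Space m n => χ p.1 * f p + (deriv χ p.1 + τ * χ p.1) * u p) 2
      (volume.restrict (strip m n T)) :=
  (memLp_time_mul hχ.continuous h.memLp_f).add (memLp_time_mul
    (χ := fun t => deriv χ t + τ * χ t)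
    (((contDiff_infty_iff_deriv.1 hχ).2.add (contDiff_const.mul hχ)).continuous) h.memLp_u)

/-- The system in the straightened variables, for the solution multiplied by `χ(t)`. -/
lemma StripSystem.weakSystem (h : StripSystem T b₁ b₂ τ A c d u f F G H) (hT : 0 < T)
    (hA : ∀ i j, IsMultiplier (A i j)) (hA' : ∀ i j, InvW (A i j)) (hc : IsMultiplier c)
    (hc' : InvW c) (hd : ∀ j, IsMultiplier (d j)) (hd' : ∀ j, InvW (d j))
    (hχ : ContDiff ℝ ∞ χ) (hT₂ : T₂ < T) (hχ0 : ∀ t, T₂ ≤ t → χ t = 0)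
    (hχ1 : ∀ t < T₁, deriv χ t = 0) :
    WeakSystem (straightCoeffs T b₁ b₂ τ A c d) T T₁
      (pullL b₁ b₂ (memLp_time_mul hχ.continuous h.memLp_u))
      (pullL b₁ b₂ (h.memLp_cutoff_f hχ))
      (pullL b₁ b₂ (memLp_time_mul hχ.continuous h.memLp_F))
      (pullL b₁ b₂ (memLp_time_mul (contDiff_infty_iff_deriv.1 hχ).2.continuous h.memLp_u))
      (fun i => pullL b₁ b₂ (memLp_time_mul hχ.continuous (h.memLp_G i))) := by
  have hco : ∀ e : Space m n, unstraighten b₁ b₂ e ∈ strip m n T ↔ e.1 ∈ Ioo 0 T := fun e =>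
    ⟨fun h => h.1, fun h => ⟨h, mem_univ _⟩⟩
  have hflux : ∀ i, (straightCoeffs T b₁ b₂ τ A c d).flux
      (fun i => pullL b₁ b₂ (memLp_time_mul hχ.continuous (h.memLp_G i))) i =
      pullL b₁ b₂ (memLp_time_mul hχ.continuous (h.memLp_H i)) := by
    intro i
    apply Lp.ext
    have h1 : ∀ᵐ e, ∀ j, mulL volume (A i j)
        (pullL b₁ b₂ (memLp_time_mul hχ.continuous (h.memLp_G j))) e =
        A i j e * pull b₁ b₂ T (fun p => χ p.1 * G j p) e := by
      rw [ae_all_iff]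
      intro j
      filter_upwards [coeFn_mulL (hA i j) (pullL b₁ b₂ (memLp_time_mul hχ.continuous (h.memLp_G j))),
        coeFn_pullL (b₁ := b₁) (b₂ := b₂) (memLp_time_mul hχ.continuous (h.memLp_G j))] with e h1 h2
      rw [h1, h2]
    filter_upwards [h1, Lp.coeFn_finsetSum Finset.univ fun j => mulL volume (A i j)
      (pullL b₁ b₂ (memLp_time_mul hχ.continuous (h.memLp_G j))),
      coeFn_pullL (b₁ := b₁) (b₂ := b₂) (memLp_time_mul hχ.continuous (h.memLp_H i))] with e h1 h2 h3
    rw [h3]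
    refine h2.trans ?_
    rw [Finset.sum_apply]
    simp only [h1]
    by_cases he : e.1 ∈ Ioo 0 T
    · simp only [pull_of_mem b₁ b₂ he, h.flux _ ((hco e).2 he), Finset.mul_sum]
      refine Finset.sum_congr rfl fun j _ => ?_
      rw [(hA' i j).comp_unstraighten]
      ring
    · simp [pull_of_notMem b₁ b₂ he]
  refine ⟨?_, ?_, ?_, ?_, timeInd_pullL _, fun i => timeInd_pullL _, timeInd_pullL _, ?_⟩
  · refine isDeriv_of_weak fun ψ hψ => ?_
    have hφ := hψ.comp_straighten (b₁ := b₁) (b₂ := b₂)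
    rw [inner_pullL_test, inner_pullL_test]
    have := h.transport_cutoff hT hχ hT₂ hχ0 hφ
    simpa only [fderiv_comp_straighten_transport b₁ b₂ hψ.contDiff] using this
  · intro i ψ hψ
    have h1 := inner_pullL_dirV (τ := τ) (A := A) (c := c) (d := d) (b₁ := b₁) (b₂ := b₂)
      (memLp_time_mul hχ.continuous h.memLp_u) hψ i
    rw [h.deriv_v_cutoff hχ hT₂ hχ0 (hψ.comp_straighten (b₁ := b₁) (b₂ := b₂)) i] at h1
    rw [Fintype.sum_option]
    simp only [Option.elim, inner_neg_left, Finset.sum_neg_distrib]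
    rw [← sub_eq_add_neg, h1, inner_pullL_test]
  · intro ψ hψ
    have h1 : ∀ i, _ := fun i => inner_pullL_dirV (τ := τ) (A := A) (c := c) (d := d) (b₁ := b₁)
      (b₂ := b₂) (memLp_time_mul hχ.continuous (h.memLp_H i)) hψ i
    have h2 := Finset.sum_congr (rfl : (Finset.univ : Finset (Fin m)) = _) fun i _ => h1 i
    rw [h.elliptic_cutoff hχ hT₂ hχ0 (hψ.comp_straighten (b₁ := b₁) (b₂ := b₂)),
      Finset.sum_sub_distrib, Finset.sum_comm] at h2
    rw [Fintype.sum_sum_type]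
    simp only [Sum.elim_inl, Sum.elim_inr, inner_neg_left, Finset.sum_neg_distrib, sum_inner, hflux]
    rw [← sub_eq_add_neg, h2, inner_pullL_test]
  · apply Lp.ext
    set Fp := pullL b₁ b₂ (memLp_time_mul hχ.continuous h.memLp_F) with hFp
    set Up := pullL b₁ b₂ (memLp_time_mul hχ.continuous h.memLp_u) with hUp
    set Ep := pullL b₁ b₂ (memLp_time_mul (contDiff_infty_iff_deriv.1 hχ).2.continuous h.memLp_u)
      with hEp
    set Gp := fun i => pullL b₁ b₂ (memLp_time_mul hχ.continuous (h.memLp_G i)) with hGp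
    have h1 : ∀ᵐ e, ∀ j, mulL volume (d j) (Gp j) e =
        d j e * pull b₁ b₂ T (fun p => χ p.1 * G j p) e := by
      rw [ae_all_iff]
      intro j
      filter_upwards [coeFn_mulL (hd j) (Gp j),
        coeFn_pullL (b₁ := b₁) (b₂ := b₂) (memLp_time_mul hχ.continuous (h.memLp_G j))] with e h1 h2
      rw [h1]
      exact congrArg _ h2
    have hcτ : IsMultiplier fun e => c e + τ := hc.add (IsMultiplier.const τ)
    filter_upwards [h1, coeFn_pullL (b₁ := b₁) (b₂ := b₂) (h.memLp_cutoff_f hχ),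
      coeFn_pullL (b₁ := b₁) (b₂ := b₂) (memLp_time_mul hχ.continuous h.memLp_F),
      coeFn_pullL (b₁ := b₁) (b₂ := b₂) (memLp_time_mul hχ.continuous h.memLp_u),
      coeFn_pullL (b₁ := b₁) (b₂ := b₂)
        (memLp_time_mul (contDiff_infty_iff_deriv.1 hχ).2.continuous h.memLp_u),
      coeFn_mulL hcτ Up, Lp.coeFn_finsetSum Finset.univ fun j => mulL volume (d j) (Gp j),
      Lp.coeFn_add Fp (mulL volume (fun e => c e + τ) Up + ∑ j, mulL volume (d j) (Gp j) + Ep),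
      Lp.coeFn_add (mulL volume (fun e => c e + τ) Up + ∑ j, mulL volume (d j) (Gp j)) Ep,
      Lp.coeFn_add (mulL volume (fun e => c e + τ) Up) (∑ j, mulL volume (d j) (Gp j))]
      with e h1 h2 h3 h4 h5 h6 h7 h8 h9 h10
    rw [h2]
    refine Eq.trans ?_ h8.symm
    rw [Pi.add_apply, h9, Pi.add_apply, h10, Pi.add_apply, h6, h7, h3, h4, h5, Finset.sum_apply]
    simp only [h1]
    by_cases he : e.1 ∈ Ioo 0 T
    · simp only [pull_of_mem b₁ b₂ he, h.split _ ((hco e).2 he), hc'.comp_unstraighten,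
        (hd' _).comp_unstraighten]
      have e1 : ∀ p : Space m n, ∑ j, d j e * ((jac b₂ e.1 : ℝ) * (χ p.1 * G j p)) =
          jac b₂ e.1 * χ p.1 * ∑ j, d j e * G j p := fun p => by
        rw [Finset.mul_sum]
        exact Finset.sum_congr rfl fun j _ => by ring
      rw [e1]
      ring
    · simp [pull_of_notMem b₁ b₂ he]
  · apply Lp.ext
    filter_upwards [coeFn_mulL (isMultiplier_timeInd measurableSet_Iio) (pullL b₁ b₂
      (memLp_time_mul (contDiff_infty_iff_deriv.1 hχ).2.continuous h.memLp_u)),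
      coeFn_pullL (b₁ := b₁) (b₂ := b₂)
        (memLp_time_mul (contDiff_infty_iff_deriv.1 hχ).2.continuous h.memLp_u),
      Lp.coeFn_zero ℝ 2 (volume : Measure (Space m n))] with e h1 h2 h3
    rw [h1, h2, h3, Pi.zero_apply]
    by_cases he : e.1 ∈ Iio T₁
    · by_cases he' : e.1 ∈ Ioo 0 T
      · rw [pull_of_mem b₁ b₂ he', show (unstraighten b₁ b₂ e).1 = e.1 from rfl, hχ1 _ he]
        ring
      · rw [pull_of_notMem b₁ b₂ he', mul_zero]
    · rw [timeInd, indicator_of_notMem he, zero_mul]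

/-- Uniqueness for real solutions. -/
lemma StripSystem.ae_eq_zero (h : StripSystem T b₁ b₂ τ A c d u f F G H) (hT : 0 < T) {l : ℝ}
    (hl : 0 ≤ l) (hA : ∀ i j, IsMultiplier (A i j)) (hA' : ∀ i j, InvW (A i j))
    (hA_symm : ∀ i j e, A i j e = A j i e)
    (hA_lip : ∃ K : ℝ, ∀ i j e s, |A i j (e + s • dirT) - A i j e| ≤ K * |s|)
    (hA_ell : ∀ e ∈ strip m n T, ∀ ξ : Fin m → ℝ,
      ∑ i, ξ i ^ 2 ≤ l * ∑ i, ∑ j, A i j e * ξ i * ξ j)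
    (hc : IsMultiplier c) (hc' : InvW c) (hd : ∀ j, IsMultiplier (d j)) (hd' : ∀ j, InvW (d j)) :
    u =ᵐ[volume.restrict (strip m n T)] 0 := by
  have hadm : (straightCoeffs T b₁ b₂ τ A c d).Admissible T l :=
    ⟨hA, hA', hA_symm, hA_lip, hA_ell, isTimeWeight_straightCoeffs, hc.add (IsMultiplier.const τ),
      fun e y => by simp only [straightCoeffs]; rw [hc'], hd, hd'⟩
  have key : ∀ T₀ < T, ∀ᵐ p ∂volume.restrict (strip m n T), p.1 ∈ Iio T₀ → u p = 0 := by
    intro T₀ hT₀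
    obtain ⟨T₁, h01, h1⟩ := exists_between hT₀
    obtain ⟨T₂, h12, h2⟩ := exists_between h1
    set χ : ℝ → ℝ := fun t => Real.smoothTransition ((T₂ - t) / (T₂ - T₁)) with hχdef
    have hpos : 0 < T₂ - T₁ := sub_pos.2 h12
    have hχ : ContDiff ℝ ∞ χ :=
      Real.smoothTransition.contDiff.comp ((contDiff_const.sub contDiff_id).div_const _)
    have hχ0 : ∀ t, T₂ ≤ t → χ t = 0 := fun t ht =>
      Real.smoothTransition.zero_of_nonpos (div_nonpos_of_nonpos_of_nonneg (by linarith) hpos.le)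
    have hχ1 : ∀ t < T₁, χ t = 1 := fun t ht =>
      Real.smoothTransition.one_of_one_le ((one_le_div hpos).2 (by linarith))
    have hχ1' : ∀ t < T₁, deriv χ t = 0 := fun t ht => by
      have : χ =ᶠ[𝓝 t] fun _ => 1 := by
        filter_upwards [Iio_mem_nhds ht] with s hs using hχ1 s hs
      rw [this.deriv_eq, deriv_const]
    have hv := (h.weakSystem hT hA hA' hc hc' hd hd' hχ h2 hχ0 hχ1').vanish hl hadm h01
    have h3 : ∀ᵐ e, e.1 ∈ Iio T₀ → pull b₁ b₂ T (fun p => χ p.1 * u p) e = 0 := by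
      have h4 := coeFn_mulL (isMultiplier_timeInd (measurableSet_Iio (a := T₀)))
        (pullL b₁ b₂ (memLp_time_mul hχ.continuous h.memLp_u))
      rw [hv] at h4
      filter_upwards [h4, coeFn_pullL (b₁ := b₁) (b₂ := b₂)
        (memLp_time_mul hχ.continuous h.memLp_u), Lp.coeFn_zero ℝ 2 (volume : Measure (Space m n))]
        with e h4 h5 h6 he
      rw [h6, h5, timeInd, indicator_of_mem he, one_mul] at h4
      exact h4.symm
    filter_upwards [ae_eq_zero_of_pull b₁ b₂ h3] with p hp hpT
    have := hp hpT
    rwa [hχ1 _ (lt_trans hpT h01), one_mul] at this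
  have h1 : ∀ᵐ p ∂volume.restrict (strip m n T), ∀ k : ℕ,
      p.1 ∈ Iio (T - 1 / ((k : ℝ) + 1)) → u p = 0 :=
    ae_all_iff.2 fun k => key _ (sub_lt_self T (by positivity))
  filter_upwards [h1, ae_restrict_mem (measurableSet_strip T)] with p hp hpT
  obtain ⟨k, hk⟩ := exists_nat_one_div_lt (sub_pos.2 hpT.1.2)
  exact hp k (by rw [mem_Iio]; linarith)

end Straightened

/-! ### The coefficients -/

section CoefficientVersions

open scoped NNReal ENNReal

/-- An essentially bounded function agrees almost everywhere with a bounded measurable one. -/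
lemma exists_isMultiplier_version {α : Type*} [MeasurableSpace α] {μ : Measure α} {b : α → ℝ}
    (hb : MemLp b ⊤ μ) : ∃ b' : α → ℝ, IsMultiplier b' ∧ b =ᵐ[μ] b' := by
  set C : ℝ := (eLpNormEssSup b μ).toReal with hC
  have hC0 : 0 ≤ C := ENNReal.toReal_nonneg
  have hfin : eLpNormEssSup b μ ≠ ⊤ := by
    have := hb.2.ne
    rwa [eLpNorm_exponent_top] at this
  refine ⟨fun a => max (-C) (min C (hb.1.mk b a)), ⟨?_, C, fun a => ?_⟩, ?_⟩
  · exact measurable_const.max (measurable_const.min hb.1.stronglyMeasurable_mk.measurable)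
  · exact abs_le.2 ⟨le_max_left _ _, max_le (by linarith) (min_le_left _ _)⟩
  · filter_upwards [hb.1.ae_eq_mk, ae_le_eLpNormEssSup (f := b) (μ := μ)] with a h1 h2
    rw [← h1]
    have h3 : |b a| ≤ C := by
      have := ENNReal.toReal_mono hfin h2
      simpa using this
    rw [min_eq_right (abs_le.1 h3).2, max_eq_right (abs_le.1 h3).1]

variable {m n : ℕ} {T : ℝ}

lemma ae_strip_of_ae_stripV {P : ℝ × EuclideanSpace ℝ (Fin m) → Prop}
    (h : ∀ᵐ q ∂volume.restrict (stripV m T), P q) :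
    ∀ᵐ p ∂volume.restrict (strip m n T), P (p.1, p.2.1) := by
  rw [ae_restrict_iff' (measurableSet_strip T)]
  have hs : MeasurableSet (stripV m T) := measurableSet_Ioo.prod MeasurableSet.univ
  rw [ae_restrict_iff' hs] at h
  have h1 := (measurePreserving_prodAssoc (volume : Measure ℝ)
    (volume : Measure (EuclideanSpace ℝ (Fin m)))
    (volume : Measure (EuclideanSpace ℝ (Fin n)))).symm.quasiMeasurePreserving
  have h2 := Measure.quasiMeasurePreserving_fst.comp h1
  filter_upwards [h2.ae h] with p hp hpT
  exact hp ⟨hpT.1, mem_univ _⟩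

lemma isMultiplier_comp_tv {b : ℝ × EuclideanSpace ℝ (Fin m) → ℝ} (hb : IsMultiplier b) :
    IsMultiplier fun p : Space m n => b (p.1, p.2.1) :=
  ⟨hb.1.comp (measurable_fst.prodMk measurable_snd.fst), hb.2.imp fun _ hC _ => hC _⟩

lemma invW_comp_tv (b : ℝ × EuclideanSpace ℝ (Fin m) → ℝ) :
    InvW fun p : Space m n => b (p.1, p.2.1) := fun e y => by
  simp [inclW_apply]

/-- Lipschitz bounded functions on the strip extend to Lipschitz bounded functions. -/
lemma exists_lipschitz_extension {b : ℝ × EuclideanSpace ℝ (Fin m) → ℝ} {K : ℝ≥0}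
    (hb : LipschitzOnWith K b (stripV m T)) {M : ℝ} (hM0 : 0 ≤ M)
    (hM : ∀ q ∈ stripV m T, |b q| ≤ M) :
    ∃ b' : ℝ × EuclideanSpace ℝ (Fin m) → ℝ,
      IsMultiplier b' ∧ LipschitzWith K b' ∧ EqOn b b' (stripV m T) := by
  obtain ⟨g, hg, hgb⟩ := hb.extend_real
  have hl : LipschitzWith K fun q => max (-M) (min M (g q)) := (hg.const_min M).const_max (-M)
  refine ⟨_, ⟨hl.continuous.measurable, M, fun q => ?_⟩, hl, fun q hq => ?_⟩
  · exact abs_le.2 ⟨le_max_left _ _, max_le (by linarith) (min_le_left _ _)⟩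
  · have h := abs_le.1 (hM q hq)
    simp only
    rw [← hgb hq, min_eq_right h.2, max_eq_right h.1]

/-- The entries of a symmetric matrix are bounded by its quadratic form. -/
lemma abs_entry_le {B : Matrix (Fin m) (Fin m) ℝ} (hB : B.IsSymm) {l : ℝ}
    (h : ∀ ξ : EuclideanSpace ℝ (Fin m), 0 ≤ ∑ i, ∑ j, B i j * ξ i * ξ j ∧
      ∑ i, ∑ j, B i j * ξ i * ξ j ≤ l * ‖ξ‖ ^ 2) (hl : 0 ≤ l) (p q : Fin m) :
    |B p q| ≤ 2 * l := by
  have hform : ∀ (p q : Fin m) (s : ℝ),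
      ∑ i, ∑ j, B i j * (EuclideanSpace.single p 1 + s • EuclideanSpace.single q 1 :
        EuclideanSpace ℝ (Fin m)) i * (EuclideanSpace.single p 1 + s • EuclideanSpace.single q 1 :
        EuclideanSpace ℝ (Fin m)) j = B p p + s * B p q + s * B q p + s ^ 2 * B q q := by
    intro p q s
    simp [mul_add, add_mul, Finset.sum_add_distrib]
    ring
  have hdiag : ∀ p, 0 ≤ B p p := fun p => by
    have h1 := (h (EuclideanSpace.single p 1 + (0:ℝ) • EuclideanSpace.single p 1)).1
    rw [hform] at h1
    linarith
  have hdiag' : ∀ p, B p p ≤ l := fun p => by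
    have h1 := (h (EuclideanSpace.single p 1 + (0:ℝ) • EuclideanSpace.single p 1)).2
    rw [hform] at h1
    simp only [zero_smul, add_zero, PiLp.norm_single, norm_one] at h1
    linarith
  have hn : ‖(EuclideanSpace.single p 1 + (1:ℝ) • EuclideanSpace.single q 1 :
      EuclideanSpace ℝ (Fin m))‖ ≤ 2 := by
    refine (norm_add_le _ _).trans ?_
    simp only [one_smul, PiLp.norm_single, norm_one]
    norm_num
  have h1 := h (EuclideanSpace.single p 1 + (1:ℝ) • EuclideanSpace.single q 1)
  rw [hform, hB.apply p q] at h1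
  have h2 : l * ‖(EuclideanSpace.single p 1 + (1:ℝ) • EuclideanSpace.single q 1 :
      EuclideanSpace ℝ (Fin m))‖ ^ 2 ≤ l * 2 ^ 2 :=
    mul_le_mul_of_nonneg_left (pow_le_pow_left₀ (norm_nonneg _) hn 2) hl
  have := hdiag p
  have := hdiag q
  have := hdiag' p
  have := hdiag' q
  exact abs_le.2 ⟨by linarith [h1.1], by linarith [h1.2]⟩

/-- Symmetric extension of the diffusion matrix. -/
lemma exists_matrix_extension {A : ℝ → EuclideanSpace ℝ (Fin m) → Matrix (Fin m) (Fin m) ℝ}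
    (hA_symm : ∀ t ∈ Ioo 0 T, ∀ v, (A t v).IsSymm)
    (hA_lip : ∀ i j, ∃ K, LipschitzOnWith K (fun q : ℝ × EuclideanSpace ℝ (Fin m) => A q.1 q.2 i j)
      (stripV m T)) {l : ℝ} (hl : 1 < l)
    (hA_ell : ∀ t ∈ Ioo 0 T, ∀ v, ∀ ξ : EuclideanSpace ℝ (Fin m),
      l⁻¹ * ‖ξ‖ ^ 2 ≤ ∑ i, ∑ j, A t v i j * ξ i * ξ j ∧
        ∑ i, ∑ j, A t v i j * ξ i * ξ j ≤ l * ‖ξ‖ ^ 2) :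
    ∃ A' : Fin m → Fin m → ℝ × EuclideanSpace ℝ (Fin m) → ℝ,
      (∀ i j, IsMultiplier (A' i j)) ∧ (∀ i j q, A' i j q = A' j i q) ∧
      (∃ K : ℝ, ∀ i j t s v, |A' i j (t + s, v) - A' i j (t, v)| ≤ K * |s|) ∧
      ∀ i j, ∀ q ∈ stripV m T, A q.1 q.2 i j = A' i j q := by
  have hl0 : 0 < l := by linarith
  have hM : ∀ i j, ∀ q ∈ stripV m T, |A q.1 q.2 i j| ≤ 2 * l := fun i j q hq =>
    abs_entry_le (hA_symm q.1 hq.1 q.2) (fun ξ => ⟨le_trans (by positivity)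
      (hA_ell q.1 hq.1 q.2 ξ).1, (hA_ell q.1 hq.1 q.2 ξ).2⟩) hl0.le i j
  choose K hK using hA_lip
  choose g hg1 hg2 hg3 using fun i j => exists_lipschitz_extension (hK i j) (by positivity) (hM i j)
  -- the entries are extended for ordered pairs of indices, to keep the symmetry
  refine ⟨fun i j => g (min i j) (max i j), fun i j => hg1 _ _, fun i j q => ?_,
    ⟨∑ i, ∑ j, (K i j : ℝ), fun i j t s v => ?_⟩, fun i j q hq => ?_⟩
  · simp only [min_comm i j, max_comm i j]
  · have h1 := (hg2 (min i j) (max i j)).dist_le_mul (t + s, v) (t, v)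
    rw [Real.dist_eq, Prod.dist_eq, dist_self, Real.dist_eq, add_sub_cancel_left,
      max_eq_left (abs_nonneg s)] at h1
    refine h1.trans (mul_le_mul_of_nonneg_right ?_ (abs_nonneg s))
    calc (K (min i j) (max i j) : ℝ) ≤ ∑ b, (K (min i j) b : ℝ) :=
          Finset.single_le_sum (f := fun b => (K (min i j) b : ℝ)) (fun _ _ => NNReal.coe_nonneg _)
            (Finset.mem_univ _)
      _ ≤ ∑ a, ∑ b, (K a b : ℝ) :=
          Finset.single_le_sum (f := fun a => ∑ b, (K a b : ℝ)) (fun _ _ => Finset.sum_nonneg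
            fun _ _ => NNReal.coe_nonneg _) (Finset.mem_univ _)
  · refine Eq.trans ?_ (hg3 (min i j) (max i j) hq)
    rcases le_total i j with h | h
    · simp only [min_eq_left h, max_eq_right h]
    · simp only [min_eq_right h, max_eq_left h]
      exact (hA_symm q.1 hq.1 q.2).apply j i

end CoefficientVersions

/-! ### The trace -/

section Trace

open scoped NNReal ENNReal

variable {𝕜 : Type*} [RCLike 𝕜] {m n : ℕ} {T : ℝ}

lemma vanishesAtZero_of_trace {u : Space m n → 𝕜} (hT : 0 < T)
    (hu : MemLp u 2 (volume.restrict (strip m n T))) (htrace : HasL2TraceAtZero u 0)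
    {L : 𝕜 →L[ℝ] ℝ} (hL : ∀ x, ‖L x‖ ≤ ‖x‖) : VanishesAtZero fun p => L (u p) := by
  intro ε hε
  have h1 := htrace.2.eventually (gt_mem_nhds (ENNReal.ofReal_pos.2 (Real.sqrt_pos.2 hε)))
  obtain ⟨S, hS, V, hV, hSV⟩ := Filter.mem_inf_iff_superset.1 h1
  obtain ⟨δ₁, hδ₁, hS⟩ := (mem_nhdsGT_iff_exists_Ioo_subset).1 hS
  refine ⟨min δ₁ T, lt_min hδ₁ hT, fun δ hδ0 hδ => ?_⟩
  have hsub : strip m n δ ⊆ strip m n T :=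
    prod_mono (Ioo_subset_Ioo_right (hδ.le.trans (min_le_right _ _))) Subset.rfl
  have hLu : AEStronglyMeasurable (fun p => L (u p)) (volume.restrict (strip m n δ)) :=
    L.continuous.comp_aestronglyMeasurable (hu.1.mono_measure (Measure.restrict_mono hsub le_rfl))
  have huδ : AEStronglyMeasurable u (volume.restrict (strip m n δ)) :=
    hu.1.mono_measure (Measure.restrict_mono hsub le_rfl)
  have hprod : (volume : Measure (Space m n)).restrict (strip m n δ) =
      ((volume : Measure ℝ).restrict (Ioo 0 δ)).prod volume :=
    (Measure.restrict_prod_eq_prod_univ _).symm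
  have h2 : ∫⁻ p in strip m n δ, ‖u p‖ₑ ^ (2:ℝ) ≤ ENNReal.ofReal (ε * δ) := by
    rw [hprod] at huδ ⊢
    rw [lintegral_prod _ (huδ.enorm.pow_const _)]
    calc ∫⁻ t in Ioo 0 δ, ∫⁻ z, ‖u (t, z)‖ₑ ^ (2:ℝ)
        ≤ ∫⁻ t in Ioo 0 δ, ENNReal.ofReal ε := by
          refine lintegral_mono_ae ?_
          rw [ae_restrict_iff' measurableSet_Ioo]
          filter_upwards [hV] with t htV ht
          have h3 := hSV ⟨hS ⟨ht.1, ht.2.trans (hδ.trans_le (min_le_left _ _))⟩, htV⟩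
          have h4 : eLpNorm (fun z => u (t, z)) 2 volume ≤ ENNReal.ofReal (Real.sqrt ε) := by
            simp only [mem_ofPred_eq, Pi.zero_apply, sub_zero] at h3
            exact h3.le
          have h5 := eLpNorm_nnreal_pow_eq_lintegral (p := 2) (μ := volume)
            (f := fun z => u (t, z)) two_ne_zero
          simp only [NNReal.coe_ofNat, ENNReal.coe_ofNat] at h5
          rw [← h5]
          refine (ENNReal.rpow_le_rpow h4 zero_le_two).trans ?_
          rw [ENNReal.ofReal_rpow_of_nonneg (Real.sqrt_nonneg _) zero_le_two, Real.rpow_two,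
            Real.sq_sqrt hε.le]
      _ = ENNReal.ofReal (ε * δ) := by
          rw [lintegral_const, Measure.restrict_apply_univ, Real.volume_Ioo, sub_zero,
            ENNReal.ofReal_mul hε.le]
  rw [integral_eq_lintegral_of_nonneg_ae (Eventually.of_forall fun p => sq_nonneg _) (hLu.pow 2)]
  refine ENNReal.toReal_le_of_le_ofReal (by positivity) (le_trans (lintegral_mono fun p => ?_) h2)
  rw [← ofReal_norm, ENNReal.ofReal_rpow_of_nonneg (norm_nonneg _) zero_le_two, Real.rpow_two]
  refine ENNReal.ofReal_le_ofReal ?_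
  rw [← sq_abs (L (u p))]
  exact pow_le_pow_left₀ (abs_nonneg _) (hL _) 2

end Trace

/-! ### Reduction to real solutions -/

section RealParts

open scoped NNReal ENNReal

variable {𝕜 : Type*} [RCLike 𝕜] {m n : ℕ} {T : ℝ}

lemma integrable_test_smul {φ : Space m n → ℝ} {x : Space m n → 𝕜} (hφc : Continuous φ)
    (hφ : HasCompactSupport φ) (hx : MemLp x 2 (volume.restrict (strip m n T))) :
    Integrable (fun p => φ p • x p) (volume.restrict (strip m n T)) :=
  memLp_one_iff_integrable.1
    (hx.smul ((hφc.memLp_of_hasCompactSupport (p := 2) hφ).restrict (strip m n T)))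

lemma memLp_multiplier_smul {b : Space m n → ℝ} (hb : IsMultiplier b) {x : Space m n → 𝕜}
    (hx : MemLp x 2 (volume.restrict (strip m n T))) :
    MemLp (fun p => b p • x p) 2 (volume.restrict (strip m n T)) := by
  obtain ⟨hm, C, hC⟩ := hb
  refine hx.of_le_mul (c := C) (hm.aestronglyMeasurable.smul hx.1) (Eventually.of_forall fun p => ?_)
  rw [norm_smul]
  exact mul_le_mul_of_nonneg_right (hC p) (norm_nonneg _)

lemma map_integral_test (L : 𝕜 →L[ℝ] ℝ) {φ : Space m n → ℝ} {x : Space m n → 𝕜}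
    (hφc : Continuous φ) (hφ : HasCompactSupport φ)
    (hx : MemLp x 2 (volume.restrict (strip m n T))) :
    L (∫ p in strip m n T, φ p • x p) = ∫ p in strip m n T, φ p * L (x p) := by
  rw [← L.integral_comp_comm (integrable_test_smul hφc hφ hx)]
  simp only [map_smul, smul_eq_mul]

/-- The matrix `B` as a continuous linear map. -/
def matrixCLM {p q : ℕ} (B : Matrix (Fin q) (Fin p) ℝ) :
    EuclideanSpace ℝ (Fin p) →L[ℝ] EuclideanSpace ℝ (Fin q) :=
  (Matrix.toLpLin 2 2 B).toContinuousLinearMap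

lemma IsTestFunction.isTest {φ : Space m n → ℝ} (h : IsTestFunction T φ) : IsTest φ :=
  ⟨h.contDiff, h.hasCompactSupport⟩

lemma continuous_transport {φ : Space m n → ℝ} (hφ : IsTest φ)
    (b₁ : EuclideanSpace ℝ (Fin m) →L[ℝ] EuclideanSpace ℝ (Fin n))
    (b₂ : EuclideanSpace ℝ (Fin n) →L[ℝ] EuclideanSpace ℝ (Fin n)) (τ : ℝ) :
    Continuous (fun p : Space m n => fderiv ℝ φ p (1, 0, b₁ p.2.1 + b₂ p.2.2) + τ * φ p) ∧
      HasCompactSupport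
        fun p : Space m n => fderiv ℝ φ p (1, 0, b₁ p.2.1 + b₂ p.2.2) + τ * φ p := by
  refine ⟨((hφ.contDiff.continuous_fderiv (by simp)).clm_apply (by fun_prop)).add
    (continuous_const.mul hφ.contDiff.continuous), HasCompactSupport.add ?_
    hφ.hasCompactSupport.mul_left⟩
  refine hφ.hasCompactSupport.fderiv (𝕜 := ℝ) |>.mono fun p hp => ?_
  rw [Function.mem_support] at hp ⊢
  exact fun h0 => hp (by rw [h0]; rfl)

/-- Real-linear functionals of a solution satisfy the system. -/
lemma stripSystem_of_solution (hT : 0 < T) {B₁ : Matrix (Fin n) (Fin m) ℝ}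
    {B₂ : Matrix (Fin n) (Fin n) ℝ}
    {A : ℝ → EuclideanSpace ℝ (Fin m) → Matrix (Fin m) (Fin m) ℝ}
    {c : ℝ → EuclideanSpace ℝ (Fin m) → ℝ}
    {d : ℝ → EuclideanSpace ℝ (Fin m) → EuclideanSpace ℝ (Fin m)}
    {u : Space m n → 𝕜} (hu : MemLp u 2 (volume.restrict (strip m n T)))
    {G : Fin m → Space m n → 𝕜} (hG : ∀ j, MemLp (G j) 2 (volume.restrict (strip m n T)))
    (hGu : ∀ j, IsWeakPartialV T j u (G j))
    {f : Space m n → 𝕜} (hf : MemLp f 2 (volume.restrict (strip m n T)))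
    (hfu : IsWeakTransport T B₁ B₂ u f) (hsol : IsDistributionalSolution T B₁ B₂ A c d u G)
    (htrace : HasL2TraceAtZero u 0)
    {A' : Fin m → Fin m → Space m n → ℝ} (hA'm : ∀ i j, IsMultiplier (A' i j))
    (hA' : ∀ i j, ∀ p ∈ strip m n T, A p.1 p.2.1 i j = A' i j p)
    {c' : Space m n → ℝ} (hc'm : IsMultiplier c')
    (hc' : ∀ᵐ p ∂volume.restrict (strip m n T), c p.1 p.2.1 = c' p)
    {d' : Fin m → Space m n → ℝ} (hd'm : ∀ j, IsMultiplier (d' j))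
    (hd' : ∀ᵐ p ∂volume.restrict (strip m n T), ∀ j, d p.1 p.2.1 j = d' j p)
    {L : 𝕜 →L[ℝ] ℝ} (hL : ∀ x, ‖L x‖ ≤ ‖x‖) :
    StripSystem T (matrixCLM B₁) (matrixCLM B₂) B₂.trace A' c' d' (fun p => L (u p))
      (fun p => L (f p)) (fun p => L (f p - (c' p • u p + ∑ j, d' j p • G j p)))
      (fun j p => L (G j p)) (fun i p => L (∑ j, A' i j p • G j p)) := by
  have hR : MemLp (fun p => c' p • u p + ∑ j, d' j p • G j p) 2
      (volume.restrict (strip m n T)) :=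
    (memLp_multiplier_smul hc'm hu).add
      (memLp_finsetSum _ fun j _ => memLp_multiplier_smul (hd'm j) (hG j))
  have hF : MemLp (fun p => f p - (c' p • u p + ∑ j, d' j p • G j p)) 2
      (volume.restrict (strip m n T)) := hf.sub hR
  have hH : ∀ i, MemLp (fun p => ∑ j, A' i j p • G j p) 2 (volume.restrict (strip m n T)) :=
    fun i => memLp_finsetSum _ fun j _ => memLp_multiplier_smul (hA'm i j) (hG j)
  have hell : ∀ φ : Space m n → ℝ, IsTestFunction T φ →
      ∑ i, ∫ p in strip m n T, fderiv ℝ φ p (dirV i) • (∑ j, A' i j p • G j p) =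
        ∫ p in strip m n T, φ p • (f p - (c' p • u p + ∑ j, d' j p • G j p)) := by
    intro φ hφ
    have ht := hφ.isTest
    have hφc := ht.contDiff.continuous
    have h1 := hsol φ hφ
    rw [hfu φ hφ, neg_neg] at h1
    have h2 : ∫ p in strip m n T, φ p • (c p.1 p.2.1 • u p + ∑ j, d p.1 p.2.1 j • G j p) =
        ∫ p in strip m n T, φ p • (c' p • u p + ∑ j, d' j p • G j p) := by
      apply integral_congr_ae
      filter_upwards [hc', hd'] with p h3 h4
      simp only [h3, h4]
    have h3 : ∫ p in strip m n T, ∑ i, ∑ j, (A p.1 p.2.1 i j * partialV i φ p) • G j p =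
        ∑ i, ∫ p in strip m n T, fderiv ℝ φ p (dirV i) • (∑ j, A' i j p • G j p) := by
      rw [← integral_finsetSum _ fun i _ => integrable_test_smul
        (ht.fderiv_apply (dirV i)).contDiff.continuous
        (ht.fderiv_apply (dirV i)).hasCompactSupport (hH i)]
      refine setIntegral_congr_fun (measurableSet_strip T) fun p hp => ?_
      refine Finset.sum_congr rfl fun i _ => ?_
      rw [Finset.smul_sum]
      refine Finset.sum_congr rfl fun j _ => ?_
      rw [hA' i j p hp, smul_smul, mul_comm]
      rfl
    rw [h2, h3] at h1
    simp only [smul_sub]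
    rw [integral_sub (integrable_test_smul hφc ht.hasCompactSupport hf)
      (integrable_test_smul hφc ht.hasCompactSupport hR), ← h1]
    abel
  refine ⟨L.comp_memLp' hu, L.comp_memLp' hf, L.comp_memLp' hF, fun i => L.comp_memLp' (hG i),
    fun i => L.comp_memLp' (hH i), ?_, ?_, ?_, ?_, ?_, vanishesAtZero_of_trace hT hu htrace hL⟩
  · intro φ hφ i
    have ht := hφ.isTest
    have h1 := congrArg L (hGu i φ hφ)
    rw [map_neg, map_integral_test L ht.contDiff.continuous ht.hasCompactSupport (hG i)] at h1
    rw [← h1]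
    exact (map_integral_test L (ht.fderiv_apply (dirV i)).contDiff.continuous
      (ht.fderiv_apply (dirV i)).hasCompactSupport hu).symm
  · intro φ hφ
    have ht := hφ.isTest
    have h1 := congrArg L (hfu φ hφ)
    rw [map_neg, map_integral_test L ht.contDiff.continuous ht.hasCompactSupport hf] at h1
    rw [← h1]
    obtain ⟨hc, hs⟩ := continuous_transport ht (matrixCLM B₁) (matrixCLM B₂) B₂.trace
    exact (map_integral_test L hc hs hu).symm
  · intro φ hφ
    have ht := hφ.isTest
    have h1 := congrArg L (hell φ hφ)
    rw [map_integral_test L ht.contDiff.continuous ht.hasCompactSupport hF, map_sum] at h1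
    rw [← h1]
    exact Finset.sum_congr rfl fun i _ => (map_integral_test L
      (ht.fderiv_apply (dirV i)).contDiff.continuous
      (ht.fderiv_apply (dirV i)).hasCompactSupport (hH i)).symm
  · intro p _ i
    simp only [map_sum, map_smul, smul_eq_mul]
  · intro p _
    simp only [map_sub, map_add, map_sum, map_smul, smul_eq_mul]
    ring

end RealParts

end Ultraparabolic

end

theorem theorem1p1 {𝕜 : Type*} [RCLike 𝕜] (m n : ℕ) (hm : 1 ≤ m) (hn : 1 ≤ n)
    (T : ℝ) (hT : 0 < T)
    (B₁ : Matrix (Fin n) (Fin m) ℝ) (B₂ : Matrix (Fin n) (Fin n) ℝ)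
    (hKalman : (Ultraparabolic.kalmanMatrix B₁ B₂).rank = n)
    (A : ℝ → EuclideanSpace ℝ (Fin m) → Matrix (Fin m) (Fin m) ℝ)
    (hA_symm : ∀ t ∈ Ioo 0 T, ∀ v, (A t v).IsSymm)
    (hA_lip : ∀ i j, ∃ K, LipschitzOnWith K (fun q : ℝ × EuclideanSpace ℝ (Fin m) => A q.1 q.2 i j)
      (Ultraparabolic.stripV m T))
    (l : ℝ) (hl : 1 < l)
    (hA_ell : ∀ t ∈ Ioo 0 T, ∀ v, ∀ ξ : EuclideanSpace ℝ (Fin m),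
      l⁻¹ * ‖ξ‖ ^ 2 ≤ ∑ i, ∑ j, A t v i j * ξ i * ξ j ∧
        ∑ i, ∑ j, A t v i j * ξ i * ξ j ≤ l * ‖ξ‖ ^ 2)
    (c : ℝ → EuclideanSpace ℝ (Fin m) → ℝ)
    (hc : MemLp (fun q : ℝ × EuclideanSpace ℝ (Fin m) => c q.1 q.2) ⊤
      (volume.restrict (Ultraparabolic.stripV m T)))
    (d : ℝ → EuclideanSpace ℝ (Fin m) → EuclideanSpace ℝ (Fin m))
    (hd : MemLp (fun q : ℝ × EuclideanSpace ℝ (Fin m) => d q.1 q.2) ⊤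
      (volume.restrict (Ultraparabolic.stripV m T)))
    (u : Ultraparabolic.Space m n → 𝕜)
    (hu : MemLp u 2 (volume.restrict (Ultraparabolic.strip m n T)))
    (G : Fin m → Ultraparabolic.Space m n → 𝕜)
    (hG : ∀ j, MemLp (G j) 2 (volume.restrict (Ultraparabolic.strip m n T)))
    (hGu : ∀ j, Ultraparabolic.IsWeakPartialV T j u (G j))
    (f : Ultraparabolic.Space m n → 𝕜)
    (hf : MemLp f 2 (volume.restrict (Ultraparabolic.strip m n T)))
    (hfu : Ultraparabolic.IsWeakTransport T B₁ B₂ u f)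
    (hsol : Ultraparabolic.IsDistributionalSolution T B₁ B₂ A c d u G)
    (htrace : Ultraparabolic.HasL2TraceAtZero u 0) :
    u =ᵐ[volume.restrict (Ultraparabolic.strip m n T)] 0 := by
  have hl0 : 0 < l := by linarith
  obtain ⟨A', hA'm, hA'symm, ⟨K, hK⟩, hA'⟩ :=
    Ultraparabolic.exists_matrix_extension hA_symm hA_lip hl hA_ell
  obtain ⟨c', hc'm, hc'⟩ := Ultraparabolic.exists_isMultiplier_version hc
  have hdj : ∀ j, MemLp (fun q : ℝ × EuclideanSpace ℝ (Fin m) => d q.1 q.2 j) ⊤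
      (volume.restrict (Ultraparabolic.stripV m T)) := fun j =>
    (EuclideanSpace.proj j : EuclideanSpace ℝ (Fin m) →L[ℝ] ℝ).comp_memLp' hd
  choose d' hd'm hd' using fun j => Ultraparabolic.exists_isMultiplier_version (hdj j)
  have key : ∀ L : 𝕜 →L[ℝ] ℝ, (∀ x, ‖L x‖ ≤ ‖x‖) →
      (fun p => L (u p)) =ᵐ[volume.restrict (Ultraparabolic.strip m n T)] 0 := by
    intro L hL
    refine (Ultraparabolic.stripSystem_of_solution hT hu hG hGu hf hfu hsol htrace
      (A' := fun i j p => A' i j (p.1, p.2.1))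
      (fun i j => Ultraparabolic.isMultiplier_comp_tv (hA'm i j))
      (fun i j p hp => hA' i j (p.1, p.2.1) ⟨hp.1, mem_univ _⟩)
      (Ultraparabolic.isMultiplier_comp_tv hc'm) (Ultraparabolic.ae_strip_of_ae_stripV hc')
      (fun j => Ultraparabolic.isMultiplier_comp_tv (hd'm j))
      (ae_all_iff.2 fun j => Ultraparabolic.ae_strip_of_ae_stripV (hd' j)) hL).ae_eq_zero hT hl0.le
      (fun i j => Ultraparabolic.isMultiplier_comp_tv (hA'm i j))
      (fun i j => Ultraparabolic.invW_comp_tv _) (fun i j p => hA'symm i j _) ⟨K, ?_⟩ ?_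
      (Ultraparabolic.isMultiplier_comp_tv hc'm) (Ultraparabolic.invW_comp_tv _)
      (fun j => Ultraparabolic.isMultiplier_comp_tv (hd'm j))
      (fun j => Ultraparabolic.invW_comp_tv _)
    · intro i j e s
      simpa [Ultraparabolic.dirT] using hK i j e.1 s e.2.1
    · intro e he ξ
      have h1 := (hA_ell e.1 he.1 e.2.1 (WithLp.toLp 2 ξ)).1
      rw [EuclideanSpace.norm_sq_eq, inv_mul_le_iff₀ hl0] at h1
      simp only [Real.norm_eq_abs, sq_abs] at h1
      refine h1.trans_eq ?_
      congr 1
      refine Finset.sum_congr rfl fun i _ => Finset.sum_congr rfl fun j _ => ?_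
      rw [← hA' i j (e.1, e.2.1) ⟨he.1, mem_univ _⟩]
  filter_upwards [key RCLike.reCLM fun x => RCLike.norm_re_le_norm x,
    key RCLike.imCLM fun x => RCLike.norm_im_le_norm x] with p h1 h2
  exact RCLike.ext (by simpa using h1) (by simpa using h2)
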